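/- Let $k$ be a field, let $S=k[x,y]$ with its standard grading, let $d\ge 2$ be an integer, and let $B=\bigoplus_{n\ge 0}S_{nd}\subset S$ be the homogeneous coordinate ring of the rational normal curve of degree $d$, graded by $B_n=S_{nd}$, with homogeneous maximal ideal $\mathfrak m$. For a $B$-module $M$ put $b_i(M)=\dim_k \operatorname{Tor}_i^B(k,M)$ with $k=B/\mathfrak m$, and $b(M)=(b_0(M),b_1(M),b_2(M),b_3(M))\in\mathbb{Q}^4$. Let $\mathbb{B}_{\mathrm{tot}}(B)\subset\mathbb{Q}^4$ be the convex cone (all finite combinations with coefficients in $\mathbb{Q}_{\ge 0}$) generated by the vectors $b(M)$ of the finitely generated $\mathbb{Z}$-graded $B$-modules $M$. For $0\le \ell\le d-1$ let $M^{(\ell)}=\bigoplus_{n\ge 0}S_{nd+\ell}$, a graded $B$-module with degree-$n$ piece $S_{nd+\ell}$. A graded $B$-module $M$ of finite length has a pure resolution of type $(d_0,d_1,d_2;\ell)$ if there is an exact sequence of graded $B$-modules, with maps of degree $0$, $$0\to M^{(\ell)}(-d_2)^{r_2}\to B(-d_1)^{r_1}\to B(-d_0)^{r_0}\to M\to 0$$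 that is minimal, i.e. the images of the first two maps lie in $\mathfrak m B(-d_1)^{r_1}$ and $\mathfrak m B(-d_0)^{r_0}$ respectively. Then: 1. The closure of $\mathbb{B}_{\mathrm{tot}}(B)$ in $\mathbb{Q}^4$ is the polyhedral cone of all $(b_0,b_1,b_2,b_3)\in\mathbb{Q}^4$ with $$b_3\ge 0,\qquad b_2\ge \frac{b_3}{d-1},\qquad b_1\ge b_2-\frac{b_3}{d},\qquad b_0\ge b_1-b_2+\frac{b_3}{d}.$$ 2. The extremal rays of this closure are exactly the rays generated by $(1,0,0,0)$, $(1,1,0,0)$, $(0,1,1,0)$ and $(0,1,d,d(d-1))$. 3. $b(B)=(1,0,0,0)$, and $b(B/(f))=(1,1,0,0)$ for every nonzero homogeneous $f\in B$ of positive degree. 4. No positive multiple of $(0,1,1,0)$ or of $(0,1,d,d(d-1))$ lies in $\mathbb{B}_{\mathrm{tot}}(B)$. 5. The rays generated by $(0,1,1,0)$ and $(0,1,d,d(d-1))$ are limits of rays of pure modules. For every integer $t\ge 1$ there is a nonzero graded $B$-module of finite length with a pure resolution of type $(0,t,t+1;0)$, and every such module has $b(M)$ equal to a positive multiple of $(1,t+1,t,0)$;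 moreover $\tfrac1t(1,t+1,t,0)\to(0,1,1,0)$ as $t\to\infty$. For every $t\ge 1$ there is a nonzero graded $B$-module of finite length with a pure resolution of type $(0,td,td+1;d-1)$, and every such module has $b(M)$ equal to a positive multiple of $(1,td^2+1,td^3,td^3(d-1))$; moreover $\tfrac{1}{td^2}(1,td^2+1,td^3,td^3(d-1))\to(0,1,d,d(d-1))$ as $t\to\infty$. -/

import Mathlib

open CategoryTheory Filter Topology

universe u

noncomputable section

namespace RationalNormalCurve

/-- The polynomial ring `S = k[x, y]`. -/
abbrev S (k : Type u) [Field k] : Type u := MvPolynomial (Fin 2) k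

/-- The homogeneous part `S_n` of `S`, for an integer `n` (it is zero for `n < 0`). -/
def polyPiece (k : Type u) [Field k] (n : ℤ) : Submodule k (S k) :=
  MvPolynomial.weightedHomogeneousSubmodule k (fun _ : Fin 2 => (1 : ℤ)) n

/-- Membership in `S_n`, spelled out: every monomial that occurs has total degree `n`. -/
theorem mem_polyPiece_iff {k : Type u} [Field k] (n : ℤ) (p : S k) :
    p ∈ polyPiece k n ↔ ∀ m ∈ p.support, (m.degree : ℤ) = n := by
  simp [polyPiece, MvPolynomial.mem_weightedHomogeneousSubmodule,
    MvPolynomial.IsWeightedHomogeneous, MvPolynomial.mem_support_iff, Finsupp.weight_apply,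
    Finsupp.degree_apply, Finsupp.sum]

/-- The ring `B = ⨁_{n ≥ 0} S_{nd}`, the homogeneous coordinate ring of the rational normal
curve of degree `d`. -/
def ring (k : Type u) [Field k] (d : ℕ) : Subalgebra k (S k) where
  carrier := {p | ∀ m ∈ p.support, ∃ n : ℕ, m.degree = n * d}
  mul_mem' := by
    classical
    intro p q hp hq m hm
    obtain ⟨a, ha, b, hb, rfl⟩ := Finset.mem_add.1 (MvPolynomial.support_mul p q hm)
    obtain ⟨i, hi⟩ := hp a ha
    obtain ⟨j, hj⟩ := hq b hb
    exact ⟨i + j, by rw [map_add, hi, hj, add_mul]⟩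
  add_mem' := by
    classical
    intro p q hp hq m hm
    rcases Finset.mem_union.1 (MvPolynomial.support_add hm) with h | h
    exacts [hp m h, hq m h]
  algebraMap_mem' := by
    classical
    intro r m hm
    rw [MvPolynomial.algebraMap_eq, MvPolynomial.mem_support_iff, MvPolynomial.coeff_C] at hm
    have h0 : 0 = m := by
      by_contra h
      simp [h] at hm
    exact ⟨0, by simp [← h0]⟩

/-- The underlying type of the ring `B`. -/
def B (k : Type u) [Field k] (d : ℕ) : Type u := ring k d

instance (k : Type u) [Field k] (d : ℕ) : CommRing (B k d) :=
  inferInstanceAs (CommRing (ring k d))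

instance (k : Type u) [Field k] (d : ℕ) : Algebra k (B k d) :=
  inferInstanceAs (Algebra k (ring k d))

instance (k : Type u) [Field k] (d : ℕ) : Algebra (B k d) (S k) :=
  inferInstanceAs (Algebra (ring k d) (S k))

/-- The inclusion of `B` into `S`. -/
def incl (k : Type u) [Field k] (d : ℕ) : B k d →ₐ[k] S k := (ring k d).val

/-- The graded piece `B_n = S_{nd}` of `B`. -/
def ringPiece (k : Type u) [Field k] (d : ℕ) (n : ℤ) : Submodule k (B k d) :=
  (polyPiece k (n * d)).comap (incl k d).toLinearMap

/-- The homogeneous maximal ideal `𝔪` of `B`: the elements without constant term. -/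
def maxIdeal (k : Type u) [Field k] (d : ℕ) : Ideal (B k d) :=
  RingHom.ker ((MvPolynomial.constantCoeff : S k →+* k).comp (incl k d).toRingHom)

/-- The maximal Cohen–Macaulay module `M^{(ℓ)} = ⨁_{n ≥ 0} S_{nd + ℓ}`, as a `B`-submodule of `S`.
Its piece of degree `n` is `S_{nd + ℓ}`. -/
def mcm (k : Type u) [Field k] (d ℓ : ℕ) : Submodule (B k d) (S k) where
  carrier := {p | ∀ m ∈ p.support, ∃ n : ℕ, m.degree = n * d + ℓ}
  add_mem' := by
    classical
    intro p q hp hq m hm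
    rcases Finset.mem_union.1 (MvPolynomial.support_add hm) with h | h
    exacts [hp m h, hq m h]
  zero_mem' := by
    intro m hm
    simp at hm
  smul_mem' := by
    classical
    intro b q hq m hm
    obtain ⟨a, ha, c, hc, rfl⟩ := Finset.mem_add.1 (MvPolynomial.support_mul (incl k d b) q hm)
    obtain ⟨i, hi⟩ := b.2 a ha
    obtain ⟨j, hj⟩ := hq c hc
    exact ⟨i + j, by rw [map_add, hi, hj, add_mul, add_assoc]⟩

/-- A `ℤ`-graded `B`-module. -/
structure GradedModule (k : Type u) [Field k] (d : ℕ) where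
  carrier : Type u
  [addCommGroup : AddCommGroup carrier]
  [module : Module (B k d) carrier]
  piece : ℤ → AddSubgroup carrier
  isInternal : DirectSum.IsInternal piece
  smul_mem : ∀ (i j : ℤ) (b : B k d) (x : carrier),
    b ∈ ringPiece k d i → x ∈ piece j → b • x ∈ piece (i + j)

attribute [instance] GradedModule.addCommGroup GradedModule.module

/-- The total Betti number `b_i(M) = dim_k Tor_i^B(k, M)`, where `k = B/𝔪`. -/
def betti (k : Type u) [Field k] (d i : ℕ) (M : Type u) [AddCommGroup M] [Module (B k d) M] : ℕ :=
  Module.finrank k ((ModuleCat.restrictScalars (algebraMap k (B k d))).obj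
    (((Tor (ModuleCat.{u} (B k d)) i).obj (ModuleCat.of (B k d) (B k d ⧸ maxIdeal k d))).obj
      (ModuleCat.of (B k d) M)))

/-- The vector `(b_0(M), b_1(M), b_2(M), b_3(M))` of total Betti numbers, in `ℚ⁴`. -/
def bettiVec (k : Type u) [Field k] (d : ℕ) (M : Type u) [AddCommGroup M] [Module (B k d) M] :
    Fin 4 → ℚ :=
  fun i => (betti k d i M : ℚ)

/-- The cone generated by the total Betti vectors of the finitely generated graded `B`-modules:
all finite combinations of such vectors with coefficients in `ℚ_{≥ 0}`. -/
def totalBettiCone (k : Type u) [Field k] (d : ℕ) : PointedCone ℚ (Fin 4 → ℚ) :=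
  PointedCone.hull ℚ {v | ∃ M : GradedModule k d,
    Module.Finite (B k d) M.carrier ∧ v = bettiVec k d M.carrier}

/-- `M` has a pure resolution of type `(d₀, d₁, d₂; ℓ)`: it has finite length and there is an exact
sequence of graded modules and maps of degree zero
`0 → M^{(ℓ)}(-d₂)^{r₂} → B(-d₁)^{r₁} → B(-d₀)^{r₀} → M → 0`
which is minimal, that is, the images of `∂₁` and `∂₂` lie in `𝔪 F₀` and `𝔪 F₁`. -/
def HasPureResolution {k : Type u} [Field k] {d : ℕ} (M : GradedModule k d)
    (d₀ d₁ d₂ : ℤ) (ℓ : ℕ) : Prop :=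
  ℓ < d ∧ IsFiniteLength (B k d) M.carrier ∧
  ∃ (r₀ r₁ r₂ : ℕ)
    (ε : (Fin r₀ → B k d) →ₗ[B k d] M.carrier)
    (δ₁ : (Fin r₁ → B k d) →ₗ[B k d] (Fin r₀ → B k d))
    (δ₂ : (Fin r₂ → mcm k d ℓ) →ₗ[B k d] (Fin r₁ → B k d)),
    Function.Surjective ε ∧ Function.Exact δ₁ ε ∧ Function.Exact δ₂ δ₁ ∧ Function.Injective δ₂ ∧
    (∀ (j : ℤ) (v : Fin r₀ → B k d), (∀ a, v a ∈ ringPiece k d (j - d₀)) → ε v ∈ M.piece j) ∧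
    (∀ (j : ℤ) (v : Fin r₁ → B k d), (∀ a, v a ∈ ringPiece k d (j - d₁)) →
      ∀ b, δ₁ v b ∈ ringPiece k d (j - d₀)) ∧
    (∀ (j : ℤ) (v : Fin r₂ → mcm k d ℓ), (∀ a, (v a : S k) ∈ polyPiece k ((j - d₂) * d + ℓ)) →
      ∀ b, δ₂ v b ∈ ringPiece k d (j - d₁)) ∧
    (∀ v b, δ₁ v b ∈ maxIdeal k d) ∧ (∀ v b, δ₂ v b ∈ maxIdeal k d)

/-- The total Betti vectors of the nonzero modules with a pure resolution of the given type. -/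
def pureBettiVecs (k : Type u) [Field k] (d : ℕ) (d₀ d₁ d₂ : ℤ) (ℓ : ℕ) : Set (Fin 4 → ℚ) :=
  {v | ∃ M : GradedModule k d, Nontrivial M.carrier ∧ HasPureResolution M d₀ d₁ d₂ ℓ ∧
    v = bettiVec k d M.carrier}

/-- The ray `ℚ_{≥ 0} · v`. -/
def ray (v : Fin 4 → ℚ) : Set (Fin 4 → ℚ) := {w | ∃ c : ℚ, 0 ≤ c ∧ w = c • v}

/-- `R` is an extremal ray of `C`: a ray spanned by a nonzero vector which is an extreme subset
(a face) of `C`. -/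
def IsExtremalRay (C R : Set (Fin 4 → ℚ)) : Prop :=
  (∃ v : Fin 4 → ℚ, v ≠ 0 ∧ R = ray v) ∧ IsExtreme ℚ C R

end RationalNormalCurve

end

/-! Everything is measured against the subring `k[x^d, y^d]`, over which `B` is finite of rank `d`.
A monomial of degree at least `2d` is divisible by `x^d` or `y^d`, so `𝔪² ⊆ (x^d, y^d)`. Hence `Bbar
= B/(x^d, y^d)` is `k ⊕ n` with `n² = 0` and `dim n = d - 1`.

Take a free resolution `F` of `M`, not necessarily minimal, and reduce it modulo `(x^d, y^d)`. On `n
F` a differential acts as `d - 1` copies of its reduction modulo `𝔪`, and the tail of the complex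
stays exact because the first Koszul homology of a second syzygy vanishes (`FreeRes.ker_redBar`).
Vanishing Koszul homology also makes the dimension of `Z/(x^d, y^d)Z` equal to the rank of the
second syzygy `Z` over `k[x^d, y^d]` (`finrank_quotient_eq_prk`). Counting dimensions yields `b₃ ≤
(d - 1) b₂` (`betti_three_le`) and `d (b₀ - b₁ + b₂) - b₃ = rank M` (`betti_alternating`). Since `0
≤ rank M ≤ d b₀` (`prk_le_betti_zero`), the inequalities of the cone follow.

Conversely the polyhedral cone is simplicial, so it suffices to reach its four generators. Two are
Betti vectors of `B` and `B/(f)`. The other two are limits, obtained from the quotients of `B` by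
the monomials `x^(e(T-i)) y^(ei)`, where `T e = D d`. A Hilbert–Burch argument
(`exists_hilbertBurch`) shows that their syzygies are copies of `M^(ℓ)` with `ℓ = d - e`; the cases
`e = d` and `e = 1` give the two families. For an arbitrary pure module of these types the Hilbert
function in large degrees fixes the ratios of the ranks (`pure_numerics`), and the Betti numbers of
`M^(ℓ)` do the rest.

The limit rays are not attained: `b₀(M) = 0` forces `M = 0` by graded Nakayama, so a vector of the
cone with vanishing first entry is zero. -/

noncomputable section

namespace RationalNormalCurve

/-! ### `Tor` computed from a free resolution -/

section FreeResolutions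

variable (R : Type u) [CommRing R]

/-- A resolution of `M` by finitely generated free modules. -/
structure FreeRes (M : Type u) [AddCommGroup M] [Module R M] where
  n : ℕ → ℕ
  δ : ∀ i, (Fin (n (i + 1)) → R) →ₗ[R] (Fin (n i) → R)
  ε : (Fin (n 0) → R) →ₗ[R] M
  surj : Function.Surjective ε
  exact_zero : Function.Exact (δ 0) ε
  exact : ∀ i, Function.Exact (δ (i + 1)) (δ i)

variable {R} {M : Type u} [AddCommGroup M] [Module R M]

namespace FreeRes

/-- The chain complex of a free resolution. -/
def complex (F : FreeRes R M) : ChainComplex (ModuleCat.{u} R) ℕ :=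
  ChainComplex.of (fun i => ModuleCat.of R (Fin (F.n i) → R)) (fun i => ModuleCat.ofHom (F.δ i))
    (fun i => by
      ext1
      exact (F.exact i).linearMap_comp_eq_zero)

theorem complex_d (F : FreeRes R M) (i : ℕ) :
    F.complex.d (i + 1) i = ModuleCat.ofHom (F.δ i) := by
  exact ChainComplex.of_d (fun i => ModuleCat.of R (Fin (F.n i) → R))
    (fun i => ModuleCat.ofHom (F.δ i)) i

theorem complex_exactAt_succ (F : FreeRes R M) (i : ℕ) : F.complex.ExactAt (i + 1) := by
  rw [HomologicalComplex.exactAt_iff' _ (i + 1 + 1) (i + 1) i (by simp) (by simp),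
    ShortComplex.ShortExact.moduleCat_exact_iff_function_exact]
  change Function.Exact (F.complex.d (i + 1 + 1) (i + 1)).hom (F.complex.d (i + 1) i).hom
  rw [complex_d, complex_d]
  exact F.exact i

/-- The projective resolution given by a free resolution. -/
def projectiveResolution (F : FreeRes R M) : ProjectiveResolution (ModuleCat.of R M) where
  complex := F.complex
  projective i := by
    change Projective (ModuleCat.of R (Fin (F.n i) → R))
    exact ModuleCat.projective_of_free (Pi.basisFun R (Fin (F.n i)))
  π := (ChainComplex.toSingle₀Equiv _ _).symm ⟨ModuleCat.ofHom F.ε, by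
          rw [complex_d]
          ext1
          exact F.exact_zero.linearMap_comp_eq_zero⟩
  quasiIso := ⟨fun n => by
    cases n
    · rw [ChainComplex.quasiIsoAt₀_iff, ShortComplex.quasiIso_iff_of_zeros']
      · refine ⟨?_, ?_⟩
        · rw [ShortComplex.ShortExact.moduleCat_exact_iff_function_exact]
          change Function.Exact (F.complex.d 1 0).hom F.ε
          rw [complex_d]
          exact F.exact_zero
        · rw [ModuleCat.epi_iff_surjective]
          exact F.surj
      all_goals rfl
    · rw [quasiIsoAt_iff_exactAt']
      · apply F.complex_exactAt_succ
      · apply ChainComplex.exactAt_succ_single_obj⟩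

open MonoidalCategory in
/-- `Tor` in positive degree, computed by a free resolution. -/
theorem tor_succ (F : FreeRes R M) (X : Type u) [AddCommGroup X] [Module R X] (i : ℕ) :
    ∃ h : (LinearMap.lTensor X (F.δ i)) ∘ₗ (LinearMap.lTensor X (F.δ (i + 1))) = 0,
    Nonempty ((((Tor (ModuleCat.{u} R) (i + 1)).obj (ModuleCat.of R X)).obj (ModuleCat.of R M)) ≃ₗ[R]
      (LinearMap.ker (LinearMap.lTensor X (F.δ i)) ⧸
        LinearMap.range ((LinearMap.lTensor X (F.δ (i + 1))).codRestrict
          (LinearMap.ker (LinearMap.lTensor X (F.δ i))) (fun v => LinearMap.congr_fun h v)))) := by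
  have h : (LinearMap.lTensor X (F.δ i)) ∘ₗ (LinearMap.lTensor X (F.δ (i + 1))) = 0 := by
    rw [← LinearMap.lTensor_comp, (F.exact i).linearMap_comp_eq_zero, LinearMap.lTensor_zero]
  refine ⟨h, ?_⟩
  let G := (tensoringLeft (ModuleCat.{u} R)).obj (ModuleCat.of R X)
  let K := (G.mapHomologicalComplex (ComplexShape.down ℕ)).obj F.complex
  let e1 := F.projectiveResolution.isoLeftDerivedObj G (i + 1)
  let e2 : K.homology (i + 1) ≅ (K.sc' (i + 1 + 1) (i + 1) i).homology :=
    ShortComplex.homologyMapIso (K.isoSc' (i + 1 + 1) (i + 1) i (by simp) (by simp))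
  let T : ShortComplex (ModuleCat.{u} R) := ShortComplex.moduleCatMk
    (LinearMap.lTensor X (F.δ (i + 1))) (LinearMap.lTensor X (F.δ i)) h
  let e3 : K.sc' (i + 1 + 1) (i + 1) i ≅ T := ShortComplex.isoMk (Iso.refl _) (Iso.refl _)
    (Iso.refl _) (by
      refine (Category.id_comp _).trans (Eq.trans ?_ (Category.comp_id _).symm)
      exact (congrArg G.map (F.complex_d (i + 1))).symm) (by
      refine (Category.id_comp _).trans (Eq.trans ?_ (Category.comp_id _).symm)
      exact (congrArg G.map (F.complex_d i)).symm)
  exact ⟨(e1 ≪≫ e2 ≪≫ ShortComplex.homologyMapIso e3 ≪≫ T.moduleCatHomologyIso).toLinearEquiv⟩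

open MonoidalCategory in
/-- `Tor` in degree zero, computed by a free resolution. -/
theorem tor_zero (F : FreeRes R M) (X : Type u) [AddCommGroup X] [Module R X] :
    Nonempty ((((Tor (ModuleCat.{u} R) 0).obj (ModuleCat.of R X)).obj (ModuleCat.of R M)) ≃ₗ[R]
      (TensorProduct R X (Fin (F.n 0) → R) ⧸ LinearMap.range (LinearMap.lTensor X (F.δ 0)))) := by
  let G := (tensoringLeft (ModuleCat.{u} R)).obj (ModuleCat.of R X)
  -- Tensoring is a left adjoint, hence right exact, so its zeroth left derived functor is the
  -- functor itself.
  have : Limits.PreservesColimitsOfSize.{0, 0} G :=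
    (ihom.adjunction (ModuleCat.of R X)).leftAdjoint_preservesColimits
  have : Limits.PreservesFiniteColimits G :=
    Limits.PreservesColimitsOfSize0.preservesFiniteColimits G
  let e1 := (G.leftDerivedZeroIsoSelf).app (ModuleCat.of R M)
  have hex := lTensor_exact X F.exact_zero F.surj
  let e2 : (TensorProduct R X (Fin (F.n 0) → R) ⧸ LinearMap.range (LinearMap.lTensor X (F.δ 0)))
      ≃ₗ[R] TensorProduct R X M :=
    (Submodule.quotEquivOfEq _ _ (LinearMap.exact_iff.1 hex).symm).trans
    (LinearMap.quotKerEquivOfSurjective _ (LinearMap.lTensor_surjective X F.surj))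
  exact ⟨e1.toLinearEquiv.trans e2.symm⟩

end FreeRes
end FreeResolutions

/-! ### Reduction of free complexes along an augmentation -/

section Reduction

variable {k : Type u} [Field k] {R : Type u} [CommRing R] [Algebra k R]

/-- The reduction of a map of free `R`-modules along `e : R →ₐ[k] k`. -/
def red (e : R →ₐ[k] k) {a b : ℕ} (δ : (Fin a → R) →ₗ[R] (Fin b → R)) :
    (Fin a → k) →ₗ[k] (Fin b → k) :=
  (e.toLinearMap.compLeft (Fin b)) ∘ₗ (δ.restrictScalars k) ∘ₗ
    ((Algebra.linearMap k R).compLeft (Fin a))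

theorem linearMap_apply_eq_sum {a : ℕ} {N : Type*} [AddCommGroup N] [Module R N]
    (δ : (Fin a → R) →ₗ[R] N) (v : Fin a → R) :
    δ v = ∑ i, v i • δ (Pi.single i 1) := by
  conv_lhs => rw [← Finset.univ_sum_single v, map_sum]
  refine Finset.sum_congr rfl fun i _ => ?_
  rw [← map_smul, ← Pi.single_smul, smul_eq_mul, mul_one]

/-- The map `δ` is given by a matrix over `R`, and `e` is a ring homomorphism, so the choice of lift
of a vector over `k` is immaterial. -/
theorem red_apply (e : R →ₐ[k] k) {a b : ℕ} (δ : (Fin a → R) →ₗ[R] (Fin b → R))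
    (v : Fin a → R) : red e δ (fun i => e (v i)) = fun j => e (δ v j) := by
  funext j
  have h : red e δ (fun i => e (v i)) j = e (δ (fun i => algebraMap k R (e (v i))) j) := rfl
  rw [h, linearMap_apply_eq_sum δ, linearMap_apply_eq_sum δ v]
  simp

/-- The quotient by the kernel of `e : R →ₐ[k] k` is `k`. -/
def residueEquiv (e : R →ₐ[k] k) (m : Ideal R) (hm : ∀ r, r ∈ m ↔ e r = 0) : (R ⧸ m) ≃ₗ[k] k :=
  (Submodule.Quotient.restrictScalarsEquiv k m).symm.trans
    ((Submodule.quotEquivOfEq (m.restrictScalars k) (LinearMap.ker e.toLinearMap) (by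
      ext r
      simp [hm])).trans
    (e.toLinearMap.quotKerEquivOfSurjective fun c => ⟨algebraMap k R c, by simp⟩))

theorem residueEquiv_mk (e : R →ₐ[k] k) (m : Ideal R) (hm : ∀ r, r ∈ m ↔ e r = 0) (r : R) :
    residueEquiv e m hm (Ideal.Quotient.mk m r) = e r := rfl

/-- The reduction of a free module, as a tensor product. -/
def tensorEquiv (e : R →ₐ[k] k) (m : Ideal R) (hm : ∀ r, r ∈ m ↔ e r = 0) (n : ℕ) :
    TensorProduct R (R ⧸ m) (Fin n → R) ≃ₗ[k] (Fin n → k) :=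
  ((TensorProduct.piScalarRight R R (R ⧸ m) (Fin n)).restrictScalars k).trans
    (LinearEquiv.piCongrRight fun _ => residueEquiv e m hm)

theorem tensorEquiv_tmul (e : R →ₐ[k] k) (m : Ideal R) (hm : ∀ r, r ∈ m ↔ e r = 0) (n : ℕ) (r : R)
    (v : Fin n → R) :
    tensorEquiv e m hm n (Ideal.Quotient.mk m r ⊗ₜ[R] v) = e r • fun i => e (v i) := by
  funext i
  have h : v i • (Ideal.Quotient.mk m r) = Ideal.Quotient.mk m (v i * r) := rfl
  simp only [tensorEquiv, LinearEquiv.trans_apply, LinearEquiv.restrictScalars_apply,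
    TensorProduct.piScalarRight_apply,
    TensorProduct.piScalarRightHom_tmul, LinearEquiv.piCongrRight_apply, h, residueEquiv_mk]
  simp [mul_comm]

theorem tensorEquiv_lTensor (e : R →ₐ[k] k) (m : Ideal R) (hm : ∀ r, r ∈ m ↔ e r = 0) {a b : ℕ}
    (δ : (Fin a → R) →ₗ[R] (Fin b → R)) (z : TensorProduct R (R ⧸ m) (Fin a → R)) :
    tensorEquiv e m hm b (LinearMap.lTensor (R ⧸ m) δ z) = red e δ (tensorEquiv e m hm a z) := by
  induction z with
  | zero => simp
  | add x y hx hy => simp only [map_add, hx, hy]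
  | tmul r v =>
    obtain ⟨r, rfl⟩ := Ideal.Quotient.mk_surjective r
    rw [LinearMap.lTensor_tmul, tensorEquiv_tmul, tensorEquiv_tmul, map_smul, red_apply]

/-- Rank–nullity for the homology at `V₂`. The homology is formed over `R`, where `Tor` lives, while
dimensions are taken over `k`. -/
theorem finrank_homology_aux {V₁ V₂ V₃ : Type*} [AddCommGroup V₁] [AddCommGroup V₂]
    [AddCommGroup V₃] [Module R V₁] [Module R V₂] [Module R V₃] [Module k V₁] [Module k V₂]
    [Module k V₃] [IsScalarTower k R V₁] [IsScalarTower k R V₂] [IsScalarTower k R V₃]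
    [Module.Finite k V₂] (f : V₁ →ₗ[R] V₂) (g : V₂ →ₗ[R] V₃) (h : ∀ v, f v ∈ LinearMap.ker g) :
    Module.finrank k (LinearMap.ker g ⧸ LinearMap.range (f.codRestrict (LinearMap.ker g) h))
      + Module.finrank k (LinearMap.range (g.restrictScalars k))
      + Module.finrank k (LinearMap.range (f.restrictScalars k)) = Module.finrank k V₂ := by
  have : Module.Finite k (LinearMap.ker g) :=
    inferInstanceAs (Module.Finite k (LinearMap.ker (g.restrictScalars k)))
  have h1 := (g.restrictScalars k).finrank_range_add_finrank_ker
  have h2 := Submodule.finrank_quotient_add_finrank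
    ((LinearMap.range (f.codRestrict (LinearMap.ker g) h)).restrictScalars k)
  rw [(Submodule.Quotient.restrictScalarsEquiv k _).finrank_eq] at h2
  have h3 : Module.finrank k
      ((LinearMap.range (f.codRestrict (LinearMap.ker g) h)).restrictScalars k) =
      Module.finrank k (LinearMap.range (f.restrictScalars k)) := by
    let j : LinearMap.ker g →ₗ[k] V₂ := (LinearMap.ker g).subtype.restrictScalars k
    have hj : Function.Injective j := Subtype.val_injective
    have hmap : Submodule.map j
        ((LinearMap.range (f.codRestrict (LinearMap.ker g) h)).restrictScalars k) =
        LinearMap.range (f.restrictScalars k) := by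
      ext w
      constructor
      · rintro ⟨_, ⟨z, rfl⟩, rfl⟩
        exact ⟨z, rfl⟩
      · rintro ⟨z, rfl⟩
        exact ⟨_, ⟨z, rfl⟩, rfl⟩
    rw [← hmap]
    exact (Submodule.equivMapOfInjective j hj _).finrank_eq
  have h4 : Module.finrank k (LinearMap.ker (g.restrictScalars k)) =
    Module.finrank k (LinearMap.ker g) := rfl
  omega

theorem finrank_range_lTensor (e : R →ₐ[k] k) (m : Ideal R) (hm : ∀ r, r ∈ m ↔ e r = 0) {a b : ℕ}
    (δ : (Fin a → R) →ₗ[R] (Fin b → R)) :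
    Module.finrank k (LinearMap.range ((LinearMap.lTensor (R ⧸ m) δ).restrictScalars k)) =
      Module.finrank k (LinearMap.range (red e δ)) := by
  refine LinearEquiv.finrank_eq ((tensorEquiv e m hm b).ofSubmodules _ _ ?_)
  ext w
  constructor
  · rintro ⟨_, ⟨z, rfl⟩, rfl⟩
    exact ⟨_, (tensorEquiv_lTensor e m hm δ z).symm⟩
  · rintro ⟨w, rfl⟩
    obtain ⟨z, rfl⟩ := (tensorEquiv e m hm a).surjective w
    exact ⟨_, ⟨z, rfl⟩, tensorEquiv_lTensor e m hm δ z⟩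

/-- The rank of the reduction of a differential. -/
def FreeRes.rho (e : R →ₐ[k] k) {M : Type u} [AddCommGroup M] [Module R M] (F : FreeRes R M)
    (i : ℕ) : ℕ :=
  Module.finrank k (LinearMap.range (red e (F.δ i)))

theorem finrank_restrictScalars_of_equiv (T : ModuleCat.{u} R) (Q : Type u) [AddCommGroup Q]
    [Module R Q] [Module k Q] [IsScalarTower k R Q] (φ : T ≃ₗ[R] Q) :
    Module.finrank k ((ModuleCat.restrictScalars (algebraMap k R)).obj T) = Module.finrank k Q := by
  refine LinearEquiv.finrank_eq
    ({ φ.toAddEquiv with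
        map_smul' := fun c x => (φ.map_smul (algebraMap k R c) x).trans (algebraMap_smul R c _) } :
      ((ModuleCat.restrictScalars (algebraMap k R)).obj T) ≃ₗ[k] Q)

variable (e : R →ₐ[k] k) (m : Ideal R)
  {M : Type u} [AddCommGroup M] [Module R M] (F : FreeRes R M)

/-- The resolution need not be minimal, so the Betti number is the rank of the free module minus the
ranks of the adjacent reduced differentials. At the end of the complex there is only one such
differential. -/
theorem FreeRes.finrank_tor_zero (hm : ∀ r, r ∈ m ↔ e r = 0) :
    Module.finrank k ((ModuleCat.restrictScalars (algebraMap k R)).obj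
    (((Tor (ModuleCat.{u} R) 0).obj (ModuleCat.of R (R ⧸ m))).obj (ModuleCat.of R M)))
      + F.rho e 0 = F.n 0 := by
  obtain ⟨φ⟩ := F.tor_zero (R ⧸ m)
  have : Module.Finite k (TensorProduct R (R ⧸ m) (Fin (F.n 0) → R)) :=
    Module.Finite.equiv (tensorEquiv e m hm (F.n 0)).symm
  rw [finrank_restrictScalars_of_equiv _ _ φ, FreeRes.rho, ← finrank_range_lTensor e m hm]
  have h := Submodule.finrank_quotient_add_finrank
    (LinearMap.range ((LinearMap.lTensor (R ⧸ m) (F.δ 0)).restrictScalars k))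
  rw [(tensorEquiv e m hm (F.n 0)).finrank_eq, Module.finrank_fin_fun] at h
  exact h

theorem FreeRes.finrank_tor_succ (hm : ∀ r, r ∈ m ↔ e r = 0) (i : ℕ) :
    Module.finrank k ((ModuleCat.restrictScalars (algebraMap k R)).obj
    (((Tor (ModuleCat.{u} R) (i + 1)).obj (ModuleCat.of R (R ⧸ m))).obj (ModuleCat.of R M)))
      + F.rho e i + F.rho e (i + 1) = F.n (i + 1) := by
  obtain ⟨h, ⟨φ⟩⟩ := F.tor_succ (R ⧸ m) i
  have : Module.Finite k (TensorProduct R (R ⧸ m) (Fin (F.n (i + 1)) → R)) :=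
    Module.Finite.equiv (tensorEquiv e m hm (F.n (i + 1))).symm
  have h1 := finrank_homology_aux (k := k) (LinearMap.lTensor (R ⧸ m) (F.δ (i + 1)))
    (LinearMap.lTensor (R ⧸ m) (F.δ i)) (fun v => LinearMap.congr_fun h v)
  rw [finrank_range_lTensor e m hm, finrank_range_lTensor e m hm,
    (tensorEquiv e m hm (F.n (i + 1))).finrank_eq, Module.finrank_fin_fun] at h1
  rw [finrank_restrictScalars_of_equiv _ _ φ]
  exact h1

end Reduction

/-! ### Construction of free resolutions -/

section FreeResolutionConstructions

variable {R : Type u} [CommRing R]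

namespace FreeRes

/-- The resolution of a free module of finite rank. -/
def ofFree {M : Type u} [AddCommGroup M] [Module R M] (r : ℕ) (φ : (Fin r → R) ≃ₗ[R] M) :
    FreeRes R M where
  n := fun i => Nat.casesOn i r fun _ => 0
  δ := fun _ => 0
  ε := φ.toLinearMap
  surj := φ.surjective
  exact_zero := fun v => by
    constructor
    · intro h
      exact ⟨0, (φ.injective (h.trans (map_zero φ).symm)).symm⟩
    · rintro ⟨w, rfl⟩
      exact map_zero φ
  exact := fun i v => by
    refine ⟨fun _ => ⟨0, ?_⟩, fun _ => rfl⟩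
    funext a
    exact a.elim0

/-- Splicing a resolution of `Z` with an exact sequence `0 → Z → R^r → M → 0`. -/
def splice {M Z : Type u} [AddCommGroup M] [Module R M] [AddCommGroup Z] [Module R Z]
    (F : FreeRes R Z) {r : ℕ} (ι : Z →ₗ[R] (Fin r → R)) (π : (Fin r → R) →ₗ[R] M)
    (hι : Function.Injective ι) (hπ : Function.Surjective π) (h : Function.Exact ι π) :
    FreeRes R M where
  n := fun i => Nat.casesOn i r F.n
  δ := fun i => match i with
    | 0 => ι ∘ₗ F.ε
    | i + 1 => F.δ i
  ε := π
  surj := hπ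
  exact_zero := fun v => by
    rw [h v]
    constructor
    · rintro ⟨z, rfl⟩
      obtain ⟨w, rfl⟩ := F.surj z
      exact ⟨w, rfl⟩
    · rintro ⟨w, rfl⟩
      exact ⟨_, rfl⟩
  exact := fun i => match i with
    | 0 => fun v => by
        rw [← F.exact_zero v]
        change ι (F.ε v) = 0 ↔ _
        rw [map_eq_zero_iff ι hι]
    | i + 1 => F.exact i

theorem exists_surjective (M : Type u) [AddCommGroup M] [Module R M] [Module.Finite R M] :
    ∃ (r : ℕ) (f : (Fin r → R) →ₗ[R] M), Function.Surjective f :=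
  Module.Finite.exists_fin' R M

/-- The stages of the construction of a free resolution: a submodule of a free module. -/
structure Stage (R : Type u) [CommRing R] where
  r : ℕ
  Z : Submodule R (Fin r → R)

variable [IsNoetherianRing R]

/-- The rank of a free module that surjects onto the submodule of a stage. -/
def Stage.rank (s : Stage R) : ℕ := (exists_surjective (R := R) s.Z).choose

/-- A free module that surjects onto the submodule of a stage. -/
def Stage.cover (s : Stage R) : (Fin s.rank → R) →ₗ[R] s.Z :=
  (exists_surjective (R := R) s.Z).choose_spec.choose

theorem Stage.cover_surjective (s : Stage R) : Function.Surjective s.cover :=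
  (exists_surjective (R := R) s.Z).choose_spec.choose_spec

/-- The next stage. -/
def Stage.next (s : Stage R) : Stage R := ⟨s.rank, LinearMap.ker s.cover⟩

theorem nonempty (M : Type u) [AddCommGroup M] [Module R M] [Module.Finite R M] :
    Nonempty (FreeRes R M) := by
  obtain ⟨r, f, hf⟩ := exists_surjective (R := R) M
  -- Stage `i` is the `i`-th free module together with the kernel still to be covered. The
  -- differential is the chosen cover of that kernel followed by the inclusion.
  let s : ℕ → Stage R := fun i => Nat.rec ⟨r, LinearMap.ker f⟩ (fun _ => Stage.next) i
  refine ⟨⟨fun i => (s i).r, fun i => (s i).Z.subtype ∘ₗ (s i).cover, f, hf, ?_, ?_⟩⟩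
  · intro v
    constructor
    · intro h
      obtain ⟨w, hw⟩ := (s 0).cover_surjective ⟨v, h⟩
      exact ⟨w, congrArg Subtype.val hw⟩
    · rintro ⟨w, rfl⟩
      exact ((s 0).cover w).2
  · intro i v
    constructor
    · intro h
      obtain ⟨w, hw⟩ := (s (i + 1)).cover_surjective ⟨v, Subtype.ext h⟩
      exact ⟨w, congrArg Subtype.val hw⟩
    · rintro ⟨w, rfl⟩
      exact congrArg Subtype.val ((s (i + 1)).cover w).2

end FreeRes

end FreeResolutionConstructions

/-! ### Betti numbers over `B` and the augmentation -/

section Betti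

variable {k : Type u} [Field k] {d : ℕ}

/-- The constant coefficient of an element of `B`. -/
def constCoeff (k : Type u) [Field k] (d : ℕ) : B k d →ₐ[k] k :=
  (MvPolynomial.aeval (fun _ : Fin 2 => (0 : k))).comp (incl k d)

theorem constCoeff_apply (f : B k d) :
    constCoeff k d f = MvPolynomial.constantCoeff (incl k d f) := by
  simp [constCoeff]

theorem mem_maxIdeal_iff (f : B k d) : f ∈ maxIdeal k d ↔ constCoeff k d f = 0 := by
  rw [constCoeff_apply]
  rfl

variable {M : Type u} [AddCommGroup M] [Module (B k d) M] (F : FreeRes (B k d) M)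

theorem betti_zero : betti k d 0 M + F.rho (constCoeff k d) 0 = F.n 0 :=
  F.finrank_tor_zero _ _ mem_maxIdeal_iff

theorem betti_succ (i : ℕ) :
    betti k d (i + 1) M + F.rho (constCoeff k d) i + F.rho (constCoeff k d) (i + 1) =
      F.n (i + 1) :=
  F.finrank_tor_succ _ _ mem_maxIdeal_iff i

end Betti

/-! ### Koszul homology and rank over a two-dimensional base -/

section Koszul

variable {k A : Type*} [Field k] [CommRing A] [Algebra k A] (e : A →ₐ[k] k)
  {J : Ideal A} {N : Type*} [AddCommGroup N] [Module A N] [Module k N] [IsScalarTower k A N]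

theorem sub_algebraMap_mem_of_ker (hJ : ∀ r, r ∈ J ↔ e r = 0) (r : A) :
    r - algebraMap k A (e r) ∈ J := by
  simp [hJ]

theorem smul_sub_smul_mem (hJ : ∀ r, r ∈ J ↔ e r = 0) (r : A) (n : N) :
    r • n - e r • n ∈ J • (⊤ : Submodule A N) := by
  rw [← algebraMap_smul A (e r) n, ← sub_smul]
  exact Submodule.smul_mem_smul (sub_algebraMap_mem_of_ker e hJ r) trivial

theorem mk_sum_smul_eq (hJ : ∀ r, r ∈ J ↔ e r = 0) {n : ℕ} (v : Fin n → A) (z : Fin n → N) :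
    (Submodule.Quotient.mk (∑ i, v i • z i) : N ⧸ (J • (⊤ : Submodule A N))) =
      ∑ i, e (v i) • Submodule.Quotient.mk (z i) := by
  let q : N →ₗ[k] (N ⧸ (J • (⊤ : Submodule A N))) :=
    (J • (⊤ : Submodule A N)).mkQ.restrictScalars k
  have h : q (∑ i, v i • z i) = ∑ i, e (v i) • q (z i) := by
    simp only [← map_smul, ← map_sum]
    refine (Submodule.Quotient.eq _).2 ?_
    rw [← Finset.sum_sub_distrib]
    exact Submodule.sum_mem _ fun i _ => smul_sub_smul_mem e hJ _ _
  exact h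

/-- A finitely generated module is finite-dimensional modulo the kernel of an augmentation. -/
theorem finite_quotient_smul_top (hJ : ∀ r, r ∈ J ↔ e r = 0) [Module.Finite A N] :
    Module.Finite k (N ⧸ (J • (⊤ : Submodule A N))) := by
  obtain ⟨n, f, hf⟩ := Module.Finite.exists_fin' A N
  let g : (Fin n → k) →ₗ[k] (N ⧸ (J • (⊤ : Submodule A N))) :=
    Fintype.linearCombination k fun i => Submodule.Quotient.mk (f (Pi.single i 1))
  refine Module.Finite.of_surjective g fun x => ?_
  obtain ⟨x, rfl⟩ := Submodule.Quotient.mk_surjective _ x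
  obtain ⟨v, rfl⟩ := hf x
  refine ⟨fun i => e (v i), ?_⟩
  rw [linearMap_apply_eq_sum f v, mk_sum_smul_eq e hJ]
  rfl

/-- A module killed by a nonzero element of a domain has rank zero. -/
theorem finrank_eq_zero_of_smul_eq_zero [IsDomain A] {s : A} (hs : s ≠ 0)
    (h : ∀ n : N, s • n = 0) : Module.finrank A N = 0 := by
  have h1 : Module.rank A N = 0 := by
    rw [rank_eq_zero_iff]
    exact fun x => ⟨s, hs, h x⟩
  rw [Module.finrank, h1, map_zero]

variable [IsDomain A] [IsNoetherianRing A] [Module.Finite A N] {a b : A}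

/-- If the first Koszul homology of `a, b` on `N` vanishes, then `N ⧸ (a, b) N` has dimension
`rank N`. -/
theorem finrank_quotient_eq_finrank (hJ : ∀ r, r ∈ J ↔ e r = 0) (hab : J = Ideal.span {a, b})
    (hN : ∀ p q : N, a • p + b • q = 0 → ∃ w : N, p = b • w ∧ q = -(a • w)) :
    Module.finrank k (N ⧸ (J • (⊤ : Submodule A N))) = Module.finrank A N := by
  have hfin : Module.Finite k (N ⧸ (J • (⊤ : Submodule A N))) := finite_quotient_smul_top e hJ
  set r := Module.finrank k (N ⧸ (J • (⊤ : Submodule A N))) with hr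
  let β := Module.finBasis k (N ⧸ (J • (⊤ : Submodule A N)))
  choose z hz using fun i => Submodule.Quotient.mk_surjective _ (β i)
  -- Lift a basis of `N/JN` to `N`. The aim is that `φ` is injective with a cokernel killed by an
  -- element of `1 + J`. This is the local freeness of `N`, proved without localizing.
  let φ : (Fin r → A) →ₗ[A] N := Fintype.linearCombination A z
  have hφ : ∀ v : Fin r → A, (Submodule.Quotient.mk (φ v) : N ⧸ (J • (⊤ : Submodule A N))) =
      ∑ i, e (v i) • β i := by
    intro v
    simp only [φ, Fintype.linearCombination_apply, mk_sum_smul_eq e hJ, hz]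
  -- Nakayama for the cokernel of `φ`, which equals `J` times itself.
  obtain ⟨s, hs1, hs⟩ : ∃ s : A, s - 1 ∈ J ∧ ∀ n : N, ∃ v, φ v = s • n := by
    obtain ⟨s, hs1, hs⟩ := Submodule.exists_sub_one_mem_and_smul_eq_zero_of_fg_of_le_smul J
      (⊤ : Submodule A (N ⧸ LinearMap.range φ)) Module.Finite.fg_top (by
        rintro x -
        obtain ⟨n, rfl⟩ := Submodule.Quotient.mk_surjective _ x
        let c : Fin r → A := fun i => algebraMap k A (β.repr (Submodule.Quotient.mk n) i)
        have h1 : n - φ c ∈ J • (⊤ : Submodule A N) := by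
          rw [← Submodule.Quotient.eq, hφ]
          simp [c]
        have h2 := Submodule.mem_map_of_mem (f := (LinearMap.range φ).mkQ) h1
        rw [Submodule.map_smul''] at h2
        have h3 : (LinearMap.range φ).mkQ (n - φ c) = Submodule.Quotient.mk n := by
          rw [Submodule.mkQ_apply, Submodule.Quotient.eq]
          exact ⟨-c, by simp⟩
        rw [h3] at h2
        exact Submodule.smul_mono le_rfl le_top h2)
    refine ⟨s, hs1, fun n => ?_⟩
    have := hs (Submodule.Quotient.mk n) trivial
    rwa [← Submodule.Quotient.mk_smul, Submodule.Quotient.mk_eq_zero] at this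
  have hone : ∀ t : A, t - 1 ∈ J → t ≠ 0 := by
    rintro t ht rfl
    simp [hJ] at ht
  -- A relation has all entries in `J`, so it is `a p + b q`. Then `(φ p, φ q)` is a Koszul cycle,
  -- hence of the form `(b w, -a w)`; since `s w = φ t`, the vectors `p` and `q`, after
  -- multiplication by `s`, can be corrected to lie in the kernel.
  have hker : LinearMap.ker φ ≤ J • LinearMap.ker φ := by
    intro v hv
    have h1 : ∀ i, ∃ p q, p * a + q * b = v i := by
      intro i
      rw [← Ideal.mem_span_pair, ← hab, hJ]
      have h2 := hφ v
      rw [LinearMap.mem_ker.1 hv, Submodule.Quotient.mk_zero, eq_comm] at h2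
      exact Fintype.linearIndependent_iff.1 β.linearIndependent _ h2 i
    choose p q hpq using h1
    have h2 : a • φ p + b • φ q = 0 := by
      rw [← map_smul, ← map_smul, ← map_add, ← LinearMap.mem_ker.1 hv]
      congr 1
      funext i
      simp [← hpq, mul_comm]
    obtain ⟨w, hw1, hw2⟩ := hN _ _ h2
    obtain ⟨t, ht⟩ := hs w
    have h3 : s • p - b • t ∈ LinearMap.ker φ := by
      rw [LinearMap.mem_ker, map_sub, map_smul, map_smul, ht, hw1, smul_comm, sub_self]
    have h4 : s • q + a • t ∈ LinearMap.ker φ := by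
      rw [LinearMap.mem_ker, map_add, map_smul, map_smul, ht, hw2, smul_neg, smul_comm,
        neg_add_cancel]
    have ha : a ∈ J := hab ▸ Ideal.subset_span (by simp)
    have hb : b ∈ J := hab ▸ Ideal.subset_span (by simp)
    have h5 : v = a • (s • p - b • t) + b • (s • q + a • t) - (s - 1) • v := by
      funext i
      simp only [Pi.add_apply, Pi.sub_apply, Pi.smul_apply, smul_eq_mul, ← hpq]
      ring
    rw [h5]
    exact Submodule.sub_mem _ (Submodule.add_mem _ (Submodule.smul_mem_smul ha h3)
      (Submodule.smul_mem_smul hb h4)) (Submodule.smul_mem_smul hs1 hv)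
  -- Nakayama again: an element of `1 + J` kills the kernel. It is nonzero and acts injectively on a
  -- free module over a domain.
  have hinj : Function.Injective φ := by
    rw [← LinearMap.ker_eq_bot, eq_bot_iff]
    intro v hv
    obtain ⟨t, ht1, ht⟩ := Submodule.exists_sub_one_mem_and_smul_eq_zero_of_fg_of_le_smul J
      (LinearMap.ker φ) (IsNoetherian.noetherian _) hker
    exact (smul_eq_zero.1 (ht v hv)).resolve_left (hone t ht1)
  have h1 := Submodule.finrank_quotient_add_finrank (LinearMap.range φ)
  rw [finrank_eq_zero_of_smul_eq_zero (hone s hs1), LinearMap.finrank_range_of_inj hinj,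
    Module.finrank_fin_fun, zero_add] at h1
  · exact h1
  · intro n
    obtain ⟨n, rfl⟩ := Submodule.Quotient.mk_surjective _ n
    rw [← Submodule.Quotient.mk_smul, Submodule.Quotient.mk_eq_zero]
    exact hs n

end Koszul

/-! ### Monomials, the parameters `x^d`, `y^d`, and the modules `M^(ℓ)` -/

section Ring

variable {k : Type u} [Field k] {d : ℕ}

/-- An element of `B` given by a polynomial. -/
def mkB (p : S k) (h : p ∈ ring k d) : B k d := ⟨p, h⟩

@[simp]
theorem incl_mkB (p : S k) (h : p ∈ ring k d) : incl k d (mkB p h) = p := rfl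

theorem incl_mem (b : B k d) : incl k d b ∈ ring k d := b.2

theorem incl_injective : Function.Injective (incl k d) := Subtype.val_injective

instance : IsDomain (B k d) := inferInstanceAs (IsDomain (ring k d))

theorem mem_mcm_zero_iff (p : S k) : p ∈ mcm k d 0 ↔ p ∈ ring k d := Iff.rfl

@[simp]
theorem coe_smul_mcm {ℓ : ℕ} (b : B k d) (p : mcm k d ℓ) :
    ((b • p : mcm k d ℓ) : S k) = incl k d b * p := rfl

theorem monomial_mem_ring {m : Fin 2 →₀ ℕ} {n : ℕ} (h : m.degree = n * d) (c : k) :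
    MvPolynomial.monomial m c ∈ ring k d := by
  intro m' hm'
  rw [Finset.mem_singleton.1 (MvPolynomial.support_monomial_subset hm')]
  exact ⟨n, h⟩

theorem X_pow_mem_ring (i : Fin 2) (n : ℕ) : (MvPolynomial.X i ^ (n * d) : S k) ∈ ring k d := by
  rw [MvPolynomial.X_pow_eq_monomial]
  exact monomial_mem_ring (n := n) (by rw [Finsupp.degree_single]) 1

/-- The element `x ^ d` (for `i = 0`) or `y ^ d` (for `i = 1`) of `B`. -/
def pw (k : Type u) [Field k] (d : ℕ) (i : Fin 2) : B k d :=
  mkB (MvPolynomial.X i ^ d) (by simpa using X_pow_mem_ring (k := k) (d := d) i 1)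

@[simp]
theorem incl_pw (i : Fin 2) : incl k d (pw k d i) = MvPolynomial.X i ^ d := rfl

theorem coeff_X_pow_mul_add (i : Fin 2) (e : ℕ) (p : S k) (m : Fin 2 →₀ ℕ) :
    MvPolynomial.coeff (Finsupp.single i e + m) (MvPolynomial.X i ^ e * p) =
      MvPolynomial.coeff m p := by
  rw [MvPolynomial.X_pow_eq_monomial, MvPolynomial.coeff_monomial_mul, one_mul]

theorem coeff_X_pow_mul_of_lt (i : Fin 2) (e : ℕ) (p : S k) (m : Fin 2 →₀ ℕ) (h : m i < e) :
    MvPolynomial.coeff m (MvPolynomial.X i ^ e * p) = 0 := by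
  rw [MvPolynomial.X_pow_eq_monomial, MvPolynomial.coeff_monomial_mul', if_neg]
  intro hle
  have := hle i
  simp at this
  omega

/-- `x ^ e w ∈ B` exactly when `w ∈ M^{(ℓ)}`, for `ℓ + e = d`. -/
theorem X_pow_mul_mem_ring_iff {ℓ e : ℕ} (he : 0 < e) (hd : ℓ + e = d) (i : Fin 2) (w : S k) :
    MvPolynomial.X i ^ e * w ∈ ring k d ↔ w ∈ mcm k d ℓ := by
  constructor
  · intro h m hm
    rw [MvPolynomial.mem_support_iff, ← coeff_X_pow_mul_add i e w m,
      ← MvPolynomial.mem_support_iff] at hm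
    obtain ⟨n, hn⟩ := h _ hm
    rw [map_add, Finsupp.degree_single] at hn
    cases n with
    | zero => omega
    | succ n => exact ⟨n, by rw [add_mul] at hn; omega⟩
  · intro h m hm
    rw [MvPolynomial.mem_support_iff] at hm
    by_cases hi : m i < e
    · exact absurd (coeff_X_pow_mul_of_lt i e w m hi) hm
    · have hle : Finsupp.single i e ≤ m := by
        rw [Finsupp.single_le_iff]
        omega
      obtain ⟨m, rfl⟩ := exists_add_of_le hle
      rw [coeff_X_pow_mul_add, ← MvPolynomial.mem_support_iff] at hm
      obtain ⟨n, hn⟩ := h _ hm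
      refine ⟨n + 1, ?_⟩
      rw [map_add, Finsupp.degree_single, hn, add_mul]
      omega

/-- Division by `x^d` or `y^d` lowers degrees by `d`. The bound `ℓ < d` excludes that the product
had degree exactly `ℓ`, where the quotient would need a negative degree. -/
theorem pw_mul_mem {ℓ : ℕ} (i : Fin 2) (w : S k) (h : MvPolynomial.X i ^ d * w ∈ mcm k d ℓ)
    (hℓ : ℓ < d) : w ∈ mcm k d ℓ := by
  intro m hm
  rw [MvPolynomial.mem_support_iff, ← coeff_X_pow_mul_add i d w m,
    ← MvPolynomial.mem_support_iff] at hm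
  obtain ⟨n, hn⟩ := h _ hm
  rw [map_add, Finsupp.degree_single] at hn
  cases n with
  | zero => omega
  | succ n => exact ⟨n, by rw [add_mul] at hn; omega⟩

/-- An element of `M^{(ℓ)}` all of whose monomials are divisible by `x ^ d` or `y ^ d` lies in
`(x ^ d, y ^ d) M^{(ℓ)}`. -/
theorem exists_eq_pw_add_pw {ℓ : ℕ} (hℓ : ℓ < d) {q : S k} (hq : q ∈ mcm k d ℓ)
    (h : ∀ m ∈ q.support, d ≤ m 0 ∨ d ≤ m 1) :
    ∃ u ∈ mcm k d ℓ, ∃ v ∈ mcm k d ℓ,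
      q = MvPolynomial.X 0 ^ d * u + MvPolynomial.X 1 ^ d * v := by
  -- Divide by `x^d` first and the remainder by `y^d`; the hypothesis on the support leaves no
  -- second remainder.
  set s : Fin 2 →₀ ℕ := Finsupp.single 0 d
  set t : Fin 2 →₀ ℕ := Finsupp.single 1 d
  have h1 := MvPolynomial.divMonomial_add_modMonomial q s
  set r := q.modMonomial s with hr
  have hrc : ∀ m, r.coeff m ≠ 0 → q.coeff m = r.coeff m ∧ ¬ d ≤ m 0 := by
    intro m hm
    have hle : ¬ s ≤ m := fun hle => hm (MvPolynomial.coeff_modMonomial_of_le _ hle)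
    exact ⟨(MvPolynomial.coeff_modMonomial_of_not_le _ hle).symm, by
      rwa [Finsupp.single_le_iff] at hle⟩
  have hrm : r ∈ mcm k d ℓ := fun m hm => by
    rw [MvPolynomial.mem_support_iff] at hm
    exact hq m (by rw [MvPolynomial.mem_support_iff, (hrc m hm).1]; exact hm)
  have h2 := MvPolynomial.divMonomial_add_modMonomial r t
  have h3 : r.modMonomial t = 0 := by
    ext m
    by_cases hle : t ≤ m
    · simp [MvPolynomial.coeff_modMonomial_of_le _ hle]
    · rw [MvPolynomial.coeff_modMonomial_of_not_le _ hle, MvPolynomial.coeff_zero]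
      by_contra hm
      obtain ⟨h4, h5⟩ := hrc m hm
      rcases h m (by rw [MvPolynomial.mem_support_iff, h4]; exact hm) with h6 | h6
      · exact h5 h6
      · exact hle (by rwa [Finsupp.single_le_iff])
  rw [h3, add_zero] at h2
  rw [← h2, ← MvPolynomial.X_pow_eq_monomial, ← MvPolynomial.X_pow_eq_monomial] at h1
  rw [← MvPolynomial.X_pow_eq_monomial] at h2
  refine ⟨q.divMonomial s, pw_mul_mem (d := d) 0 _ ?_ hℓ, r.divMonomial t,
    pw_mul_mem (d := d) 1 _ (by rw [h2]; exact hrm) hℓ, h1.symm⟩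
  rw [h2] at h1
  rw [eq_sub_of_add_eq h1]
  exact Submodule.sub_mem _ hq hrm

/-- The variable `y` is prime and does not divide `x^e`, so `y^e` must divide `p`. -/
theorem koszul_S (e : ℕ) {p q : S k}
    (h : MvPolynomial.X 0 ^ e * p + MvPolynomial.X 1 ^ e * q = 0) :
    ∃ w : S k, p = MvPolynomial.X 1 ^ e * w ∧ q = -(MvPolynomial.X 0 ^ e * w) := by
  have h1 : (MvPolynomial.X 1 ^ e : S k) ∣ MvPolynomial.X 0 ^ e * p :=
    ⟨-q, by linear_combination h⟩
  have hrel : ¬ (MvPolynomial.X 1 : S k) ∣ MvPolynomial.X 0 ^ e := by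
    intro hdvd
    have h2 := (MvPolynomial.X_prime (R := k) (i := (1 : Fin 2))).dvd_of_dvd_pow hdvd
    rw [MvPolynomial.X_dvd_X] at h2
    simp at h2
  obtain ⟨w, hw⟩ := (MvPolynomial.X_prime (R := k) (i := (1 : Fin 2))).pow_dvd_of_dvd_mul_left e
    hrel h1
  refine ⟨w, hw, ?_⟩
  have h3 : (MvPolynomial.X 1 ^ e : S k) ≠ 0 := pow_ne_zero _ (MvPolynomial.X_ne_zero _)
  apply mul_left_cancel₀ h3
  rw [hw] at h
  linear_combination h

/-- The first Koszul homology of `x ^ d, y ^ d` on `M^{(ℓ)}` vanishes. -/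
theorem koszul_mcm {ℓ : ℕ} (hℓ : ℓ < d) (p q : mcm k d ℓ)
    (h : pw k d 0 • p + pw k d 1 • q = 0) :
    ∃ w : mcm k d ℓ, p = pw k d 1 • w ∧ q = -(pw k d 0 • w) := by
  obtain ⟨w, hw1, hw2⟩ := koszul_S d (congrArg Subtype.val h)
  refine ⟨⟨w, pw_mul_mem 1 w (hw1 ▸ p.2) hℓ⟩, Subtype.ext hw1, Subtype.ext hw2⟩

/-- The first Koszul homology of `x ^ d, y ^ d` on `B` vanishes. -/
theorem koszul_B (hd : 0 < d) (p q : B k d) (h : pw k d 0 * p + pw k d 1 * q = 0) :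
    ∃ w : B k d, p = pw k d 1 * w ∧ q = -(pw k d 0 * w) := by
  obtain ⟨w, hw1, hw2⟩ := koszul_mcm (k := k) hd ⟨incl k d p, incl_mem p⟩ ⟨incl k d q, incl_mem q⟩
    (by
      have h' := congrArg (incl k d) h
      rw [map_add, map_mul, map_mul, map_zero] at h'
      exact Subtype.ext h')
  refine ⟨mkB w w.2, incl_injective ?_, incl_injective ?_⟩
  · rw [map_mul]
    exact congrArg Subtype.val hw1
  · rw [map_neg, map_mul]
    exact congrArg Subtype.val hw2

/-- The ideal `(x ^ d, y ^ d)` of `B`. -/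
def parIdeal (k : Type u) [Field k] (d : ℕ) : Ideal (B k d) := Ideal.span {pw k d 0, pw k d 1}

theorem mem_parIdeal_iff_exists (f : B k d) :
    f ∈ parIdeal k d ↔ ∃ p q, p * pw k d 0 + q * pw k d 1 = f := Ideal.mem_span_pair

theorem degree_fin_two (m : Fin 2 →₀ ℕ) : m.degree = m 0 + m 1 := by
  rw [Finsupp.degree_eq_sum, Fin.sum_univ_two]

theorem mem_parIdeal_of_support (hd : 0 < d) (f : B k d)
    (h : ∀ m ∈ (incl k d f).support, d ≤ m 0 ∨ d ≤ m 1) : f ∈ parIdeal k d := by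
  obtain ⟨u, hu, v, hv, huv⟩ := exists_eq_pw_add_pw hd (incl_mem f) h
  rw [mem_parIdeal_iff_exists]
  refine ⟨mkB u ((mem_mcm_zero_iff u).1 hu), mkB v ((mem_mcm_zero_iff v).1 hv), incl_injective ?_⟩
  simp only [map_add, map_mul, incl_mkB, incl_pw, huv]
  ring

theorem support_of_mem_maxIdeal {f : B k d} (hf : f ∈ maxIdeal k d) {m : Fin 2 →₀ ℕ}
    (hm : m ∈ (incl k d f).support) : d ≤ m.degree := by
  obtain ⟨n, hn⟩ := incl_mem f m hm
  cases n with
  | zero =>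
    exfalso
    rw [zero_mul, Finsupp.degree_eq_zero_iff] at hn
    subst hn
    rw [mem_maxIdeal_iff, constCoeff_apply] at hf
    exact MvPolynomial.mem_support_iff.1 hm hf
  | succ n => rw [hn, add_mul]; omega

/-- A monomial of a product of two elements of `𝔪` has degree at least `2d`, so one of its two
exponents is at least `d`. -/
theorem mul_mem_parIdeal (hd : 0 < d) {f g : B k d} (hf : f ∈ maxIdeal k d)
    (hg : g ∈ maxIdeal k d) : f * g ∈ parIdeal k d := by
  classical
  refine mem_parIdeal_of_support hd _ fun m hm => ?_
  rw [map_mul] at hm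
  obtain ⟨a, ha, b, hb, rfl⟩ := Finset.mem_add.1 (MvPolynomial.support_mul _ _ hm)
  have h1 := support_of_mem_maxIdeal hf ha
  have h2 := support_of_mem_maxIdeal hg hb
  rw [degree_fin_two] at h1 h2
  simp only [Finsupp.add_apply]
  omega

/-- For `ℓ = d - 1` the monomials involved have degree at least `d + (d - 1)`, and two exponents
below `d` add up to at most `2d - 2`. Thus `𝔪` and `(x^d, y^d)` have the same products with
`M^(d-1)`; this is what makes the last extremal ray appear. -/
theorem smul_mcm_mem {ℓ : ℕ} (hℓ : ℓ < d) (hd : d ≤ ℓ + 1) {f : B k d} (hf : f ∈ maxIdeal k d)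
    (q : mcm k d ℓ) : ∃ u v : mcm k d ℓ, f • q = pw k d 0 • u + pw k d 1 • v := by
  classical
  obtain ⟨u, hu, v, hv, huv⟩ := exists_eq_pw_add_pw hℓ (f • q).2 fun m hm => by
    obtain ⟨a, ha, b, hb, rfl⟩ := Finset.mem_add.1 (MvPolynomial.support_mul _ _ hm)
    have h1 := support_of_mem_maxIdeal hf ha
    obtain ⟨n, h2⟩ := q.2 b hb
    rw [degree_fin_two] at h1 h2
    simp only [Finsupp.add_apply]
    have : 0 ≤ n * d := Nat.zero_le _
    omega
  exact ⟨⟨u, hu⟩, ⟨v, hv⟩, Subtype.ext huv⟩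

theorem pw_mem_maxIdeal (hd : 0 < d) (i : Fin 2) : pw k d i ∈ maxIdeal k d := by
  rw [mem_maxIdeal_iff, constCoeff_apply]
  simp [hd.ne']

theorem parIdeal_le_maxIdeal (hd : 0 < d) : parIdeal k d ≤ maxIdeal k d := by
  rw [parIdeal, Ideal.span_le]
  rintro _ (rfl | rfl) <;> exact pw_mem_maxIdeal hd _

end Ring

/-! ### The base ring `k[x^d, y^d]` -/

section Param

variable (k : Type u) [Field k] (d : ℕ)

/-- The polynomial ring `k[x ^ d, y ^ d]`, over which `B` is finite. -/
def Param : Type u := MvPolynomial (Fin 2) k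

instance : CommRing (Param k) := inferInstanceAs (CommRing (MvPolynomial (Fin 2) k))
instance : IsDomain (Param k) := inferInstanceAs (IsDomain (MvPolynomial (Fin 2) k))
instance : IsNoetherianRing (Param k) :=
  inferInstanceAs (IsNoetherianRing (MvPolynomial (Fin 2) k))
instance : Algebra k (Param k) := inferInstanceAs (Algebra k (MvPolynomial (Fin 2) k))

/-- The variables of `Param k`. -/
def Param.X (i : Fin 2) : Param k := (MvPolynomial.X i : MvPolynomial (Fin 2) k)

/-- The constant coefficient. -/
def Param.constCoeff : Param k →ₐ[k] k :=
  (MvPolynomial.aeval (fun _ => 0) : MvPolynomial (Fin 2) k →ₐ[k] k)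

/-- The inclusion of `k[x ^ d, y ^ d]` into `B`. -/
def Param.toB : Param k →ₐ[k] B k d :=
  (MvPolynomial.aeval (pw k d) : MvPolynomial (Fin 2) k →ₐ[k] B k d)

@[simp]
theorem Param.toB_X (i : Fin 2) : Param.toB k d (Param.X k i) = pw k d i :=
  MvPolynomial.aeval_X _ _

theorem Param.mem_span_iff (r : Param k) :
    r ∈ Ideal.span {Param.X k 0, Param.X k 1} ↔ Param.constCoeff k r = 0 := by
  have h1 : Param.constCoeff k r = MvPolynomial.constantCoeff (R := k) (σ := Fin 2) r := by
    exact MvPolynomial.aeval_zero _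
  have h2 : ({Param.X k 0, Param.X k 1} : Set (Param k)) =
      (MvPolynomial.X '' ({0, 1} : Set (Fin 2)) : Set (MvPolynomial (Fin 2) k)) := by
    rw [Set.image_pair]
    rfl
  rw [h1, h2]
  refine MvPolynomial.mem_ideal_span_X_image.trans ?_
  constructor
  · intro h
    by_contra h0
    obtain ⟨i, -, hi⟩ := h 0 (MvPolynomial.mem_support_iff.2 h0)
    exact hi rfl
  · intro h m hm
    by_contra! h0
    have hm0 : m = 0 := by
      ext i
      exact h0 i (by fin_cases i <;> simp)
    subst hm0
    exact MvPolynomial.mem_support_iff.1 hm h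

/-- The structure of a `k[x ^ d, y ^ d]`-module on a `B`-module. -/
abbrev paramModule (M : Type*) [AddCommGroup M] [Module (B k d) M] : Module (Param k) M :=
  Module.compHom M (Param.toB k d).toRingHom

variable {k d}

theorem mem_span_pair_smul_top_iff {A N : Type*} [CommRing A] [AddCommGroup N] [Module A N]
    (a b : A) (x : N) :
    x ∈ Ideal.span {a, b} • (⊤ : Submodule A N) ↔ ∃ u v : N, x = a • u + b • v := by
  rw [Ideal.span_insert, Submodule.sup_smul, Submodule.mem_sup]
  simp only [Submodule.ideal_span_singleton_smul, Submodule.mem_smul_pointwise_iff_exists]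
  constructor
  · rintro ⟨_, ⟨u, -, rfl⟩, _, ⟨v, -, rfl⟩, rfl⟩
    exact ⟨u, v, rfl⟩
  · rintro ⟨u, v, rfl⟩
    exact ⟨_, ⟨u, trivial, rfl⟩, _, ⟨v, trivial, rfl⟩, rfl⟩

/-- The monomials of `B` with both exponents less than `N`. -/
def genB (k : Type u) [Field k] (d N : ℕ) (i : Fin N × Fin N) : B k d :=
  if h : d ∣ (i.1 : ℕ) + i.2 then
    mkB (MvPolynomial.monomial (Finsupp.single 0 (i.1 : ℕ) + Finsupp.single 1 (i.2 : ℕ)) 1)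
      (monomial_mem_ring (n := h.choose) (by
        rw [map_add, Finsupp.degree_single, Finsupp.degree_single]; exact h.choose_spec.trans (mul_comm _ _)) 1)
  else 0

theorem fin_two_finsupp_eq (m : Fin 2 →₀ ℕ) :
    m = Finsupp.single 0 (m 0) + Finsupp.single 1 (m 1) := by
  ext i
  fin_cases i <;> simp

/-- Dividing both exponents of a monomial by `d` with remainder leaves a monomial with exponents
below `d`, still in `B` because the sum of the exponents is unchanged modulo `d`. -/
theorem finite_param (hd : 0 < d) :
    letI := paramModule k d (B k d)
    Module.Finite (Param k) (B k d) := by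
  let := paramModule k d (B k d)
  have hsm : ∀ (p : Param k) (b : B k d), p • b = Param.toB k d p * b := fun _ _ => rfl
  refine Module.finite_def.2 (Submodule.fg_def.2 ⟨Set.range (genB k d d), Set.finite_range _, ?_⟩)
  rw [eq_top_iff]
  rintro f -
  have hmono : ∀ (m : Fin 2 →₀ ℕ) (hm : ∃ n : ℕ, m.degree = n * d) (c : k),
      mkB (MvPolynomial.monomial m c) (monomial_mem_ring hm.choose_spec c) ∈
      Submodule.span (Param k) (Set.range (genB k d d)) := by
    intro m hm c
    obtain ⟨n, hn⟩ := hm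
    let i : Fin d × Fin d := (⟨m 0 % d, Nat.mod_lt _ hd⟩, ⟨m 1 % d, Nat.mod_lt _ hd⟩)
    have hi : d ∣ (i.1 : ℕ) + i.2 := by
      have : d ∣ m 0 + m 1 := ⟨n, by rw [← degree_fin_two, hn, mul_comm]⟩
      change d ∣ m 0 % d + m 1 % d
      rw [Nat.dvd_iff_mod_eq_zero, ← Nat.add_mod, ← Nat.dvd_iff_mod_eq_zero]
      exact this
    have h1 : mkB (MvPolynomial.monomial m c) (monomial_mem_ring hn c) =
        (c • (Param.X k 0 ^ (m 0 / d) * Param.X k 1 ^ (m 1 / d)) : Param k) • genB k d d i := by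
      rw [hsm]
      apply incl_injective
      simp only [map_smul, map_mul, map_pow, Param.toB_X, incl_pw, incl_mkB, genB, dif_pos hi]
      rw [MvPolynomial.X_pow_eq_monomial, MvPolynomial.X_pow_eq_monomial,
        MvPolynomial.monomial_pow, MvPolynomial.monomial_pow, MvPolynomial.monomial_mul,
        smul_mul_assoc, MvPolynomial.monomial_mul, MvPolynomial.smul_monomial]
      have hmi : m = (m 0 / d) • Finsupp.single 0 d + (m 1 / d) • Finsupp.single 1 d +
          (Finsupp.single 0 (m 0 % d) + Finsupp.single 1 (m 1 % d)) := by
        ext j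
        fin_cases j <;> simp [Nat.div_add_mod']
      rw [← hmi]
      simp
    rw [h1]
    refine Submodule.smul_mem _ _ (Submodule.subset_span ⟨i, rfl⟩)
  have hf : f = ∑ m ∈ (incl k d f).support.attach,
      mkB (MvPolynomial.monomial m.1 ((incl k d f).coeff m.1))
        (monomial_mem_ring (incl_mem f m.1 m.2).choose_spec _) := by
    apply incl_injective
    rw [map_sum]
    simp only [incl_mkB]
    rw [Finset.sum_attach _ (fun m => MvPolynomial.monomial m ((incl k d f).coeff m)),
      MvPolynomial.support_sum_monomial_coeff]
  rw [hf]
  exact Submodule.sum_mem _ fun m _ => hmono m.1 (incl_mem f m.1 m.2) _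

theorem finite_param_of_finite (hd : 0 < d) (M : Type*) [AddCommGroup M] [Module (B k d) M]
    [Module.Finite (B k d) M] :
    letI := paramModule k d M
    Module.Finite (Param k) M := by
  let := paramModule k d M
  let := paramModule k d (B k d)
  have := finite_param (k := k) hd
  have : IsScalarTower (Param k) (B k d) M := ⟨fun a b c => by
    change (Param.toB k d a * b) • c = Param.toB k d a • (b • c)
    rw [mul_smul]⟩
  exact Module.Finite.trans (B k d) M

theorem isNoetherianRing_B (hd : 0 < d) : IsNoetherianRing (B k d) := by
  let := paramModule k d (B k d)
  have := finite_param (k := k) hd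
  have : IsScalarTower (Param k) (B k d) (B k d) := ⟨fun a b c => by
    change (Param.toB k d a * b) * c = Param.toB k d a * (b * c)
    rw [mul_assoc]⟩
  exact isNoetherian_of_tower (Param k) inferInstance

/-- The exponents of a basis of `B` modulo `(x ^ d, y ^ d)`. -/
def basisExp (d : ℕ) (r : Fin d) : Fin 2 →₀ ℕ :=
  if (r : ℕ) = 0 then 0 else Finsupp.single 0 (r : ℕ) + Finsupp.single 1 (d - r)

theorem basisExp_zero (r : Fin d) : basisExp d r 0 = r := by
  unfold basisExp
  split_ifs with h <;> simp [h]

theorem basisExp_one_lt (r : Fin d) : basisExp d r 1 < d := by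
  unfold basisExp
  have := r.2
  split_ifs with h
  · simp; omega
  · simp; omega

theorem basisExp_degree (r : Fin d) : ∃ n, (basisExp d r).degree = n * d := by
  unfold basisExp
  have := r.2
  split_ifs with h
  · exact ⟨0, by simp⟩
  · exact ⟨1, by rw [map_add, Finsupp.degree_single, Finsupp.degree_single]; omega⟩

theorem exists_basisExp_eq (m : Fin 2 →₀ ℕ) (hm : ∃ n, m.degree = n * d) (h0 : m 0 < d)
    (h1 : m 1 < d) : ∃ r : Fin d, m = basisExp d r := by
  obtain ⟨n, hn⟩ := hm
  rw [degree_fin_two] at hn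
  refine ⟨⟨m 0, h0⟩, ?_⟩
  refine (fin_two_finsupp_eq m).trans ?_
  -- Two exponents below `d` give total degree below `2d`, so the degree is `0` or `d`.
  have hn2 : n < 2 := by
    by_contra h
    have := Nat.mul_le_mul_right d (not_lt.1 h)
    omega
  unfold basisExp
  interval_cases n
  · have h2 : m 0 = 0 := by omega
    have h3 : m 1 = 0 := by omega
    simp [h2, h3]
  · have h2 : m 0 ≠ 0 := by omega
    have h3 : m 1 = d - m 0 := by omega
    simp [h2, h3]

/-- The dimension of `B` modulo `(x ^ d, y ^ d)` is `d`. -/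
theorem finrank_quotient_parIdeal (hd : 0 < d) :
    Module.finrank k (B k d ⧸ parIdeal k d) = d := by
  -- The monomials of `B` with both exponents below `d` are `1` and `x^r y^(d-r)` with `0 < r < d`.
  -- The map reads off their coefficients, and its kernel is the ideal.
  let c : B k d →ₗ[k] (Fin d → k) :=
    LinearMap.pi fun r => (MvPolynomial.lcoeff k (basisExp d r)) ∘ₗ (incl k d).toLinearMap
  have hc : Function.Surjective c := by
    intro v
    refine ⟨∑ r, v r • mkB _ (monomial_mem_ring (basisExp_degree r).choose_spec 1), ?_⟩
    funext s
    have hinj : ∀ r, basisExp d r = basisExp d s ↔ r = s := fun r =>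
      ⟨fun h => Fin.ext (by rw [← basisExp_zero r, h, basisExp_zero]), fun h => h ▸ rfl⟩
    simp [c, MvPolynomial.coeff_monomial, hinj]
  have hker : (parIdeal k d).restrictScalars k = LinearMap.ker c := by
    ext f
    rw [Submodule.restrictScalars_mem, LinearMap.mem_ker]
    constructor
    · intro hf
      obtain ⟨p, q, rfl⟩ := (mem_parIdeal_iff_exists f).1 hf
      funext r
      have h1 := coeff_X_pow_mul_of_lt (k := k) 0 d (incl k d p) (basisExp d r)
        (by rw [basisExp_zero]; exact r.2)
      have h2 := coeff_X_pow_mul_of_lt (k := k) 1 d (incl k d q) (basisExp d r)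
        (basisExp_one_lt r)
      rw [mul_comm] at h1 h2
      simp [c, h1, h2]
    · intro hf
      refine mem_parIdeal_of_support hd f fun m hm => ?_
      by_contra! h
      obtain ⟨r, rfl⟩ := exists_basisExp_eq m (incl_mem f m hm) h.1 h.2
      exact MvPolynomial.mem_support_iff.1 hm (congrFun hf r)
  rw [← (Submodule.Quotient.restrictScalarsEquiv k (parIdeal k d)).finrank_eq,
    ((Submodule.quotEquivOfEq _ _ hker).trans (c.quotKerEquivOfSurjective hc)).finrank_eq,
    Module.finrank_fin_fun]

end Param

/-! ### Rank of `B`-modules over `k[x^d, y^d]` -/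

section ParamRank

variable (k : Type u) [Field k] (d : ℕ)

/-- The rank of a `B`-module over `k[x ^ d, y ^ d]`. -/
def prk (M : Type*) [AddCommGroup M] [Module (B k d) M] : ℕ :=
  letI := paramModule k d M
  Module.finrank (Param k) M

variable {k d}
variable {M N : Type*} [AddCommGroup M] [Module (B k d) M] [AddCommGroup N] [Module (B k d) N]

theorem prk_congr (e : M ≃ₗ[B k d] N) : prk k d M = prk k d N := by
  let := paramModule k d M
  let := paramModule k d N
  exact LinearEquiv.finrank_eq
    ({ e.toAddEquiv with map_smul' := fun p x => e.map_smul (Param.toB k d p) x } :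
      M ≃ₗ[Param k] N)

theorem prk_of_subsingleton [Subsingleton M] : prk k d M = 0 := by
  let := paramModule k d M
  exact Module.finrank_zero_of_subsingleton

theorem prk_ker_add_prk_range (hd : 0 < d) [Module.Finite (B k d) M] (f : M →ₗ[B k d] N) :
    prk k d (LinearMap.ker f) + prk k d (LinearMap.range f) = prk k d M := by
  let := paramModule k d M
  let := paramModule k d N
  have := finite_param_of_finite (k := k) hd M
  let g : M →ₗ[Param k] N :=
    { f.toAddMonoidHom with map_smul' := fun p x => f.map_smul (Param.toB k d p) x }
  have h := Submodule.finrank_quotient_add_finrank (LinearMap.ker g)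
  rw [g.quotKerEquivRange.finrank_eq] at h
  rw [add_comm]
  exact h

theorem prk_le_of_injective (hd : 0 < d) [Module.Finite (B k d) N] (f : M →ₗ[B k d] N)
    (hf : Function.Injective f) : prk k d M ≤ prk k d N := by
  have := isNoetherianRing_B (k := k) hd
  have h := prk_ker_add_prk_range hd (LinearMap.range f).mkQ
  rw [Submodule.ker_mkQ, ← prk_congr (LinearEquiv.ofInjective f hf)] at h
  omega

theorem prk_of_surjective (hd : 0 < d) [Module.Finite (B k d) M] (f : M →ₗ[B k d] N)
    (hf : Function.Surjective f) : prk k d (LinearMap.ker f) + prk k d N = prk k d M := by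
  rw [← prk_ker_add_prk_range hd f, prk_congr (LinearEquiv.ofTop _ (LinearMap.range_eq_top.2 hf))]

theorem prk_quotient_add (hd : 0 < d) [Module.Finite (B k d) M] (P : Submodule (B k d) M) :
    prk k d P + prk k d (M ⧸ P) = prk k d M := by
  have h := prk_of_surjective hd P.mkQ P.mkQ_surjective
  rwa [Submodule.ker_mkQ] at h

theorem prk_prod (hd : 0 < d) [Module.Finite (B k d) M] [Module.Finite (B k d) N] :
    prk k d (M × N) = prk k d M + prk k d N := by
  rw [← prk_of_surjective hd (LinearMap.fst (B k d) M N) LinearMap.fst_surjective, add_comm,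
    LinearMap.ker_fst,
    ← prk_congr (LinearEquiv.ofInjective (LinearMap.inr (B k d) M N) LinearMap.inr_injective)]

theorem prk_fin_fun (hd : 0 < d) [Module.Finite (B k d) M] (n : ℕ) :
    prk k d (Fin n → M) = n * prk k d M := by
  induction n with
  | zero => rw [prk_of_subsingleton, zero_mul]
  | succ n ih =>
    rw [← prk_congr (Fin.consLinearEquiv (B k d) (fun _ : Fin (n + 1) => M)), prk_prod hd, ih,
      add_mul, one_mul, add_comm]

/-- If the first Koszul homology of `x ^ d, y ^ d` on `N` vanishes, then
`N ⧸ (x ^ d, y ^ d) N` has dimension `prk N`. -/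
theorem finrank_quotient_eq_prk (hd : 0 < d) [Module k N] [IsScalarTower k (B k d) N]
    [Module.Finite (B k d) N]
    (hN : ∀ p q : N, pw k d 0 • p + pw k d 1 • q = 0 →
      ∃ w : N, p = pw k d 1 • w ∧ q = -(pw k d 0 • w)) :
    Module.finrank k (N ⧸ (parIdeal k d • (⊤ : Submodule (B k d) N))) = prk k d N := by
  let := paramModule k d N
  have := finite_param_of_finite (k := k) hd N
  have : IsScalarTower k (Param k) N := ⟨fun c p x => by
    change (Param.toB k d (c • p)) • x = c • (Param.toB k d p • x)
    rw [map_smul, smul_assoc]⟩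
  have hsm : ∀ (i : Fin 2) (x : N), Param.X k i • x = pw k d i • x := fun i x => by
    change Param.toB k d (Param.X k i) • x = _
    rw [Param.toB_X]
  have h := finrank_quotient_eq_finrank (N := N) (Param.constCoeff k) (Param.mem_span_iff k) rfl
    (fun p q hpq => by
      simp only [hsm] at hpq ⊢
      exact hN p q hpq)
  have heq : (parIdeal k d • (⊤ : Submodule (B k d) N)).restrictScalars k =
      (Ideal.span {Param.X k 0, Param.X k 1} • (⊤ : Submodule (Param k) N)).restrictScalars k := by
    ext x
    rw [Submodule.restrictScalars_mem, Submodule.restrictScalars_mem, parIdeal,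
      mem_span_pair_smul_top_iff, mem_span_pair_smul_top_iff]
    simp only [hsm]
  exact (((Submodule.Quotient.restrictScalarsEquiv k _).symm.trans
    (Submodule.quotEquivOfEq _ _ heq)).trans
    (Submodule.Quotient.restrictScalarsEquiv k _)).finrank_eq.trans h

/-- Vanishing Koszul homology turns the rank into the dimension of `B/(x^d, y^d)`. -/
theorem prk_B (hd : 0 < d) : prk k d (B k d) = d := by
  have hk : ∀ p q : B k d, pw k d 0 • p + pw k d 1 • q = 0 →
      ∃ w : B k d, p = pw k d 1 • w ∧ q = -(pw k d 0 • w) := fun p q hpq => by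
    simp only [smul_eq_mul] at hpq ⊢
    exact koszul_B hd p q hpq
  rw [← finrank_quotient_eq_prk hd hk]
  have h : (parIdeal k d • (⊤ : Submodule (B k d) (B k d))) = parIdeal k d := by
    rw [smul_eq_mul, Ideal.mul_top]
  rw [h]
  exact finrank_quotient_parIdeal hd

theorem prk_free (hd : 0 < d) (n : ℕ) : prk k d (Fin n → B k d) = n * d := by
  rw [prk_fin_fun hd, prk_B hd]

/-- The annihilator lies in `B`, not in the base ring, so torsion over the base is not immediate.
Instead, multiplication by `s` embeds a free cover into its module of relations, which therefore has
full rank. -/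
theorem prk_eq_zero_of_smul_eq_zero (hd : 0 < d) [Module.Finite (B k d) M] {s : B k d}
    (hs : s ≠ 0) (h : ∀ x : M, s • x = 0) : prk k d M = 0 := by
  obtain ⟨n, f, hf⟩ := Module.Finite.exists_fin' (B k d) M
  let g : (Fin n → B k d) →ₗ[B k d] LinearMap.ker f :=
    (LinearMap.lsmul (B k d) (Fin n → B k d) s).codRestrict (LinearMap.ker f) fun v => by
      rw [LinearMap.mem_ker, LinearMap.lsmul_apply, map_smul, h]
  have hg : Function.Injective g := fun v w hvw => by
    have := congrArg Subtype.val hvw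
    exact smul_right_injective _ hs this
  have := isNoetherianRing_B (k := k) hd
  have h1 := prk_le_of_injective hd g hg
  have h2 := prk_of_surjective hd f hf
  omega

/-- A module that is generated by `b` elements modulo `𝔪` has rank at most `b d`. -/
theorem prk_le_of_span_mod_maxIdeal (hd : 0 < d) [Module.Finite (B k d) M] {b : ℕ} (v : Fin b → M)
    (h : ∀ x : M, ∃ c : Fin b → B k d, x - ∑ i, c i • v i ∈ maxIdeal k d •
      (⊤ : Submodule (B k d) M)) : prk k d M ≤ b * d := by
  have hno := isNoetherianRing_B (k := k) hd
  let φ : (Fin b → B k d) →ₗ[B k d] M := Fintype.linearCombination (B k d) v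
  -- By Nakayama the cokernel of `B^b → M` is killed by an element of `1 + 𝔪`, hence has rank zero.
  -- No grading is needed.
  obtain ⟨s, hs1, hs⟩ := Submodule.exists_sub_one_mem_and_smul_eq_zero_of_fg_of_le_smul
    (maxIdeal k d) (⊤ : Submodule (B k d) (M ⧸ LinearMap.range φ)) Module.Finite.fg_top (by
      rintro x -
      obtain ⟨x, rfl⟩ := Submodule.Quotient.mk_surjective _ x
      obtain ⟨c, hc⟩ := h x
      have h2 := Submodule.mem_map_of_mem (f := (LinearMap.range φ).mkQ) hc
      rw [Submodule.map_smul''] at h2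
      have h3 : (LinearMap.range φ).mkQ (x - ∑ i, c i • v i) = Submodule.Quotient.mk x := by
        rw [Submodule.mkQ_apply, Submodule.Quotient.eq]
        exact ⟨-c, by simp [φ, Fintype.linearCombination_apply]⟩
      rw [h3] at h2
      exact Submodule.smul_mono le_rfl le_top h2)
  have hs0 : s ≠ 0 := by
    rintro rfl
    simp [mem_maxIdeal_iff] at hs1
  have h1 := prk_eq_zero_of_smul_eq_zero hd hs0 fun x => hs x trivial
  have h2 := prk_quotient_add hd (LinearMap.range φ)
  have h3 := prk_ker_add_prk_range hd φ
  rw [prk_free hd] at h3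
  omega

/-- Multiplication by `x^(d-ℓ)` embeds `M^(ℓ)` in `B`, and multiplication by `x^ℓ` embeds `B` in
`M^(ℓ)`, so the ranks agree. -/
theorem mcm_finite (hd : 0 < d) {ℓ : ℕ} (hℓ : ℓ < d) : Module.Finite (B k d) (mcm k d ℓ) ∧
    prk k d (mcm k d ℓ) = d := by
  have hno := isNoetherianRing_B (k := k) hd
  let f : mcm k d ℓ →ₗ[B k d] B k d :=
    { toFun := fun w => mkB (MvPolynomial.X 0 ^ (d - ℓ) * (w : S k))
        ((X_pow_mul_mem_ring_iff (ℓ := ℓ) (by omega) (by omega) 0 _).2 w.2)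
      map_add' := fun x y => incl_injective (by simp [mul_add])
      map_smul' := fun c x => incl_injective (by
        simp only [incl_mkB, coe_smul_mcm, RingHom.id_apply, smul_eq_mul, map_mul]
        ring) }
  have hf : Function.Injective f := fun x y h => by
    have h1 := congrArg (incl k d) h
    exact Subtype.ext (mul_left_cancel₀ (pow_ne_zero _ (MvPolynomial.X_ne_zero _)) h1)
  let g : B k d →ₗ[B k d] mcm k d ℓ := LinearMap.toSpanSingleton (B k d) _
    ⟨MvPolynomial.X 0 ^ ℓ, fun m hm => by
      rw [MvPolynomial.X_pow_eq_monomial] at hm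
      rw [Finset.mem_singleton.1 (MvPolynomial.support_monomial_subset hm)]
      exact ⟨0, by simp⟩⟩
  have hg : Function.Injective g := fun x y h => by
    have h1 := congrArg Subtype.val h
    exact incl_injective (mul_right_cancel₀ (pow_ne_zero ℓ (MvPolynomial.X_ne_zero _)) h1)
  have hfin : Module.Finite (B k d) (mcm k d ℓ) := Module.Finite.of_injective f hf
  refine ⟨hfin, ?_⟩
  have h1 := prk_le_of_injective hd f hf
  have h2 := prk_le_of_injective hd g hg
  rw [prk_B hd] at h1 h2
  omega

end ParamRank

/-! ### Dimension formulas -/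

section LinearAlgebra

variable {k : Type*} [Field k] {V W : Type*} [AddCommGroup V] [Module k V] [AddCommGroup W]
  [Module k W]

theorem finrank_map_add_finrank_inf_ker [Module.Finite k V] (f : V →ₗ[k] W) (U : Submodule k V) :
    Module.finrank k (U.map f) + Module.finrank k (U ⊓ LinearMap.ker f : Submodule k V) =
      Module.finrank k U := by
  have h := (f.domRestrict U).finrank_range_add_finrank_ker
  rw [LinearMap.range_domRestrict, LinearMap.ker_domRestrict] at h
  rw [← h, ← Submodule.map_comap_subtype]
  congr 1
  exact (Submodule.equivMapOfInjective U.subtype Subtype.val_injective _).finrank_eq.symm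

theorem finrank_range_compLeft [Module.Finite k W] (f : V →ₗ[k] W) (n : ℕ) :
    Module.finrank k (LinearMap.range (f.compLeft (Fin n))) =
      n * Module.finrank k (LinearMap.range f) := by
  let j : (Fin n → LinearMap.range f) →ₗ[k] (Fin n → W) :=
    (LinearMap.range f).subtype.compLeft (Fin n)
  have hj : Function.Injective j := fun x y h =>
    funext fun i => Subtype.ext (congrFun h i)
  have hr : LinearMap.range (f.compLeft (Fin n)) = LinearMap.range j := by
    ext w
    constructor
    · rintro ⟨v, rfl⟩
      exact ⟨fun i => ⟨f (v i), v i, rfl⟩, rfl⟩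
    · rintro ⟨v, rfl⟩
      choose z hz using fun i => (v i).2
      exact ⟨z, funext hz⟩
  rw [hr, LinearMap.finrank_range_of_inj hj, Module.finrank_pi_fintype]
  simp

end LinearAlgebra

/-! ### Dimension counts over `Bbar = B/(x^d, y^d)` -/

section Counting

variable {k : Type u} [Field k] {d : ℕ}

/-- The ring `B` modulo `(x ^ d, y ^ d)`. -/
abbrev Bbar (k : Type u) [Field k] (d : ℕ) : Type u := B k d ⧸ parIdeal k d

theorem finite_Bbar (hd : 0 < d) : Module.Finite k (Bbar k d) :=
  Module.finite_of_finrank_pos (by rw [finrank_quotient_parIdeal hd]; exact hd)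

/-- The augmentation of `Bbar`. -/
def bbarCoeff (hd : 0 < d) : Bbar k d →ₐ[k] k :=
  Ideal.Quotient.liftₐ (parIdeal k d) (constCoeff k d)
    (fun _ ha => (mem_maxIdeal_iff _).1 (parIdeal_le_maxIdeal hd ha))

@[simp]
theorem bbarCoeff_mk (hd : 0 < d) (f : B k d) :
    bbarCoeff hd (Ideal.Quotient.mk (parIdeal k d) f) = constCoeff k d f := rfl

/-- The augmentation of a free module over `Bbar`. -/
def augm (hd : 0 < d) (n : ℕ) : (Fin n → Bbar k d) →ₗ[k] (Fin n → k) :=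
  (bbarCoeff hd).toLinearMap.compLeft (Fin n)

@[simp]
theorem augm_apply (hd : 0 < d) {n : ℕ} (z : Fin n → Bbar k d) (i : Fin n) :
    augm hd n z i = bbarCoeff hd (z i) := rfl

theorem augm_surjective (hd : 0 < d) (n : ℕ) : Function.Surjective (augm (k := k) hd n) :=
  fun v => ⟨fun i => algebraMap k _ (v i), funext fun i => by simp⟩

theorem finrank_free_bbar (hd : 0 < d) (n : ℕ) : Module.finrank k (Fin n → Bbar k d) = n * d := by
  have := finite_Bbar (k := k) hd
  rw [Module.finrank_pi_fintype]
  simp [finrank_quotient_parIdeal hd]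

/-- This is `n² = 0`: on the augmentation ideal `n`, the ring `Bbar` acts through `k`. -/
theorem mul_eq_smul_of_mem_ker (hd : 0 < d) (r : Bbar k d) {w : Bbar k d}
    (hw : bbarCoeff hd w = 0) : r * w = bbarCoeff hd r • w := by
  obtain ⟨r, rfl⟩ := Ideal.Quotient.mk_surjective r
  obtain ⟨w, rfl⟩ := Ideal.Quotient.mk_surjective w
  rw [bbarCoeff_mk] at hw
  have h1 : r - algebraMap k (B k d) (constCoeff k d r) ∈ maxIdeal k d := by
    simp [mem_maxIdeal_iff]
  have h2 := mul_mem_parIdeal hd h1 ((mem_maxIdeal_iff w).2 hw)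
  rw [← Ideal.Quotient.eq_zero_iff_mem, sub_mul, map_sub, sub_eq_zero, map_mul] at h2
  rw [h2, bbarCoeff_mk, Algebra.smul_def, map_mul]
  rfl

/-- The reduction of a map of free `B`-modules modulo `(x ^ d, y ^ d)`. -/
def redBar {a b : ℕ} (δ : (Fin a → B k d) →ₗ[B k d] (Fin b → B k d)) :
    (Fin a → Bbar k d) →ₗ[Bbar k d] (Fin b → Bbar k d) :=
  ((LinearMap.toMatrix' δ).map (Ideal.Quotient.mk (parIdeal k d))).mulVecLin

theorem redBar_apply {a b : ℕ} (δ : (Fin a → B k d) →ₗ[B k d] (Fin b → B k d)) (v : Fin a → B k d) :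
    redBar δ (fun i => Ideal.Quotient.mk (parIdeal k d) (v i)) =
      fun j => Ideal.Quotient.mk (parIdeal k d) (δ v j) := by
  funext j
  have h := RingHom.map_mulVec (Ideal.Quotient.mk (parIdeal k d)) (LinearMap.toMatrix' δ) v j
  rw [LinearMap.toMatrix'_mulVec] at h
  rw [h]
  rfl

theorem exists_lift {n : ℕ} (z : Fin n → Bbar k d) :
    ∃ v : Fin n → B k d, z = fun i => Ideal.Quotient.mk (parIdeal k d) (v i) := by
  choose v hv using fun i => Ideal.Quotient.mk_surjective (z i)
  exact ⟨v, (funext hv).symm⟩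

/-- The reduction modulo `(x ^ d, y ^ d)`, as a `k`-linear map. -/
abbrev redBarK {a b : ℕ} (δ : (Fin a → B k d) →ₗ[B k d] (Fin b → B k d)) :
    (Fin a → Bbar k d) →ₗ[k] (Fin b → Bbar k d) := (redBar δ).restrictScalars k

theorem augm_redBar (hd : 0 < d) {a b : ℕ} (δ : (Fin a → B k d) →ₗ[B k d] (Fin b → B k d))
    (z : Fin a → Bbar k d) :
    augm hd b (redBarK δ z) = red (constCoeff k d) δ (augm hd a z) := by
  obtain ⟨v, rfl⟩ := exists_lift z
  have h := red_apply (constCoeff k d) δ v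
  rw [LinearMap.restrictScalars_apply, redBar_apply]
  exact h.symm

/-- The kernel of the augmentation of `Bbar`. -/
abbrev socle (k : Type u) [Field k] {d : ℕ} (hd : 0 < d) : Submodule k (Bbar k d) :=
  LinearMap.ker (bbarCoeff (k := k) hd).toLinearMap

theorem finrank_socle (hd : 0 < d) : Module.finrank k (socle k hd) = d - 1 := by
  have := finite_Bbar (k := k) hd
  have h := (bbarCoeff (k := k) hd).toLinearMap.finrank_range_add_finrank_ker
  have hr : LinearMap.range (bbarCoeff (k := k) hd).toLinearMap = ⊤ :=
    LinearMap.range_eq_top.2 fun c => ⟨algebraMap k _ c, by simp⟩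
  rw [finrank_quotient_parIdeal hd, hr, finrank_top, Module.finrank_self] at h
  exact (Nat.sub_eq_of_eq_add' h.symm).symm

/-- A basis of the kernel of the augmentation. -/
def socleBasis (k : Type u) [Field k] {d : ℕ} (hd : 0 < d) :
    Module.Basis (Fin (d - 1)) k (socle k hd) :=
  haveI := finite_Bbar (k := k) hd
  Module.finBasisOfFinrankEq k _ (finrank_socle hd)

/-- Coordinates on the kernel of the augmentation of a free module over `Bbar`. -/
def socleMap (k : Type u) [Field k] {d : ℕ} (hd : 0 < d) (n : ℕ) :
    (Fin (d - 1) → Fin n → k) →ₗ[k] (Fin n → Bbar k d) where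
  toFun u := fun i => ∑ t, u t i • (socleBasis k hd t : Bbar k d)
  map_add' u v := by
    funext i
    simp [add_smul, Finset.sum_add_distrib]
  map_smul' c u := by
    funext i
    simp [mul_smul, Finset.smul_sum]

theorem socleMap_apply (hd : 0 < d) {n : ℕ} (u : Fin (d - 1) → Fin n → k) (i : Fin n) :
    socleMap k hd n u i = ∑ t, u t i • (socleBasis k hd t : Bbar k d) := rfl

theorem socleMap_injective (hd : 0 < d) (n : ℕ) : Function.Injective (socleMap k hd n) := by
  rw [← LinearMap.ker_eq_bot, eq_bot_iff]
  intro u hu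
  funext t i
  have h := congrFun (LinearMap.mem_ker.1 hu) i
  rw [socleMap_apply] at h
  have h2 : ∑ t, u t i • socleBasis k hd t = 0 := Subtype.ext (by simpa using h)
  exact Fintype.linearIndependent_iff.1 (socleBasis k hd).linearIndependent _ h2 t

theorem range_socleMap (hd : 0 < d) (n : ℕ) :
    LinearMap.range (socleMap k hd n) = LinearMap.ker (augm hd n) := by
  ext z
  constructor
  · rintro ⟨u, rfl⟩
    rw [LinearMap.mem_ker]
    funext i
    rw [augm_apply, socleMap_apply, map_sum]
    refine Finset.sum_eq_zero fun t _ => ?_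
    have : bbarCoeff hd (socleBasis k hd t : Bbar k d) = 0 := (socleBasis k hd t).2
    rw [map_smul, this, smul_zero]
  · intro hz
    have hz' : ∀ i, z i ∈ socle k hd := fun i => congrFun (LinearMap.mem_ker.1 hz) i
    refine ⟨fun t i => (socleBasis k hd).repr ⟨z i, hz' i⟩ t, funext fun i => ?_⟩
    rw [socleMap_apply]
    have h := congrArg (socle k hd).subtype ((socleBasis k hd).sum_repr ⟨z i, hz' i⟩)
    rw [map_sum] at h
    exact h

/-- Since `Bbar` acts on `n` through `k`, the matrix of `δ` acts on `n F` only by its constant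
terms, once for each basis vector of `n`. -/
theorem redBar_socleMap (hd : 0 < d) {a b : ℕ} (δ : (Fin a → B k d) →ₗ[B k d] (Fin b → B k d))
    (u : Fin (d - 1) → Fin a → k) :
    redBarK δ (socleMap k hd a u) = socleMap k hd b (fun t => red (constCoeff k d) δ (u t)) := by
  funext j
  have h1 : redBarK δ (socleMap k hd a u) j = ∑ i, Ideal.Quotient.mk (parIdeal k d)
      (LinearMap.toMatrix' δ j i) * socleMap k hd a u i := rfl
  have h2 : ∀ v : Fin a → k, red (constCoeff k d) δ v j =
      ∑ i, constCoeff k d (LinearMap.toMatrix' δ j i) * v i := fun v => by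
    have h3 : v = fun i => constCoeff k d (algebraMap k _ (v i)) := by simp
    conv_lhs => rw [h3, red_apply]
    have h4 := congrFun (LinearMap.toMatrix'_mulVec δ (fun i => algebraMap k (B k d) (v i))) j
    refine (congrArg (constCoeff k d) h4.symm).trans ?_
    rw [Matrix.mulVec, dotProduct, map_sum]
    simp
  rw [h1, socleMap_apply]
  simp only [socleMap_apply, h2, Finset.mul_sum, Finset.sum_smul]
  rw [Finset.sum_comm]
  refine Finset.sum_congr rfl fun t _ => Finset.sum_congr rfl fun i _ => ?_
  rw [mul_smul_comm, mul_eq_smul_of_mem_ker hd _ (socleBasis k hd t).2, bbarCoeff_mk, smul_smul,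
    mul_comm]

theorem finrank_map_ker_augm (hd : 0 < d) {a b : ℕ}
    (δ : (Fin a → B k d) →ₗ[B k d] (Fin b → B k d)) :
    Module.finrank k ((LinearMap.ker (augm hd a)).map (redBarK δ)) =
      (d - 1) * Module.finrank k (LinearMap.range (red (constCoeff k d) δ)) := by
  have h : redBarK δ ∘ₗ socleMap k hd a =
      socleMap k hd b ∘ₗ (red (constCoeff k d) δ).compLeft (Fin (d - 1)) :=
    LinearMap.ext fun u => redBar_socleMap hd δ u
  rw [← range_socleMap, ← LinearMap.range_comp, h, LinearMap.range_comp,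
    ← (Submodule.equivMapOfInjective _ (socleMap_injective hd b) _).finrank_eq,
    finrank_range_compLeft]

theorem finrank_ker_augm (hd : 0 < d) (n : ℕ) :
    Module.finrank k (LinearMap.ker (augm (k := k) hd n)) = (d - 1) * n := by
  rw [← range_socleMap, LinearMap.finrank_range_of_inj (socleMap_injective hd n),
    Module.finrank_pi_fintype]
  simp

theorem map_augm_range_redBar (hd : 0 < d) {a b : ℕ}
    (δ : (Fin a → B k d) →ₗ[B k d] (Fin b → B k d)) :
    (LinearMap.range (redBarK δ)).map (augm hd b) = LinearMap.range (red (constCoeff k d) δ) := by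
  ext w
  constructor
  · rintro ⟨_, ⟨z, rfl⟩, rfl⟩
    exact ⟨_, (augm_redBar hd δ z).symm⟩
  · rintro ⟨v, rfl⟩
    obtain ⟨z, rfl⟩ := augm_surjective hd a v
    exact ⟨_, ⟨z, rfl⟩, augm_redBar hd δ z⟩

variable {a b c : ℕ}

/-- The rank of the reduction modulo `(x ^ d, y ^ d)`, for a complex that stays exact. -/
theorem finrank_range_redBar (hd : 0 < d) (δ' : (Fin a → B k d) →ₗ[B k d] (Fin b → B k d))
    (δ : (Fin b → B k d) →ₗ[B k d] (Fin c → B k d))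
    (h : LinearMap.ker (redBarK δ) = LinearMap.range (redBarK δ')) :
    Module.finrank k (LinearMap.range (redBarK δ)) +
      Module.finrank k (LinearMap.range (red (constCoeff k d) δ')) =
    b + (d - 1) * Module.finrank k (LinearMap.range (red (constCoeff k d) δ)) := by
  have := finite_Bbar (k := k) hd
  -- The kernel is `im δ'`. Split its dimension into the image under the augmentation, which is the
  -- rank of the reduction of `δ'`, and the intersection with `n F`; the latter is the kernel of `δ`
  -- on `n F`, where `δ` is `d - 1` copies of its reduction.
  have h1 := (redBarK δ).finrank_range_add_finrank_ker
  have h2 := finrank_map_add_finrank_inf_ker (augm hd b) (LinearMap.range (redBarK δ'))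
  have h3 := finrank_map_add_finrank_inf_ker (redBarK δ) (LinearMap.ker (augm hd b))
  rw [map_augm_range_redBar, ← h] at h2
  rw [finrank_map_ker_augm, finrank_ker_augm, inf_comm] at h3
  rw [finrank_free_bbar hd] at h1
  have h4 : b * d = b + (d - 1) * b := by
    obtain ⟨d, rfl⟩ := Nat.exists_eq_succ_of_ne_zero hd.ne'
    simp
    ring
  omega

/-- The part of `im δ'` in `n F` lies in the kernel of `δ` on `n F`, whose dimension is `(d - 1)(b -
rank red δ)`. Only the complex property is used, so this applies one step before exactness sets in.
-/
theorem finrank_range_redBar_add_le (hd : 0 < d) (δ' : (Fin a → B k d) →ₗ[B k d] (Fin b → B k d))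
    (δ : (Fin b → B k d) →ₗ[B k d] (Fin c → B k d))
    (h : LinearMap.range (redBarK δ') ≤ LinearMap.ker (redBarK δ)) :
    Module.finrank k (LinearMap.range (redBarK δ')) +
      (d - 1) * Module.finrank k (LinearMap.range (red (constCoeff k d) δ)) ≤
    Module.finrank k (LinearMap.range (red (constCoeff k d) δ')) + (d - 1) * b := by
  have := finite_Bbar (k := k) hd
  have h2 := finrank_map_add_finrank_inf_ker (augm hd b) (LinearMap.range (redBarK δ'))
  have h3 := finrank_map_add_finrank_inf_ker (redBarK δ) (LinearMap.ker (augm hd b))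
  rw [map_augm_range_redBar] at h2
  rw [finrank_map_ker_augm, finrank_ker_augm, inf_comm] at h3
  have h4 := Submodule.finrank_mono (inf_le_inf_right (LinearMap.ker (augm hd b)) h)
  omega

theorem finrank_range_redBar_of_le (hd : 0 < d) (δ : (Fin a → B k d) →ₗ[B k d] (Fin b → B k d))
    (h : LinearMap.ker (augm hd b) ≤ LinearMap.range (redBarK δ)) :
    Module.finrank k (LinearMap.range (redBarK δ)) =
      Module.finrank k (LinearMap.range (red (constCoeff k d) δ)) + (d - 1) * b := by
  have := finite_Bbar (k := k) hd
  have h2 := finrank_map_add_finrank_inf_ker (augm hd b) (LinearMap.range (redBarK δ))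
  rw [map_augm_range_redBar, inf_eq_right.2 h, finrank_ker_augm] at h2
  omega

/-- The map of a free module onto `N ⧸ (x ^ d, y ^ d) N`, and its kernel. -/
theorem finrank_quotient_add_finrank_range_redBar (hd : 0 < d) {N : Type*} [AddCommGroup N]
    [Module (B k d) N] [Module k N] [IsScalarTower k (B k d) N]
    (δ : (Fin a → B k d) →ₗ[B k d] (Fin b → B k d)) (π : (Fin b → B k d) →ₗ[B k d] N)
    (hπ : Function.Surjective π) (h : Function.Exact δ π) :
    Module.finrank k (N ⧸ (parIdeal k d • (⊤ : Submodule (B k d) N))) +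
      Module.finrank k (LinearMap.range (redBarK δ)) = b * d := by
  have := finite_Bbar (k := k) hd
  let g : (Fin b → B k d) →ₗ[k] (N ⧸ (parIdeal k d • (⊤ : Submodule (B k d) N))) :=
    ((parIdeal k d • (⊤ : Submodule (B k d) N)).mkQ ∘ₗ π).restrictScalars k
  let p : (Fin b → B k d) →ₗ[k] (Fin b → Bbar k d) :=
    (Ideal.Quotient.mkₐ k (parIdeal k d)).toLinearMap.compLeft (Fin b)
  let g' : (Fin b → B k d) →ₗ[k] ((Fin b → Bbar k d) ⧸ LinearMap.range (redBarK δ)) :=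
    (LinearMap.range (redBarK δ)).mkQ ∘ₗ p
  have hp : ∀ v, p v = fun i => Ideal.Quotient.mk (parIdeal k d) (v i) := fun v => rfl
  have hg : Function.Surjective g := (Submodule.mkQ_surjective _).comp hπ
  have hg' : Function.Surjective g' := (Submodule.mkQ_surjective _).comp fun z => by
    obtain ⟨v, rfl⟩ := exists_lift z
    exact ⟨v, rfl⟩
  -- Right exactness of reduction: both quotients are `B^b` modulo `im δ + (x^d, y^d) B^b`.
  have hker : LinearMap.ker g = LinearMap.ker g' := by
    ext v
    have h1 : v ∈ LinearMap.ker g ↔ π v ∈ parIdeal k d • (⊤ : Submodule (B k d) N) :=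
      Submodule.Quotient.mk_eq_zero _
    have h2 : v ∈ LinearMap.ker g' ↔ p v ∈ LinearMap.range (redBarK δ) :=
      Submodule.Quotient.mk_eq_zero _
    rw [h1, h2]
    refine (mem_span_pair_smul_top_iff (pw k d 0) (pw k d 1) (π v)).trans ?_
    constructor
    · rintro ⟨x, y, hxy⟩
      obtain ⟨x, rfl⟩ := hπ x
      obtain ⟨y, rfl⟩ := hπ y
      rw [← map_smul, ← map_smul, ← map_add, ← sub_eq_zero, ← map_sub, h] at hxy
      obtain ⟨w, hw⟩ := hxy
      refine ⟨fun i => Ideal.Quotient.mk (parIdeal k d) (w i), ?_⟩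
      rw [LinearMap.restrictScalars_apply, redBar_apply, hw]
      funext i
      rw [hp, Ideal.Quotient.eq, Pi.sub_apply, sub_sub_cancel_left, neg_mem_iff, mem_parIdeal_iff_exists]
      exact ⟨x i, y i, by simp [mul_comm]⟩
    · rintro ⟨z, hz⟩
      obtain ⟨w, rfl⟩ := exists_lift z
      rw [LinearMap.restrictScalars_apply, redBar_apply, hp] at hz
      have h3 : ∀ i, v i - δ w i ∈ parIdeal k d := fun i => by
        rw [← Ideal.Quotient.eq]
        exact (congrFun hz i).symm
      simp only [mem_parIdeal_iff_exists] at h3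
      choose x y hxy using h3
      refine ⟨π x, π y, ?_⟩
      have h4 : v = δ w + (pw k d 0 • x + pw k d 1 • y) := by
        funext i
        simp only [Pi.add_apply, Pi.smul_apply, smul_eq_mul]
        linear_combination -hxy i
      rw [h4, map_add, h.apply_apply_eq_zero, zero_add, map_add, map_smul, map_smul]
  have e1 := ((g.quotKerEquivOfSurjective hg).symm.trans
    ((Submodule.quotEquivOfEq _ _ hker).trans (g'.quotKerEquivOfSurjective hg'))).finrank_eq
  have e2 := Submodule.finrank_quotient_add_finrank (LinearMap.range (redBarK δ))
  rw [finrank_free_bbar hd] at e2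
  omega

end Counting

/-! ### The linear relations and inequalities between Betti numbers -/

section BettiRelations

variable {k : Type u} [Field k] {d : ℕ} {M : Type u} [AddCommGroup M] [Module (B k d) M]
  (F : FreeRes (B k d) M)

theorem koszul_free (hd : 0 < d) {n : ℕ} (p q : Fin n → B k d)
    (h : pw k d 0 • p + pw k d 1 • q = 0) :
    ∃ w : Fin n → B k d, p = pw k d 1 • w ∧ q = -(pw k d 0 • w) := by
  choose w hw1 hw2 using fun i => koszul_B hd (p i) (q i) (congrFun h i)
  exact ⟨w, funext hw1, funext hw2⟩

/-- The first Koszul homology of a second syzygy vanishes. -/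
theorem koszul_ker (hd : 0 < d) {a b : ℕ} (δ : (Fin a → B k d) →ₗ[B k d] (Fin b → B k d))
    (p q : LinearMap.ker δ) (h : pw k d 0 • p + pw k d 1 • q = 0) :
    ∃ w : LinearMap.ker δ, p = pw k d 1 • w ∧ q = -(pw k d 0 • w) := by
  obtain ⟨w, hw1, hw2⟩ := koszul_free hd p.1 q.1 (congrArg Subtype.val h)
  have hw : δ w = 0 := by
    have h1 : pw k d 1 • δ w = 0 := by
      rw [← map_smul, ← hw1]
      exact p.2
    have h2 : pw k d 1 ≠ 0 := fun h => pow_ne_zero d (MvPolynomial.X_ne_zero (R := k) (1 : Fin 2))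
      (congrArg (incl k d) h)
    exact (smul_eq_zero.1 h1).resolve_left h2
  exact ⟨⟨w, hw⟩, Subtype.ext hw1, Subtype.ext hw2⟩

/-- The homology in question is `Tor₁` of `Bbar` with the syzygy `ker (F.δ i)`, that is, its first
Koszul homology, and this vanishes. The proof is the corresponding diagram chase. -/
theorem FreeRes.ker_redBar (hd : 0 < d) (i : ℕ) :
    LinearMap.ker (redBarK (F.δ (i + 2))) = LinearMap.range (redBarK (F.δ (i + 3))) := by
  ext z
  obtain ⟨v, rfl⟩ := exists_lift z
  rw [LinearMap.mem_ker, LinearMap.restrictScalars_apply, redBar_apply]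
  constructor
  · intro h
    have h1 : ∀ j, F.δ (i + 2) v j ∈ parIdeal k d := fun j =>
      Ideal.Quotient.eq_zero_iff_mem.1 (congrFun h j)
    simp only [mem_parIdeal_iff_exists] at h1
    choose p q hpq using h1
    have h2 : F.δ (i + 2) v = pw k d 0 • p + pw k d 1 • q := by
      funext j
      simp only [Pi.add_apply, Pi.smul_apply, smul_eq_mul, ← hpq j]
      ring
    have hmem : ∀ w, F.δ (i + 1) w ∈ LinearMap.ker (F.δ i) := fun w =>
      (F.exact i).apply_apply_eq_zero w
    have h3 : pw k d 0 • F.δ (i + 1) p + pw k d 1 • F.δ (i + 1) q = 0 := by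
      rw [← map_smul, ← map_smul, ← map_add, ← h2]
      exact (F.exact (i + 1)).apply_apply_eq_zero v
    -- With `δ v = x^d p + y^d q`, the images of `p` and `q` form a Koszul cycle on `ker (F.δ i)`.
    -- Writing it as a boundary and lifting `w` to `u` corrects `p` and `q` to cycles without
    -- changing `x^d p + y^d q`.
    obtain ⟨w, hw1, hw2⟩ := koszul_ker hd (F.δ i) ⟨_, hmem p⟩ ⟨_, hmem q⟩ (Subtype.ext h3)
    obtain ⟨u, hu⟩ := (F.exact i w.1).1 w.2
    have hw1' : F.δ (i + 1) p = pw k d 1 • w.1 := congrArg Subtype.val hw1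
    have hw2' : F.δ (i + 1) q = -(pw k d 0 • w.1) := congrArg Subtype.val hw2
    obtain ⟨p', hp'⟩ := (F.exact (i + 1) (p - pw k d 1 • u)).1 (by
      rw [map_sub, map_smul, hu, hw1', sub_self])
    obtain ⟨q', hq'⟩ := (F.exact (i + 1) (q + pw k d 0 • u)).1 (by
      rw [map_add, map_smul, hu, hw2', neg_add_cancel])
    -- Lifting the corrected `p` and `q` shows that `v` is a cycle modulo `(x^d, y^d)`, hence a
    -- boundary there.
    obtain ⟨t, ht⟩ := (F.exact (i + 2) (v - pw k d 0 • p' - pw k d 1 • q')).1 (by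
      rw [map_sub, map_sub, map_smul, map_smul]
      change F.δ (i + 2) v - pw k d 0 • F.δ (i + 1 + 1) p' - pw k d 1 • F.δ (i + 1 + 1) q' = 0
      rw [hp', hq', h2]
      funext j
      simp only [Pi.add_apply, Pi.sub_apply, Pi.smul_apply, smul_eq_mul, Pi.zero_apply]
      ring)
    refine ⟨fun j => Ideal.Quotient.mk (parIdeal k d) (t j), ?_⟩
    rw [LinearMap.restrictScalars_apply, redBar_apply]
    funext j
    rw [Ideal.Quotient.eq]
    change F.δ (i + 2 + 1) t j - v j ∈ _
    rw [ht, mem_parIdeal_iff_exists]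
    refine ⟨-p' j, -q' j, ?_⟩
    simp only [Pi.sub_apply, Pi.smul_apply, smul_eq_mul]
    ring
  · rintro ⟨y, hy⟩
    obtain ⟨t, rfl⟩ := exists_lift y
    rw [LinearMap.restrictScalars_apply, redBar_apply] at hy
    rw [← redBar_apply, ← hy, redBar_apply]
    have h1 : F.δ (i + 2) (F.δ (i + 3) t) = 0 := (F.exact (i + 2)).apply_apply_eq_zero t
    rw [h1]
    funext j
    exact map_zero _

theorem FreeRes.range_redBar_le (i : ℕ) :
    LinearMap.range (redBarK (F.δ (i + 1))) ≤ LinearMap.ker (redBarK (F.δ i)) := by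
  rintro _ ⟨z, rfl⟩
  obtain ⟨v, rfl⟩ := exists_lift z
  rw [LinearMap.mem_ker, LinearMap.restrictScalars_apply, LinearMap.restrictScalars_apply,
    redBar_apply, redBar_apply, (F.exact i).apply_apply_eq_zero v]
  funext j
  exact map_zero _

/-- Additivity of rank along `0 → ker δ₀ → F₁ → F₀ → M → 0`. -/
theorem FreeRes.prk_ker_add (hd : 0 < d) :
    prk k d (LinearMap.ker (F.δ 0)) + F.n 0 * d = F.n 1 * d + prk k d M := by
  have h1 := prk_ker_add_prk_range hd (F.δ 0)
  have h2 := prk_of_surjective hd F.ε F.surj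
  rw [LinearMap.exact_iff.1 F.exact_zero] at h2
  rw [prk_free hd] at h1 h2
  change _ = F.n 1 * d at h1
  omega

/-- The map of the second free module onto the second syzygy. -/
def FreeRes.syz (F : FreeRes (B k d) M) : (Fin (F.n 2) → B k d) →ₗ[B k d] LinearMap.ker (F.δ 0) :=
  (F.δ 1).codRestrict _ fun v => (F.exact 0).apply_apply_eq_zero v

theorem FreeRes.syz_surjective : Function.Surjective F.syz := fun w => by
  obtain ⟨v, hv⟩ := (F.exact 0 w.1).1 w.2
  exact ⟨v, Subtype.ext hv⟩

theorem FreeRes.exact_syz : Function.Exact (F.δ 2) F.syz := fun v => by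
  rw [← F.exact 1 v]
  exact Subtype.ext_iff

/-- The second syzygy `Z` has no first Koszul homology, so its rank is the dimension of `Z/(x^d,
y^d)Z`, and the latter is the cokernel of `F.δ 2` over `Bbar`. -/
theorem FreeRes.prk_ker_add_finrank_range (hd : 0 < d) :
    prk k d (LinearMap.ker (F.δ 0)) + Module.finrank k (LinearMap.range (redBarK (F.δ 2))) =
      F.n 2 * d := by
  have := isNoetherianRing_B (k := k) hd
  rw [← finrank_quotient_eq_prk hd (koszul_ker hd (F.δ 0))]
  exact finrank_quotient_add_finrank_range_redBar hd _ _ F.syz_surjective F.exact_syz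

/-- Both terms `prk` and `rank (redBar (F.δ 2))` are known: the latter is `b₃ + d ρ₂` by the count
over `Bbar`. For a minimal resolution this reads `b₃ = d b₂ - rank Z`. -/
theorem betti_three_eq (F : FreeRes (B k d) M) (hd : 0 < d) :
    betti k d 3 M + prk k d (LinearMap.ker (F.δ 0)) + d * F.rho (constCoeff k d) 2 =
      F.n 2 * d := by
  have h1 := F.prk_ker_add_finrank_range hd
  have h2 := finrank_range_redBar hd (F.δ 3) (F.δ 2) (F.ker_redBar hd 0)
  have h3 := betti_succ F 2
  change _ + F.rho (constCoeff k d) 3 = F.n 3 + (d - 1) * F.rho (constCoeff k d) 2 at h2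
  have h4 : d * F.rho (constCoeff k d) 2 = F.rho (constCoeff k d) 2 +
      (d - 1) * F.rho (constCoeff k d) 2 := by
    obtain ⟨d, rfl⟩ := Nat.exists_eq_succ_of_ne_zero hd.ne'
    simp
    ring
  simp only [Nat.reduceAdd] at h3
  omega

/-- The image of `F.δ 2` over `Bbar` has dimension `b₃ + d ρ₂`, and it is bounded through its part
in `n F₂`. For a minimal resolution this says that `b₃` is at most `dim (n F₂)`. -/
theorem betti_three_le (F : FreeRes (B k d) M) (hd : 0 < d) :
    betti k d 3 M ≤ (d - 1) * betti k d 2 M := by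
  have h1 := finrank_range_redBar hd (F.δ 3) (F.δ 2) (F.ker_redBar hd 0)
  have h2 := finrank_range_redBar_add_le hd (F.δ 2) (F.δ 1) (F.range_redBar_le 1)
  have h3 := betti_succ F 2
  have h4 := betti_succ F 1
  change _ + F.rho (constCoeff k d) 3 = F.n 3 + (d - 1) * F.rho (constCoeff k d) 2 at h1
  change _ + (d - 1) * F.rho (constCoeff k d) 1 ≤ F.rho (constCoeff k d) 2 + (d - 1) * F.n 2 at h2
  simp only [Nat.reduceAdd] at h3 h4
  have h5 := congrArg ((d - 1) * ·) h4
  simp only [mul_add] at h5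
  omega

theorem betti_alternating (F : FreeRes (B k d) M) (hd : 0 < d) :
    d * betti k d 0 M + d * betti k d 2 M = d * betti k d 1 M + betti k d 3 M + prk k d M := by
  have h0 := congrArg (d * ·) (betti_zero F)
  have h1 := congrArg (d * ·) (betti_succ F 0)
  have h2 := congrArg (d * ·) (betti_succ F 1)
  have h3 := betti_three_eq F hd
  have h4 := F.prk_ker_add hd
  simp only [Nat.reduceAdd, mul_add] at h0 h1 h2
  rw [mul_comm (F.n 0), mul_comm (F.n 1)] at h4
  rw [mul_comm (F.n 2)] at h3
  omega

theorem mem_maxIdeal_smul_top_of_forall {n : ℕ} (v : Fin n → B k d)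
    (f : (Fin n → B k d) →ₗ[B k d] M)
    (h : ∀ i, v i ∈ maxIdeal k d) : f v ∈ maxIdeal k d • (⊤ : Submodule (B k d) M) := by
  rw [linearMap_apply_eq_sum]
  exact Submodule.sum_mem _ fun i _ => Submodule.smul_mem_smul (h i) trivial

/-- Modulo `𝔪`, the module `M` is generated by `b_0(M)` elements. -/
theorem FreeRes.exists_generators (F : FreeRes (B k d) M) :
    ∃ v : Fin (betti k d 0 M) → M, ∀ x : M, ∃ c : Fin (betti k d 0 M) → B k d,
      x - ∑ i, c i • v i ∈ maxIdeal k d • (⊤ : Submodule (B k d) M) := by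
  let D := red (constCoeff k d) (F.δ 0)
  have hb : Module.finrank k ((Fin (F.n 0) → k) ⧸ LinearMap.range D) = betti k d 0 M := by
    have h1 := Submodule.finrank_quotient_add_finrank (LinearMap.range D)
    have h2 := betti_zero F
    rw [Module.finrank_fin_fun] at h1
    change _ + Module.finrank k (LinearMap.range D) = _ at h2
    omega
  let β := Module.finBasisOfFinrankEq k _ hb
  choose v hv using fun i => Submodule.Quotient.mk_surjective _ (β i)
  refine ⟨fun i => F.ε (fun j => algebraMap k (B k d) (v i j)), fun x => ?_⟩
  obtain ⟨w, rfl⟩ := F.surj x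
  let w' : Fin (F.n 0) → k := fun j => constCoeff k d (w j)
  let c : Fin (betti k d 0 M) → k := fun i => β.repr (Submodule.Quotient.mk w') i
  -- The `v i` form a basis modulo the image of the reduced differential. What is left over lifts to
  -- a boundary `F.δ 0 t'`, which `F.ε` kills, and then all remaining entries lie in `𝔪`.
  have h1 : w' - ∑ i, c i • v i ∈ LinearMap.range D := by
    have hs : (LinearMap.range D).mkQ w' = ∑ i, c i • (LinearMap.range D).mkQ (v i) := by
      simp only [Submodule.mkQ_apply, hv, c, β.sum_repr]
    rw [← Submodule.ker_mkQ (LinearMap.range D), LinearMap.mem_ker, map_sub, map_sum, hs]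
    simp
  obtain ⟨t, ht⟩ := h1
  let t' : Fin (F.n 1) → B k d := fun j => algebraMap k _ (t j)
  refine ⟨fun i => algebraMap k _ (c i), ?_⟩
  have h2 : F.ε w - ∑ i, algebraMap k (B k d) (c i) • F.ε (fun j => algebraMap k (B k d) (v i j)) =
      F.ε (w - ∑ i, algebraMap k (B k d) (c i) • (fun j => algebraMap k (B k d) (v i j)) -
        F.δ 0 t') := by
    rw [map_sub, map_sub, map_sum, F.exact_zero.apply_apply_eq_zero, sub_zero]
    simp only [map_smul]
  rw [h2]
  refine mem_maxIdeal_smul_top_of_forall _ _ fun j => ?_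
  have h3 : constCoeff k d (F.δ 0 t' j) = D t j := rfl
  rw [mem_maxIdeal_iff, Pi.sub_apply, map_sub, h3, ht]
  simp [w', Finset.sum_apply]

theorem prk_le_betti_zero (F : FreeRes (B k d) M) (hd : 0 < d) :
    prk k d M ≤ betti k d 0 M * d := by
  have : Module.Finite (B k d) M := Module.Finite.of_surjective F.ε F.surj
  obtain ⟨v, hv⟩ := F.exists_generators
  exact prk_le_of_span_mod_maxIdeal hd v hv

theorem smul_top_eq_top_of_betti_zero (F : FreeRes (B k d) M) (h : betti k d 0 M = 0) :
    maxIdeal k d • (⊤ : Submodule (B k d) M) = ⊤ := by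
  obtain ⟨v, hv⟩ := F.exists_generators
  have : IsEmpty (Fin (betti k d 0 M)) := by
    rw [h]
    infer_instance
  rw [eq_top_iff]
  rintro x -
  obtain ⟨c, hc⟩ := hv x
  simpa using hc

end BettiRelations

/-! ### Gradings and homogeneous components -/

section Grading

/-- A family of subgroups with projections is a grading. -/
theorem isInternal_of_projections {W : Type*} [AddCommGroup W] (𝒲 : ℤ → AddSubgroup W)
    (htop : ⨆ i, 𝒲 i = ⊤) (p : ℤ → W →+ W) (h1 : ∀ i, ∀ x ∈ 𝒲 i, p i x = x)
    (h2 : ∀ i j, i ≠ j → ∀ x ∈ 𝒲 i, p j x = 0) : DirectSum.IsInternal 𝒲 := by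
  classical
  constructor
  · rw [injective_iff_map_eq_zero]
    intro x hx
    have key : ∀ (x : DirectSum ℤ fun i => 𝒲 i) (j : ℤ),
        p j (DirectSum.coeAddMonoidHom 𝒲 x) = x j := by
      intro x j
      induction x using DirectSum.induction_on with
      | zero => simp
      | of i y =>
        rw [DirectSum.coeAddMonoidHom_of, DirectSum.of_apply]
        split_ifs with h
        · subst h
          exact h1 _ _ y.2
        · exact h2 _ _ h _ y.2
      | add x y hx hy => simp [hx, hy]
    ext j
    rw [← key, hx, map_zero]
    rfl
  · rw [← AddMonoidHom.range_eq_top, eq_top_iff, ← htop, iSup_le_iff]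
    intro i x hx
    exact ⟨DirectSum.of (fun i => 𝒲 i) i ⟨x, hx⟩, DirectSum.coeAddMonoidHom_of _ _ _⟩

/-- If a graded map takes a value in degree `j` then it takes this value at an element of degree
`j`. -/
theorem exists_mem_piece_of_graded {V W W' : Type*} [AddCommGroup V] [AddCommGroup W]
    [AddCommGroup W'] (𝒱 : ℤ → AddSubgroup V) (𝒲 : ℤ → Set W) (hV : ⨆ i, 𝒱 i = ⊤) (f : V →+ W)
    (hf : ∀ i, ∀ x ∈ 𝒱 i, f x ∈ 𝒲 i) (j : ℤ) (ι p : W →+ W') (hι : Function.Injective ι)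
    (h1 : ∀ x ∈ 𝒲 j, p x = ι x) (h2 : ∀ i, i ≠ j → ∀ x ∈ 𝒲 i, p x = 0) (v : V)
    (hv : f v ∈ 𝒲 j) : ∃ v' ∈ 𝒱 j, f v' = f v := by
  -- Take for `v'` the degree `j` component of `v`; it is built by induction over sums because no
  -- projection on `V` is given.
  have key : ∀ v : V, ∃ v' ∈ 𝒱 j, ι (f v') = p (f v) := by
    intro v
    have hv : v ∈ ⨆ i, 𝒱 i := hV ▸ AddSubgroup.mem_top v
    induction hv using AddSubgroup.iSup_induction' with
    | hp i x hx =>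
      by_cases hij : i = j
      · subst hij
        exact ⟨x, hx, (h1 _ (hf _ _ hx)).symm⟩
      · exact ⟨0, zero_mem _, by rw [h2 i hij _ (hf _ _ hx), map_zero, map_zero]⟩
    | h1 => exact ⟨0, zero_mem _, by simp⟩
    | hadd x y _ _ hx hy =>
      obtain ⟨x', hx', hx⟩ := hx
      obtain ⟨y', hy', hy⟩ := hy
      exact ⟨x' + y', add_mem hx' hy', by simp [hx, hy]⟩
  obtain ⟨v', hv', h⟩ := key v
  exact ⟨v', hv', hι (by rw [h, h1 _ hv])⟩

variable {k : Type u} [Field k] {d : ℕ}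

theorem monomial_mem_polyPiece {m : Fin 2 →₀ ℕ} {n : ℤ} (h : (m.degree : ℤ) = n) (c : k) :
    MvPolynomial.monomial m c ∈ polyPiece k n := by
  rw [mem_polyPiece_iff]
  intro m' hm'
  rw [Finset.mem_singleton.1 (MvPolynomial.support_monomial_subset hm'), h]

theorem mem_ringPiece_iff (n : ℤ) (b : B k d) :
    b ∈ ringPiece k d n ↔ incl k d b ∈ polyPiece k (n * d) := Iff.rfl

theorem eq_sum_monomials (b : B k d) : b = ∑ m ∈ (incl k d b).support.attach,
    mkB (MvPolynomial.monomial m.1 ((incl k d b).coeff m.1))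
      (monomial_mem_ring (incl_mem b m.1 m.2).choose_spec _) := by
  apply incl_injective
  rw [map_sum]
  simp only [incl_mkB]
  rw [Finset.sum_attach _ (fun m => MvPolynomial.monomial m ((incl k d b).coeff m)),
    MvPolynomial.support_sum_monomial_coeff]

/-- Every element of `B` is a sum of homogeneous elements of nonnegative degree. -/
theorem B_induction {P : B k d → Prop} (h0 : P 0) (hadd : ∀ a b, P a → P b → P (a + b))
    (hpiece : ∀ (n : ℕ) (b : B k d), b ∈ ringPiece k d n → P b) (b : B k d) : P b := by
  rw [eq_sum_monomials b]
  refine Finset.sum_induction _ P hadd h0 fun m _ => ?_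
  obtain ⟨n, hn⟩ := incl_mem b m.1 m.2
  exact hpiece n _ (monomial_mem_polyPiece (by rw [hn]; simp) _)

/-- Every element of `𝔪` is a sum of homogeneous elements of positive degree. -/
theorem maxIdeal_induction {P : B k d → Prop} (h0 : P 0) (hadd : ∀ a b, P a → P b → P (a + b))
    (hpiece : ∀ (n : ℕ) (b : B k d), 0 < n → b ∈ ringPiece k d n → P b) {b : B k d}
    (hb : b ∈ maxIdeal k d) : P b := by
  rw [eq_sum_monomials b]
  refine Finset.sum_induction _ P hadd h0 fun m _ => ?_
  obtain ⟨n, hn⟩ := incl_mem b m.1 m.2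
  refine hpiece n _ (Nat.pos_of_ne_zero ?_) (monomial_mem_polyPiece (by rw [hn]; simp) _)
  rintro rfl
  rw [zero_mul, Finsupp.degree_eq_zero_iff] at hn
  have hm := MvPolynomial.mem_support_iff.1 m.2
  rw [hn] at hm
  rw [mem_maxIdeal_iff, constCoeff_apply] at hb
  exact hm hb

end Grading

/-! ### Graded Nakayama and vanishing in large degrees -/

namespace GradedModule

variable {k : Type u} [Field k] {d : ℕ} (M : GradedModule k d)

theorem smul_mem_of_nat (n : ℕ) {b : B k d} (hb : b ∈ ringPiece k d n) {N : ℤ} {x : M.carrier}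
    (hx : x ∈ ⨆ i : {i : ℤ // N ≤ i}, M.piece i) :
    b • x ∈ ⨆ i : {i : ℤ // N + n ≤ i}, M.piece i := by
  induction hx using AddSubgroup.iSup_induction' with
  | hp i x hx =>
    exact AddSubgroup.mem_iSup_of_mem ⟨(n : ℤ) + i.1, by have := i.2; omega⟩
      (M.smul_mem n i.1 b x hb hx)
  | h1 => simp
  | hadd x y _ _ hx hy =>
    rw [smul_add]
    exact add_mem hx hy

theorem iSup_piece_anti {N N' : ℤ} (h : N ≤ N') :
    ⨆ i : {i : ℤ // N' ≤ i}, M.piece i ≤ ⨆ i : {i : ℤ // N ≤ i}, M.piece i :=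
  iSup_le fun i => le_iSup (fun i : {i : ℤ // N ≤ i} => M.piece i) ⟨i.1, h.trans i.2⟩

/-- The submodule of elements whose components of degree less than `N` vanish. -/
def above (N : ℤ) : Submodule (B k d) M.carrier where
  toAddSubmonoid := (⨆ i : {i : ℤ // N ≤ i}, M.piece i).toAddSubmonoid
  smul_mem' b x hx := by
    induction b using B_induction with
    | h0 =>
      rw [zero_smul]
      exact zero_mem (⨆ i : {i : ℤ // N ≤ i}, M.piece i)
    | hadd a b ha hb =>
      rw [add_smul]
      exact add_mem (S := AddSubgroup M.carrier) ha hb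
    | hpiece n b hb => exact M.iSup_piece_anti (by omega) (M.smul_mem_of_nat n hb hx)

theorem piece_le_above {j : ℤ} {x : M.carrier} (hx : x ∈ M.piece j) : x ∈ M.above j :=
  AddSubgroup.mem_iSup_of_mem (⟨j, le_rfl⟩ : {i : ℤ // j ≤ i}) hx

theorem iSup_piece_eq_top : ⨆ i, M.piece i = ⊤ := by
  classical
  rw [eq_top_iff]
  rintro x -
  obtain ⟨y, rfl⟩ := M.isInternal.2 x
  induction y using DirectSum.induction_on with
  | zero => simp
  | of i y =>
    rw [DirectSum.coeAddMonoidHom_of]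
    exact AddSubgroup.mem_iSup_of_mem i y.2
  | add x y hx hy =>
    rw [map_add]
    exact add_mem hx hy

theorem eq_zero_of_mem_above {j : ℤ} {x : M.carrier} (hx : x ∈ M.piece j)
    (hx' : x ∈ M.above (j + 1)) : x = 0 := by
  have h := M.isInternal.addSubgroup_iSupIndep j
  rw [AddSubgroup.disjoint_def] at h
  refine h hx ?_
  have hle : ⨆ i : {i : ℤ // j + 1 ≤ i}, M.piece i ≤ ⨆ i, ⨆ (_ : i ≠ j), M.piece i :=
    iSup_le fun i => le_iSup₂_of_le i.1 (by have := i.2; omega) le_rfl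
  exact hle hx'

theorem smul_mem_above_succ {j : ℤ} {b : B k d} (hb : b ∈ maxIdeal k d) {x : M.carrier}
    (hx : x ∈ M.above j) : b • x ∈ M.above (j + 1) := by
  refine maxIdeal_induction (P := fun b => b • x ∈ M.above (j + 1)) ?_ ?_ ?_ hb
  · simp
  · intro a b ha hb
    rw [add_smul]
    exact add_mem ha hb
  · intro n b hn hb
    exact M.iSup_piece_anti (by omega) (M.smul_mem_of_nat n hb hx)

/-- Graded Nakayama without a bound on the degrees: some `s` in `1 + 𝔪` kills `M`, and a homogeneous
`x` then equals `-(s - 1) x`, which has only components of larger degree. -/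
theorem subsingleton_of_smul_top [Module.Finite (B k d) M.carrier]
    (h : maxIdeal k d • (⊤ : Submodule (B k d) M.carrier) = ⊤) : Subsingleton M.carrier := by
  obtain ⟨s, hs1, hs⟩ := Submodule.exists_sub_one_mem_and_smul_eq_zero_of_fg_of_le_smul
    (maxIdeal k d) (⊤ : Submodule (B k d) M.carrier) Module.Finite.fg_top h.ge
  have hpiece : ∀ j, ∀ x ∈ M.piece j, x = 0 := fun j x hx => by
    refine M.eq_zero_of_mem_above hx ?_
    have h1 := M.smul_mem_above_succ hs1 (M.piece_le_above hx)
    rw [sub_smul, hs x trivial, one_smul, zero_sub, neg_mem_iff] at h1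
    exact h1
  refine subsingleton_of_forall_eq 0 fun x => ?_
  have hx : x ∈ ⨆ i, M.piece i := M.iSup_piece_eq_top ▸ AddSubgroup.mem_top x
  induction hx using AddSubgroup.iSup_induction' with
  | hp i x hx => exact hpiece i x hx
  | h1 => rfl
  | hadd x y _ _ hx hy => rw [hx, hy, add_zero]

/-- The submodules `above n` form a descending chain, which stabilizes in an artinian module. A
homogeneous element of degree `j` past that point also lies in `above (j + 1)`, so it vanishes. -/
theorem exists_piece_eq_zero (h : IsFiniteLength (B k d) M.carrier) :
    ∃ n : ℕ, ∀ j : ℤ, n ≤ j → ∀ x ∈ M.piece j, x = 0 := by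
  obtain ⟨-, hart⟩ := isFiniteLength_iff_isNoetherian_isArtinian.1 h
  let f : ℕ →o (Submodule (B k d) M.carrier)ᵒᵈ :=
    ⟨fun n => OrderDual.toDual (M.above n), fun a b hab =>
      M.iSup_piece_anti (Int.ofNat_le.2 hab)⟩
  obtain ⟨n, hn⟩ := IsArtinian.monotone_stabilizes f
  refine ⟨n, fun j hj x hx => ?_⟩
  obtain ⟨j, rfl⟩ := Int.eq_ofNat_of_zero_le (by omega : 0 ≤ j)
  refine M.eq_zero_of_mem_above hx ?_
  have h1 : M.above n = M.above ((j + 1 : ℕ) : ℤ) := hn (j + 1) (by omega)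
  have h2 : x ∈ M.above n := M.iSup_piece_anti hj (M.piece_le_above hx)
  rw [h1] at h2
  exact_mod_cast h2

end GradedModule

/-! ### Graded quotients of `B` -/

section QuotientGrading

variable {k : Type u} [Field k] {d : ℕ}

/-- The projection of `S` onto its homogeneous part of degree `n`. -/
def compS (k : Type u) [Field k] (n : ℤ) : S k →ₗ[k] S k :=
  MvPolynomial.weightedHomogeneousComponent (fun _ : Fin 2 => (1 : ℤ)) n

theorem compS_of_mem {n : ℤ} {p : S k} (hp : p ∈ polyPiece k n) : compS k n p = p :=
  MvPolynomial.IsWeightedHomogeneous.weightedHomogeneousComponent_same hp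

theorem compS_of_mem_ne {m n : ℤ} {p : S k} (hp : p ∈ polyPiece k m) (h : m ≠ n) :
    compS k n p = 0 :=
  MvPolynomial.IsWeightedHomogeneous.weightedHomogeneousComponent_ne n hp h.symm

theorem support_compS_subset (n : ℤ) (p : S k) : (compS k n p).support ⊆ p.support := by
  intro m hm
  rw [MvPolynomial.mem_support_iff] at hm ⊢
  intro h
  apply hm
  rw [compS, MvPolynomial.coeff_weightedHomogeneousComponent, h, ite_self]

/-- The projection of `B` onto its part of degree `n`. -/
def compB (k : Type u) [Field k] (d : ℕ) (n : ℤ) : B k d →ₗ[k] B k d where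
  toFun b := mkB (compS k (n * d) (incl k d b))
    (fun m hm => incl_mem b m (support_compS_subset _ _ hm))
  map_add' a b := incl_injective (by
    simp only [incl_mkB, map_add]
    rfl)
  map_smul' c b := incl_injective (by
    simp only [incl_mkB, map_smul, RingHom.id_apply]
    rfl)

@[simp]
theorem incl_compB (n : ℤ) (b : B k d) : incl k d (compB k d n b) = compS k (n * d) (incl k d b) :=
  rfl

theorem compB_of_mem {n : ℤ} {b : B k d} (h : b ∈ ringPiece k d n) : compB k d n b = b :=
  incl_injective (compS_of_mem h)

theorem compB_of_mem_ne (hd : 0 < d) {m n : ℤ} {b : B k d} (h : b ∈ ringPiece k d m)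
    (hmn : m ≠ n) : compB k d n b = 0 := by
  apply incl_injective
  rw [incl_compB, map_zero]
  refine compS_of_mem_ne h fun h => hmn ?_
  exact mul_right_cancel₀ (by exact_mod_cast hd.ne') h

theorem mul_mem_polyPiece {m n : ℤ} {p q : S k} (hp : p ∈ polyPiece k m) (hq : q ∈ polyPiece k n) :
    p * q ∈ polyPiece k (m + n) := MvPolynomial.IsWeightedHomogeneous.mul hp hq

theorem mul_mem_ringPiece {m n : ℤ} {a b : B k d} (ha : a ∈ ringPiece k d m)
    (hb : b ∈ ringPiece k d n) : a * b ∈ ringPiece k d (m + n) := by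
  rw [mem_ringPiece_iff, map_mul, add_mul]
  exact mul_mem_polyPiece ha hb

/-- An ideal with homogeneous generators contains the components of its elements, so the projections
of `B` descend to the quotient. -/
theorem compB_mem_span (hd : 0 < d) {r : ℕ} (g : Fin r → B k d) (e : Fin r → ℤ)
    (hg : ∀ i, g i ∈ ringPiece k d (e i)) (n : ℤ) {b : B k d}
    (hb : b ∈ Ideal.span (Set.range g)) : compB k d n b ∈ Ideal.span (Set.range g) := by
  obtain ⟨c, rfl⟩ := (Submodule.mem_span_range_iff_exists_fun _).1 hb
  rw [map_sum]
  refine Submodule.sum_mem _ fun i _ => ?_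
  have hi : g i ∈ Ideal.span (Set.range g) := Ideal.subset_span ⟨i, rfl⟩
  refine B_induction (P := fun b => compB k d n (b • g i) ∈ Ideal.span (Set.range g)) ?_ ?_ ?_ (c i)
  · simp
  · intro a b ha hb
    rw [add_smul, map_add]
    exact add_mem ha hb
  · intro m b hb
    have h := mul_mem_ringPiece hb (hg i)
    rw [smul_eq_mul]
    by_cases hmn : (m : ℤ) + e i = n
    · subst hmn
      rw [compB_of_mem h]
      exact Ideal.mul_mem_left _ _ hi
    · rw [compB_of_mem_ne hd h hmn]
      exact zero_mem _

/-- The quotient of `B` by an ideal with homogeneous generators, as a graded module. -/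
def quotientGraded (hd : 0 < d) {r : ℕ} (g : Fin r → B k d) (e : Fin r → ℤ)
    (hg : ∀ i, g i ∈ ringPiece k d (e i)) : GradedModule k d where
  carrier := B k d ⧸ Ideal.span (Set.range g)
  piece n := (ringPiece k d n).toAddSubgroup.map
    (Ideal.Quotient.mk (Ideal.span (Set.range g))).toAddMonoidHom
  isInternal := by
    have hle : ∀ n, (Ideal.span (Set.range g)).restrictScalars k ≤ LinearMap.ker
        ((Ideal.Quotient.mkₐ k (Ideal.span (Set.range g))).toLinearMap ∘ₗ compB k d n) := by
      intro n b hb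
      rw [LinearMap.mem_ker]
      exact Ideal.Quotient.eq_zero_iff_mem.2 (compB_mem_span hd g e hg n hb)
    let p : ℤ → (B k d ⧸ Ideal.span (Set.range g)) →ₗ[k] (B k d ⧸ Ideal.span (Set.range g)) :=
      fun n => (Submodule.liftQ _ _ (hle n)) ∘ₗ
        (Submodule.Quotient.restrictScalarsEquiv k (Ideal.span (Set.range g))).symm.toLinearMap
    have hp : ∀ n b, p n (Ideal.Quotient.mk _ b) = Ideal.Quotient.mk _ (compB k d n b) :=
      fun n b => rfl
    refine isInternal_of_projections _ ?_ (fun n => (p n).toAddMonoidHom) ?_ ?_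
    · rw [eq_top_iff]
      rintro x -
      obtain ⟨b, rfl⟩ := Ideal.Quotient.mk_surjective x
      induction b using B_induction with
      | h0 => simp
      | hadd a b ha hb =>
        rw [map_add]
        exact add_mem ha hb
      | hpiece n b hb => exact AddSubgroup.mem_iSup_of_mem (n : ℤ) ⟨b, hb, rfl⟩
    · rintro n _ ⟨b, hb, rfl⟩
      refine (hp n b).trans ?_
      rw [compB_of_mem hb]
      rfl
    · rintro m n hmn _ ⟨b, hb, rfl⟩
      refine (hp n b).trans ?_
      rw [compB_of_mem_ne hd hb hmn, map_zero]
  smul_mem := by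
    rintro i j b _ hb ⟨c, hc, rfl⟩
    exact ⟨b * c, mul_mem_ringPiece hb hc, rfl⟩

end QuotientGrading

/-! ### Hilbert–Burch resolution of the pure modules -/

section HilbertBurch

variable {k : Type u} [Field k] {d : ℕ}

/-- The second syzygies of the powers of `(x ^ e, y ^ e)`. -/
theorem exists_hilbertBurch {ℓ e : ℕ} (he : 0 < e) (hd : ℓ + e = d) (T : ℕ) (f : Fin (T + 1) → S k)
    (hf : ∀ i, f i ∈ ring k d)
    (h : ∑ i, f i * ((MvPolynomial.X 0 ^ e) ^ (T - i : ℕ) * (MvPolynomial.X 1 ^ e) ^ (i : ℕ)) = 0) :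
    ∃ w : Fin T → S k, (∀ i, w i ∈ mcm k d ℓ) ∧ ∀ i, f i =
      MvPolynomial.X 1 ^ e * (Fin.snoc w 0 : Fin (T + 1) → S k) i -
        MvPolynomial.X 0 ^ e * (Fin.cons 0 w : Fin (T + 1) → S k) i := by
  induction T with
  | zero =>
    refine ⟨Fin.elim0, fun i => i.elim0, fun i => ?_⟩
    obtain rfl : i = 0 := Fin.ext (by omega)
    have h1 : f 0 = 0 := by simpa using h
    rw [h1]
    simp [Fin.snoc]
  | succ T ih =>
    rw [Fin.sum_univ_succ] at h
    -- Every term but the first contains `y^e`, so `f 0 = y^e w0`, and `w0` lies in `M^(ℓ)` because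
    -- `f 0` lies in `B`. Adding `x^e w0` to `f 1` removes the Koszul relation of the first two
    -- generators, and the rest, divided by `y^e`, is a relation for `T`.
    have h1 : (MvPolynomial.X 1 ^ e : S k) ∣
        f 0 * ((MvPolynomial.X 0 ^ e) ^ (T + 1)) := by
      refine ⟨-∑ i : Fin (T + 1), f i.succ *
        ((MvPolynomial.X 0 ^ e) ^ (T - i : ℕ) * (MvPolynomial.X 1 ^ e) ^ (i : ℕ)), ?_⟩
      rw [mul_neg, Finset.mul_sum, eq_neg_iff_add_eq_zero, ← h]
      congr 1
      · simp
      · refine Finset.sum_congr rfl fun i _ => ?_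
        rw [Fin.val_succ, Nat.add_sub_add_right, pow_succ (MvPolynomial.X 1 ^ e)]
        ring
    have hrel : ¬ (MvPolynomial.X 1 : S k) ∣ (MvPolynomial.X 0 ^ e) ^ (T + 1) := by
      intro hdvd
      have h2 := (MvPolynomial.X_prime (R := k) (i := (1 : Fin 2))).dvd_of_dvd_pow
        ((MvPolynomial.X_prime (R := k) (i := (1 : Fin 2))).dvd_of_dvd_pow hdvd)
      rw [MvPolynomial.X_dvd_X] at h2
      simp at h2
    obtain ⟨w0, hw0⟩ := (MvPolynomial.X_prime (R := k) (i := (1 : Fin 2))).pow_dvd_of_dvd_mul_right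
      e hrel h1
    have hw0m : w0 ∈ mcm k d ℓ := (X_pow_mul_mem_ring_iff he hd 1 w0).1 (hw0 ▸ hf 0)
    obtain ⟨w, hw, hfw⟩ := ih
      (fun i => f i.succ + (Fin.cons (MvPolynomial.X 0 ^ e * w0) 0 : Fin (T + 1) → S k) i)
      (fun i => by
        refine add_mem (hf _) ?_
        cases i using Fin.cases with
        | zero => exact (X_pow_mul_mem_ring_iff he hd 0 w0).2 hw0m
        | succ i => exact zero_mem (ring k d))
      (by
        have h2 : (MvPolynomial.X 1 ^ e : S k) ≠ 0 := pow_ne_zero _ (MvPolynomial.X_ne_zero _)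
        apply mul_left_cancel₀ h2
        rw [mul_zero, ← h]
        simp only [add_mul, Finset.sum_add_distrib, mul_add]
        rw [add_comm, hw0]
        congr 1
        · rw [Fin.sum_univ_succ]
          simp
          ring
        · rw [Finset.mul_sum]
          refine Finset.sum_congr rfl fun i _ => ?_
          rw [Fin.val_succ, Nat.add_sub_add_right, pow_succ (MvPolynomial.X 1 ^ e)]
          ring)
    refine ⟨Fin.cons w0 w, fun i => ?_, fun i => ?_⟩
    · cases i using Fin.cases with
      | zero => exact hw0m
      | succ i => exact hw i
    · rw [← Fin.cons_snoc_eq_snoc_cons]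
      cases i using Fin.cases with
      | zero => simp [hw0]
      | succ i =>
        have h3 := hfw i
        rw [← eq_sub_iff_add_eq] at h3
        rw [h3, Fin.cons_succ, Fin.cons_succ]
        cases i using Fin.cases with
        | zero => simp
        | succ i => simp

variable (k d)

/-- The generators `x ^ {e (T - i)} y ^ {e i}`. -/
def powGen (e T D : ℕ) (h : T * e = D * d) (i : Fin (T + 1)) : B k d :=
  mkB ((MvPolynomial.X 0 ^ e) ^ (T - i : ℕ) * (MvPolynomial.X 1 ^ e) ^ (i : ℕ)) (by
    rw [← pow_mul, ← pow_mul, MvPolynomial.X_pow_eq_monomial, MvPolynomial.X_pow_eq_monomial,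
      MvPolynomial.monomial_mul]
    refine monomial_mem_ring (n := D) ?_ _
    rw [map_add, Finsupp.degree_single, Finsupp.degree_single, ← h, ← mul_add, mul_comm]
    congr 1
    omega)

variable {k d}

theorem powGen_mem (e T D : ℕ) (h : T * e = D * d) (i : Fin (T + 1)) :
    powGen k d e T D h i ∈ ringPiece k d D := by
  rw [mem_ringPiece_iff, powGen, incl_mkB, ← pow_mul, ← pow_mul, MvPolynomial.X_pow_eq_monomial,
    MvPolynomial.X_pow_eq_monomial, MvPolynomial.monomial_mul]
  refine monomial_mem_polyPiece ?_ _
  rw [map_add, Finsupp.degree_single, Finsupp.degree_single, ← mul_add]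
  have h1 : e * (T - i + i) = D * d := by
    rw [← h, mul_comm]
    congr 1
    omega
  exact_mod_cast h1

theorem mem_maxIdeal_of_mem_ringPiece {n : ℤ} (hn : n * d ≠ 0) {b : B k d}
    (hb : b ∈ ringPiece k d n) : b ∈ maxIdeal k d := by
  rw [mem_maxIdeal_iff, constCoeff_apply]
  by_contra h
  have h1 := (mem_polyPiece_iff _ _).1 hb 0 (MvPolynomial.mem_support_iff.2 h)
  simp only [map_zero, Nat.cast_zero] at h1
  exact hn h1.symm

/-- The first differential of the resolution of `B ⧸ (x ^ e, y ^ e) ^ T ∩ B`. -/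
def powDiff₁ (e T D : ℕ) (h : T * e = D * d) :
    (Fin (T + 1) → B k d) →ₗ[B k d] (Fin 1 → B k d) :=
  LinearMap.pi fun _ => Fintype.linearCombination (B k d) (powGen k d e T D h)

theorem powDiff₁_apply (e T D : ℕ) (h : T * e = D * d) (v : Fin (T + 1) → B k d) (b : Fin 1) :
    powDiff₁ e T D h v b = ∑ i, v i * powGen k d e T D h i := by
  simp [powDiff₁, Fintype.linearCombination_apply]

theorem snoc_add {n : ℕ} {A : Type*} [AddMonoid A] (v w : Fin n → A) :
    (Fin.snoc (v + w) 0 : Fin (n + 1) → A) = Fin.snoc v 0 + Fin.snoc w 0 := by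
  funext i
  cases i using Fin.lastCases with
  | last => simp
  | cast i => simp

theorem cons_add {n : ℕ} {A : Type*} [AddMonoid A] (v w : Fin n → A) :
    (Fin.cons 0 (v + w) : Fin (n + 1) → A) = Fin.cons 0 v + Fin.cons 0 w := by
  funext i
  cases i using Fin.cases with
  | zero => simp
  | succ i => simp

/-- The second differential of the resolution of `B ⧸ (x ^ e, y ^ e) ^ T ∩ B`. -/
def powDiff₂ {ℓ e : ℕ} (he : 0 < e) (hd : ℓ + e = d) (T : ℕ) :
    (Fin T → mcm k d ℓ) →ₗ[B k d] (Fin (T + 1) → B k d) where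
  toFun w := fun i =>
    mkB (MvPolynomial.X 1 ^ e * ((Fin.snoc w 0 : Fin (T + 1) → mcm k d ℓ) i : S k))
      ((X_pow_mul_mem_ring_iff he hd 1 _).2 (Subtype.mem _)) -
    mkB (MvPolynomial.X 0 ^ e * ((Fin.cons 0 w : Fin (T + 1) → mcm k d ℓ) i : S k))
      ((X_pow_mul_mem_ring_iff he hd 0 _).2 (Subtype.mem _))
  map_add' v w := by
    funext i
    apply incl_injective
    simp only [snoc_add, cons_add, Pi.add_apply, map_sub, map_add, incl_mkB, Submodule.coe_add]
    ring
  map_smul' c w := by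
    funext i
    apply incl_injective
    have h1 : (Fin.snoc (c • w) 0 : Fin (T + 1) → mcm k d ℓ) i =
        c • (Fin.snoc w 0 : Fin (T + 1) → mcm k d ℓ) i := by
      cases i using Fin.lastCases <;> simp
    have h2 : (Fin.cons 0 (c • w) : Fin (T + 1) → mcm k d ℓ) i =
        c • (Fin.cons 0 w : Fin (T + 1) → mcm k d ℓ) i := by
      cases i using Fin.cases <;> simp
    simp only [h1, h2, Pi.smul_apply, map_sub, map_mul, incl_mkB, coe_smul_mcm, RingHom.id_apply,
      smul_eq_mul]
    ring

theorem incl_powDiff₂ {ℓ e : ℕ} (he : 0 < e) (hd : ℓ + e = d) (T : ℕ) (w : Fin T → mcm k d ℓ)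
    (i : Fin (T + 1)) : incl k d (powDiff₂ he hd T w i) =
      MvPolynomial.X 1 ^ e * ((Fin.snoc w 0 : Fin (T + 1) → mcm k d ℓ) i : S k) -
      MvPolynomial.X 0 ^ e * ((Fin.cons 0 w : Fin (T + 1) → mcm k d ℓ) i : S k) := rfl

theorem powDiff₂_injective {ℓ e : ℕ} (he : 0 < e) (hd : ℓ + e = d) (T : ℕ) :
    Function.Injective (powDiff₂ (k := k) he hd T) := by
  rw [injective_iff_map_eq_zero]
  intro w hw
  have hX : (MvPolynomial.X 1 ^ e : S k) ≠ 0 := pow_ne_zero _ (MvPolynomial.X_ne_zero _)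
  -- The matrix is bidiagonal: row `n` reads `y^e w_n - x^e w_{n-1}`, so the `w_n` vanish one after
  -- another.
  have key : ∀ n (hn : n < T), w ⟨n, hn⟩ = 0 := by
    intro n
    induction n with
    | zero =>
      intro hn
      have h1 := incl_powDiff₂ he hd T w (Fin.castSucc ⟨0, hn⟩)
      have h2 : Fin.castSucc ⟨0, hn⟩ = 0 := rfl
      rw [hw, Fin.snoc_castSucc, h2, Fin.cons_zero] at h1
      simp only [Pi.zero_apply, map_zero, Submodule.coe_zero, mul_zero, sub_zero] at h1
      exact Subtype.ext ((mul_eq_zero.1 h1.symm).resolve_left hX)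
    | succ n ih =>
      intro hn
      have h1 := incl_powDiff₂ he hd T w (Fin.castSucc ⟨n + 1, hn⟩)
      have h2 : Fin.castSucc ⟨n + 1, hn⟩ = Fin.succ ⟨n, by omega⟩ := rfl
      rw [hw, Fin.snoc_castSucc, h2, Fin.cons_succ, ih] at h1
      simp only [Pi.zero_apply, map_zero, Submodule.coe_zero, mul_zero, sub_zero] at h1
      exact Subtype.ext ((mul_eq_zero.1 h1.symm).resolve_left hX)
  funext i
  exact key i.1 i.2

theorem exact_powDiff {ℓ e : ℕ} (he : 0 < e) (hd : ℓ + e = d) (T D : ℕ) (h : T * e = D * d) :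
    Function.Exact (powDiff₂ (k := k) he hd T) (powDiff₁ e T D h) := by
  have hincl : ∀ v : Fin (T + 1) → B k d, incl k d (powDiff₁ e T D h v 0) =
      ∑ i, incl k d (v i) *
        ((MvPolynomial.X 0 ^ e) ^ (T - i : ℕ) * (MvPolynomial.X 1 ^ e) ^ (i : ℕ)) := fun v => by
    rw [powDiff₁_apply, map_sum]
    simp only [map_mul]
    rfl
  intro v
  constructor
  · intro hv
    have h1 := hincl v
    rw [hv, Pi.zero_apply, map_zero] at h1
    obtain ⟨w, hw, hvw⟩ := exists_hilbertBurch he hd T (fun i => incl k d (v i))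
      (fun i => incl_mem _) h1.symm
    refine ⟨fun i => ⟨w i, hw i⟩, funext fun i => incl_injective ?_⟩
    rw [incl_powDiff₂, hvw]
    congr 2
    · cases i using Fin.lastCases <;> simp
    · cases i using Fin.cases <;> simp
  · rintro ⟨w, rfl⟩
    funext b
    obtain rfl : b = 0 := Subsingleton.elim _ _
    apply incl_injective
    rw [hincl, Pi.zero_apply, map_zero]
    simp only [incl_powDiff₂, sub_mul, Finset.sum_sub_distrib]
    -- The two sums are indexed with a shift of one, and their boundary terms vanish through the
    -- zeros put in by `snoc` and `cons`; then they cancel termwise.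
    rw [Fin.sum_univ_castSucc, Fin.sum_univ_succ (n := T)]
    simp only [Fin.snoc_castSucc, Fin.snoc_last, Fin.cons_succ, Fin.cons_zero,
      Submodule.coe_zero, mul_zero, zero_mul, add_zero, zero_add, Fin.val_castSucc, Fin.val_succ]
    rw [sub_eq_zero]
    refine Finset.sum_congr rfl fun i _ => ?_
    have h2 : T - (i : ℕ) = T - (i + 1) + 1 := by omega
    rw [h2, pow_succ (MvPolynomial.X 0 ^ e), pow_succ (MvPolynomial.X 1 ^ e)]
    ring

end HilbertBurch

/-! ### Existence of modules with pure resolutions -/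

section PureModules

variable {k : Type u} [Field k] {d : ℕ}

theorem isFiniteLength_quotient_of_finite (J : Ideal (B k d)) [Module.Finite k (B k d ⧸ J)] :
    IsFiniteLength (B k d) (B k d ⧸ J) := by
  rw [isFiniteLength_iff_isNoetherian_isArtinian]
  exact ⟨isNoetherian_of_tower k inferInstance, isArtinian_of_tower k inferInstance⟩

/-- The quotient of the monomial by `x_i^(N d)` still has degree divisible by `d`, so the division
takes place in `B`. -/
theorem monomial_mem_of_le {J : Ideal (B k d)} {N : ℕ} (i : Fin 2) {g : B k d} (hg : g ∈ J)
    (hgN : incl k d g = MvPolynomial.X i ^ (N * d)) {m : Fin 2 →₀ ℕ} {n : ℕ}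
    (hm : m.degree = n * d) (c : k) (h : N * d ≤ m i) :
    mkB (MvPolynomial.monomial m c) (monomial_mem_ring hm c) ∈ J := by
  have hle : Finsupp.single i (N * d) ≤ m := by
    rw [Finsupp.single_le_iff]
    exact h
  have h1 : m = (m - Finsupp.single i (N * d)) + Finsupp.single i (N * d) :=
    (tsub_add_cancel_of_le hle).symm
  have h2 : (m - Finsupp.single i (N * d)).degree = (n - N) * d := by
    have h3 := congrArg Finsupp.degree h1
    rw [map_add, Finsupp.degree_single] at h3
    rw [Nat.sub_mul]
    omega
  have h4 : mkB (MvPolynomial.monomial m c) (monomial_mem_ring hm c) =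
      mkB (MvPolynomial.monomial _ c) (monomial_mem_ring h2 c) * g := by
    apply incl_injective
    rw [map_mul, incl_mkB, incl_mkB, hgN, MvPolynomial.X_pow_eq_monomial,
      MvPolynomial.monomial_mul, ← h1, mul_one]
  rw [h4]
  exact Ideal.mul_mem_left _ _ hg

/-- Modulo powers of both variables only the finitely many monomials with both exponents below `N d`
survive. -/
theorem finite_quotient_of_X_pow_mem {J : Ideal (B k d)} {N : ℕ} (g : Fin 2 → B k d)
    (hg : ∀ i, g i ∈ J) (hgN : ∀ i, incl k d (g i) = MvPolynomial.X i ^ (N * d)) :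
    Module.Finite k (B k d ⧸ J) := by
  refine Module.finite_def.2 (Submodule.fg_def.2
    ⟨Set.range (fun i => Ideal.Quotient.mk J (genB k d (N * d) i)), Set.finite_range _, ?_⟩)
  rw [eq_top_iff]
  rintro x -
  obtain ⟨b, rfl⟩ := Ideal.Quotient.mk_surjective x
  rw [eq_sum_monomials b, map_sum]
  suffices key : ∀ (m : Fin 2 →₀ ℕ) (n : ℕ) (hm : m.degree = n * d) (c : k),
      Ideal.Quotient.mk J (mkB (MvPolynomial.monomial m c) (monomial_mem_ring hm c)) ∈
        Submodule.span k (Set.range fun i => Ideal.Quotient.mk J (genB k d (N * d) i)) from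
    Submodule.sum_mem _ fun m _ => key m.1 _ (incl_mem b m.1 m.2).choose_spec _
  intro m n hm c
  by_cases h : m 0 < N * d ∧ m 1 < N * d
  · have hdvd : d ∣ m 0 + m 1 := ⟨n, by rw [← degree_fin_two, hm, mul_comm]⟩
    have h1 : mkB (MvPolynomial.monomial m c) (monomial_mem_ring hm c) =
        c • genB k d (N * d) (⟨m 0, h.1⟩, ⟨m 1, h.2⟩) := by
      apply incl_injective
      rw [genB, dif_pos hdvd, map_smul, incl_mkB, incl_mkB, ← fin_two_finsupp_eq,
        MvPolynomial.smul_monomial, smul_eq_mul, mul_one]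
    rw [h1]
    change c • Ideal.Quotient.mk J (genB k d (N * d) (⟨m 0, h.1⟩, ⟨m 1, h.2⟩)) ∈ _
    exact Submodule.smul_mem _ c (Submodule.subset_span (Set.mem_range_self _))
  · have h1 : mkB (MvPolynomial.monomial m c) (monomial_mem_ring hm c) ∈ J := by
      rw [not_and_or, not_lt, not_lt] at h
      rcases h with h | h
      · exact monomial_mem_of_le 0 (hg 0) (hgN 0) hm c h
      · exact monomial_mem_of_le 1 (hg 1) (hgN 1) hm c h
    rw [Ideal.Quotient.eq_zero_iff_mem.2 h1]
    exact zero_mem _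

theorem hasPureResolution_powGen {ℓ e : ℕ} (he : 0 < e) (hℓe : ℓ + e = d) (hd : 0 < d) (T D : ℕ)
    (h : T * e = D * d) (hD : 0 < D) :
    HasPureResolution (quotientGraded hd (powGen k d e T D h) (fun _ => (D : ℤ))
      (powGen_mem e T D h)) 0 D (D + 1) ℓ := by
  have hmax : ∀ i, powGen k d e T D h i ∈ maxIdeal k d := fun i =>
    mem_maxIdeal_of_mem_ringPiece (n := D) (by positivity) (powGen_mem e T D h i)
  refine ⟨by omega, ?_, 1, T + 1, T,
    (Submodule.mkQ (Ideal.span (Set.range (powGen k d e T D h)))) ∘ₗ LinearMap.proj 0,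
    powDiff₁ e T D h, powDiff₂ he hℓe T, ?_, ?_, exact_powDiff he hℓe T D h,
    powDiff₂_injective he hℓe T, ?_, ?_, ?_, ?_, ?_⟩
  · have := finite_quotient_of_X_pow_mem (J := Ideal.span (Set.range (powGen k d e T D h)))
      (N := D) ![powGen k d e T D h 0, powGen k d e T D h (Fin.last T)]
      (by
        intro i
        fin_cases i
        · exact Ideal.subset_span ⟨_, rfl⟩
        · exact Ideal.subset_span ⟨_, rfl⟩)
      (by
        intro i
        fin_cases i
        · simp [powGen, ← pow_mul, ← h, mul_comm]
        · simp [powGen, ← pow_mul, ← h, mul_comm])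
    exact isFiniteLength_quotient_of_finite _
  · intro x
    obtain ⟨b, rfl⟩ := Submodule.mkQ_surjective _ x
    exact ⟨fun _ => b, rfl⟩
  · intro v
    refine (Submodule.Quotient.mk_eq_zero _).trans ?_
    refine (Submodule.mem_span_range_iff_exists_fun (B k d)).trans ⟨?_, ?_⟩
    · rintro ⟨c, hc⟩
      refine ⟨c, funext fun b => ?_⟩
      obtain rfl : b = 0 := Subsingleton.elim _ _
      rw [powDiff₁_apply]
      exact hc
    · rintro ⟨c, rfl⟩
      refine ⟨c, ?_⟩
      exact (powDiff₁_apply e T D h c 0).symm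
  · intro j v hv
    refine ⟨v 0, ?_, rfl⟩
    have := hv 0
    rwa [sub_zero] at this
  · intro j v hv b
    rw [powDiff₁_apply]
    refine Submodule.sum_mem _ fun i _ => ?_
    have := mul_mem_ringPiece (hv i) (powGen_mem e T D h i)
    rwa [sub_add_cancel, ← sub_zero j] at this
  · intro j v hv b
    rw [mem_ringPiece_iff, incl_powDiff₂]
    have hX : ∀ (i : Fin 2) (p : S k), p ∈ polyPiece k ((j - (D + 1)) * d + ℓ) →
        MvPolynomial.X i ^ e * p ∈ polyPiece k ((j - D) * d) := fun i p hp => by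
      have h1 : (MvPolynomial.X i ^ e : S k) ∈ polyPiece k e := by
        rw [MvPolynomial.X_pow_eq_monomial]
        exact monomial_mem_polyPiece (by rw [Finsupp.degree_single]) 1
      have h2 := mul_mem_polyPiece h1 hp
      -- Because `e + ℓ = d`, the second differential raises the shift by exactly one.
      have h3 : (e : ℤ) + ((j - (D + 1)) * d + ℓ) = (j - D) * d := by
        rw [← hℓe]
        push_cast
        ring
      rwa [h3] at h2
    refine sub_mem (hX 1 _ ?_) (hX 0 _ ?_)
    · cases b using Fin.lastCases with
      | last => simp
      | cast i => simpa using hv i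
    · cases b using Fin.cases with
      | zero => simp
      | succ i => simpa using hv i
  · intro v b
    rw [powDiff₁_apply]
    exact Submodule.sum_mem _ fun i _ => Ideal.mul_mem_left _ _ (hmax i)
  · intro v b
    rw [mem_maxIdeal_iff, constCoeff_apply, incl_powDiff₂]
    simp [he.ne']

theorem nontrivial_quotientGraded (hd : 0 < d) {r : ℕ} (g : Fin r → B k d) (e : Fin r → ℤ)
    (hg : ∀ i, g i ∈ ringPiece k d (e i)) (h : ∀ i, g i ∈ maxIdeal k d) :
    Nontrivial (quotientGraded hd g e hg).carrier := by
  refine Ideal.Quotient.nontrivial_iff.2 fun htop => ?_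
  have h1 : (1 : B k d) ∈ maxIdeal k d := by
    have h2 : Ideal.span (Set.range g) ≤ maxIdeal k d := by
      rw [Ideal.span_le]
      rintro _ ⟨i, rfl⟩
      exact h i
    exact h2 (htop ▸ Submodule.mem_top)
  rw [mem_maxIdeal_iff, map_one] at h1
  exact one_ne_zero h1

theorem pureBettiVecs_nonempty {ℓ e : ℕ} (he : 0 < e) (hℓe : ℓ + e = d) (T D : ℕ)
    (h : T * e = D * d) (hD : 0 < D) : (pureBettiVecs k d 0 D (D + 1) ℓ).Nonempty := by
  have hd : 0 < d := by omega
  refine ⟨_, _, ?_, hasPureResolution_powGen he hℓe hd T D h hD, rfl⟩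
  exact nontrivial_quotientGraded hd _ _ _ fun i =>
    mem_maxIdeal_of_mem_ringPiece (n := D) (by positivity) (powGen_mem e T D h i)

end PureModules

/-! ### Hilbert functions of pure modules -/

section HilbertFunction

variable {k : Type u} [Field k] {d : ℕ}

theorem finrank_polyPiece (m : ℕ) : Module.finrank k (polyPiece k m) = m + 1 := by
  let s : Set (Fin 2 →₀ ℕ) := {x | Finsupp.weight (fun _ : Fin 2 => (1 : ℤ)) x = m}
  have hs : ∀ x, x ∈ s ↔ x 0 + x 1 = m := fun x => by
    have h : Finsupp.weight (fun _ : Fin 2 => (1 : ℤ)) x = (x.degree : ℤ) := by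
      simp [Finsupp.weight_apply, Finsupp.degree_apply, Finsupp.sum]
    change Finsupp.weight (fun _ : Fin 2 => (1 : ℤ)) x = m ↔ _
    rw [h, degree_fin_two]
    norm_cast
  have h1 : Module.finrank k (polyPiece k m) = Nat.card s := by
    rw [polyPiece, MvPolynomial.weightedHomogeneousSubmodule_eq_finsupp_supported]
    exact Module.finrank_eq_nat_card_basis (MvPolynomial.basisRestrictSupport k s)
  rw [h1, ← Nat.card_fin (m + 1)]
  symm
  refine Nat.card_eq_of_bijective (fun i : Fin (m + 1) =>
    (⟨Finsupp.single 0 (i : ℕ) + Finsupp.single 1 (m - i), (hs _).2 (by simp; omega)⟩ : s)) ⟨?_, ?_⟩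
  · intro i j hij
    have := DFunLike.congr_fun (congrArg Subtype.val hij) 0
    simpa [Fin.ext_iff] using this
  · rintro ⟨x, hx⟩
    have hx' := (hs x).1 hx
    refine ⟨⟨x 0, by omega⟩, Subtype.ext ?_⟩
    refine Eq.trans ?_ (fin_two_finsupp_eq x).symm
    have h2 : m - x 0 = x 1 := by omega
    simp only [h2]

theorem mem_ring_of_mem_polyPiece {n : ℕ} {p : S k} (hp : p ∈ polyPiece k ((n : ℤ) * d)) :
    p ∈ ring k d := fun m hm =>
  ⟨n, by exact_mod_cast (mem_polyPiece_iff _ _).1 hp m hm⟩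

theorem mem_mcm_of_mem_polyPiece {n ℓ : ℕ} {p : S k} (hp : p ∈ polyPiece k ((n : ℤ) * d + ℓ)) :
    p ∈ mcm k d ℓ := fun m hm =>
  ⟨n, by exact_mod_cast (mem_polyPiece_iff _ _).1 hp m hm⟩

theorem finrank_ringPiece (n : ℕ) : Module.finrank k (ringPiece k d n) = n * d + 1 := by
  have h1 : (ringPiece k d n).map (incl k d).toLinearMap = polyPiece k ((n * d : ℕ) : ℤ) := by
    rw [ringPiece, Submodule.map_comap_eq]
    push_cast
    refine inf_eq_right.2 fun p hp => ⟨mkB p (mem_ring_of_mem_polyPiece hp), rfl⟩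
  rw [← finrank_polyPiece (k := k), ← h1]
  exact (Submodule.equivMapOfInjective _ incl_injective _).finrank_eq

instance : IsScalarTower k (B k d) (S k) := inferInstanceAs (IsScalarTower k (ring k d) (S k))

/-- The inclusion of a graded piece of `M^{(ℓ)}`. -/
def mcmPiece (k : Type u) [Field k] (d ℓ n : ℕ) : polyPiece k ((n : ℤ) * d + ℓ) →ₗ[k] mcm k d ℓ where
  toFun p := ⟨p, mem_mcm_of_mem_polyPiece p.2⟩
  map_add' _ _ := rfl
  map_smul' _ _ := rfl

theorem finrank_fin_fun_of_injective {V W : Type*} [AddCommGroup V] [Module k V] [AddCommGroup W]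
    [Module k W] [Module.Finite k V] (r : ℕ) (f : (Fin r → V) →ₗ[k] W)
    (hf : Function.Injective f) :
    Module.finrank k (LinearMap.range f) = r * Module.finrank k V := by
  rw [LinearMap.finrank_range_of_inj hf, Module.finrank_pi_fintype]
  simp

/-- The dimension count for an exact sequence in a fixed degree. -/
theorem dimension_count {ℓ r₀ r₁ r₂ n₀ n₁ n₂ : ℕ}
    (δ₁ : (Fin r₁ → B k d) →ₗ[B k d] (Fin r₀ → B k d))
    (δ₂ : (Fin r₂ → mcm k d ℓ) →ₗ[B k d] (Fin r₁ → B k d))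
    (hinj : Function.Injective δ₂)
    (h1 : ∀ v : Fin r₁ → B k d, (∀ a, v a ∈ ringPiece k d n₁) → ∀ b, δ₁ v b ∈ ringPiece k d n₀)
    (h1' : ∀ v : Fin r₀ → B k d, (∀ a, v a ∈ ringPiece k d n₀) →
      ∃ w, (∀ a, w a ∈ ringPiece k d n₁) ∧ δ₁ w = v)
    (h2 : ∀ v : Fin r₂ → mcm k d ℓ, (∀ a, (v a : S k) ∈ polyPiece k ((n₂ : ℤ) * d + ℓ)) →
      (∀ b, δ₂ v b ∈ ringPiece k d n₁) ∧ δ₁ (δ₂ v) = 0)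
    (h2' : ∀ v : Fin r₁ → B k d, (∀ a, v a ∈ ringPiece k d n₁) → δ₁ v = 0 →
      ∃ w : Fin r₂ → mcm k d ℓ, (∀ a, (w a : S k) ∈ polyPiece k ((n₂ : ℤ) * d + ℓ)) ∧ δ₂ w = v) :
    r₀ * (n₀ * d + 1) + r₂ * (n₂ * d + ℓ + 1) = r₁ * (n₁ * d + 1) := by
  have hfin : ∀ n : ℕ, Module.Finite k (ringPiece k d n) := fun n =>
    Module.finite_of_finrank_pos (by rw [finrank_ringPiece]; omega)
  have hd2 : Module.finrank k (polyPiece k ((n₂ : ℤ) * d + ℓ)) = n₂ * d + ℓ + 1 := by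
    rw [← finrank_polyPiece (k := k)]
    push_cast
    rfl
  have hfin2 : Module.Finite k (polyPiece k ((n₂ : ℤ) * d + ℓ)) :=
    Module.finite_of_finrank_pos (by omega)
  let ι : ∀ r n, (Fin r → ringPiece k d n) →ₗ[k] (Fin r → B k d) := fun r n =>
    (ringPiece k d n).subtype.compLeft (Fin r)
  have hι : ∀ r n, Function.Injective (ι r n) := fun r n x y h =>
    funext fun i => Subtype.ext (congrFun h i)
  let κ : (Fin r₂ → polyPiece k ((n₂ : ℤ) * d + ℓ)) →ₗ[k] (Fin r₂ → mcm k d ℓ) :=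
    (mcmPiece k d ℓ n₂).compLeft (Fin r₂)
  have hκ : Function.Injective κ := fun x y h =>
    funext fun i => Subtype.ext
      (congrArg (fun q : mcm k d ℓ => (q : S k)) (congrFun h i))
  let f₁ := δ₁.restrictScalars k ∘ₗ ι r₁ n₁
  let f₂ := δ₂.restrictScalars k ∘ₗ κ
  -- In the chosen degree `δ₁` is onto and its kernel is the image of `δ₂`, so rank–nullity for `f₁`
  -- is the claim.
  have e1 : LinearMap.range f₁ = LinearMap.range (ι r₀ n₀) := by
    ext v
    constructor
    · rintro ⟨w, rfl⟩
      exact ⟨fun b => ⟨_, h1 (ι r₁ n₁ w) (fun a => (w a).2) b⟩, rfl⟩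
    · rintro ⟨w, rfl⟩
      obtain ⟨z, hz, h⟩ := h1' (ι r₀ n₀ w) fun a => (w a).2
      exact ⟨fun a => ⟨z a, hz a⟩, h⟩
  have e2 : (LinearMap.ker f₁).map (ι r₁ n₁) = LinearMap.range f₂ := by
    ext v
    constructor
    · rintro ⟨w, hw, rfl⟩
      obtain ⟨z, hz, h⟩ := h2' (ι r₁ n₁ w) (fun a => (w a).2) hw
      exact ⟨fun a => ⟨z a, hz a⟩, h⟩
    · rintro ⟨w, rfl⟩
      obtain ⟨h, h'⟩ := h2 (κ w) fun a => (w a).2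
      exact ⟨fun b => ⟨_, h b⟩, h', rfl⟩
  have h3 := f₁.finrank_range_add_finrank_ker
  have h4 : Module.finrank k (LinearMap.ker f₁) =
      Module.finrank k ((LinearMap.ker f₁).map (ι r₁ n₁)) :=
    (Submodule.equivMapOfInjective _ (hι r₁ n₁) _).finrank_eq
  rw [h4, e1, e2, finrank_fin_fun_of_injective _ _ (hι r₀ n₀),
    finrank_fin_fun_of_injective _ f₂ (hinj.comp hκ), Module.finrank_pi_fintype] at h3
  simpa [finrank_ringPiece, hd2] using h3

theorem iSup_pi_eq_top {A : Type*} [AddCommGroup A] (𝒜 : ℤ → AddSubgroup A) (h : ⨆ i, 𝒜 i = ⊤)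
    (r : ℕ) : ⨆ i, AddSubgroup.pi Set.univ (fun _ : Fin r => 𝒜 i) = ⊤ := by
  rw [eq_top_iff]
  rintro v -
  rw [← Finset.univ_sum_single v]
  refine AddSubgroup.sum_mem _ fun a _ => ?_
  have ha : v a ∈ ⨆ i, 𝒜 i := h ▸ AddSubgroup.mem_top _
  generalize v a = x at ha
  induction ha using AddSubgroup.iSup_induction' with
  | hp i x hx =>
    refine AddSubgroup.mem_iSup_of_mem i ?_
    rw [AddSubgroup.mem_pi]
    intro b _
    by_cases hab : b = a
    · subst hab
      simpa using hx
    · simp [Pi.single_eq_of_ne hab]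
  | h1 => simp
  | hadd x y _ _ hx hy =>
    rw [Pi.single_add]
    exact add_mem hx hy

theorem iSup_ringPiece_eq_top (n : ℤ) :
    ⨆ j : ℤ, (ringPiece k d (j - n)).toAddSubgroup = ⊤ := by
  rw [eq_top_iff]
  rintro b -
  induction b using B_induction with
  | h0 => exact zero_mem _
  | hadd a b ha hb => exact add_mem (ha) (hb)
  | hpiece i b hb => exact AddSubgroup.mem_iSup_of_mem (n + i) (by simpa using hb)

theorem iSup_mcmPiece_eq_top (ℓ : ℕ) (n : ℤ) :
    ⨆ j : ℤ, (polyPiece k ((j - n) * d + ℓ)).toAddSubgroup.comap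
      (mcm k d ℓ).subtype.toAddMonoidHom = ⊤ := by
  rw [eq_top_iff]
  rintro q -
  have hmono : ∀ (m : Fin 2 →₀ ℕ), m ∈ (q : S k).support → ∀ c : k,
      MvPolynomial.monomial m c ∈ mcm k d ℓ := by
    intro m hm c m' hm'
    rw [Finset.mem_singleton.1 (MvPolynomial.support_monomial_subset hm')]
    exact q.2 m hm
  have hq : q = ∑ m ∈ (q : S k).support.attach,
      ⟨MvPolynomial.monomial m.1 ((q : S k).coeff m.1), hmono m.1 m.2 _⟩ := by
    apply Subtype.ext
    rw [AddSubmonoidClass.coe_finsetSum]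
    simp only
    rw [Finset.sum_attach _ (fun m => MvPolynomial.monomial m ((q : S k).coeff m)),
      MvPolynomial.support_sum_monomial_coeff]
  rw [hq]
  refine AddSubgroup.sum_mem _ fun m _ => ?_
  obtain ⟨i, hi⟩ := q.2 m.1 m.2
  exact AddSubgroup.mem_iSup_of_mem (n + i)
    (monomial_mem_polyPiece (by rw [hi]; push_cast; ring) _)

/-- The Hilbert function of a pure module vanishes in large degrees. -/
theorem pure_dimension_count (hd : 0 < d) (M : GradedModule k d)
    (hM : IsFiniteLength (B k d) M.carrier) {ℓ D r₀ r₁ r₂ : ℕ}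
    (ε : (Fin r₀ → B k d) →ₗ[B k d] M.carrier)
    (δ₁ : (Fin r₁ → B k d) →ₗ[B k d] (Fin r₀ → B k d))
    (δ₂ : (Fin r₂ → mcm k d ℓ) →ₗ[B k d] (Fin r₁ → B k d))
    (hex : Function.Exact δ₁ ε) (hex' : Function.Exact δ₂ δ₁) (hinj : Function.Injective δ₂)
    (hε : ∀ (j : ℤ) (v : Fin r₀ → B k d), (∀ a, v a ∈ ringPiece k d (j - 0)) → ε v ∈ M.piece j)
    (h1 : ∀ (j : ℤ) (v : Fin r₁ → B k d), (∀ a, v a ∈ ringPiece k d (j - D)) →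
      ∀ b, δ₁ v b ∈ ringPiece k d (j - 0))
    (h2 : ∀ (j : ℤ) (v : Fin r₂ → mcm k d ℓ),
      (∀ a, (v a : S k) ∈ polyPiece k ((j - (D + 1)) * d + ℓ)) →
      ∀ b, δ₂ v b ∈ ringPiece k d (j - D)) :
    ∃ s₀ : ℕ, ∀ s, s₀ ≤ s →
      r₀ * ((D + 1 + s) * d + 1) + r₂ * (s * d + ℓ + 1) = r₁ * ((1 + s) * d + 1) := by
  obtain ⟨s₀, hs₀⟩ := M.exists_piece_eq_zero hM
  refine ⟨s₀, fun s hs => ?_⟩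
  -- In this degree all three shifted degrees are nonnegative, so each dimension is given by its
  -- polynomial formula.
  let j : ℤ := ((D + 1 + s : ℕ) : ℤ)
  have j0 : j - 0 = ((D + 1 + s : ℕ) : ℤ) := by simp [j]
  have j1 : j - D = ((1 + s : ℕ) : ℤ) := by simp [j]; ring
  have j2 : j - (D + 1) = (s : ℤ) := by simp [j]
  have hproj : ∀ (r : ℕ) (D : ℤ), ∀ x ∈ {v : Fin r → B k d | ∀ a, v a ∈ ringPiece k d (j - D)},
      ((compB k d (j - D)).compLeft (Fin r)).toAddMonoidHom x = AddMonoidHom.id _ x :=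
    fun r D x hx => funext fun a => compB_of_mem (hx a)
  have hproj' : ∀ (r : ℕ) (D : ℤ), ∀ i, i ≠ j →
      ∀ x ∈ {v : Fin r → B k d | ∀ a, v a ∈ ringPiece k d (i - D)},
      ((compB k d (j - D)).compLeft (Fin r)).toAddMonoidHom x = 0 :=
    fun r D i hij x hx => funext fun a => compB_of_mem_ne hd (hx a) (by simpa using hij)
  refine dimension_count δ₁ δ₂ hinj ?_ ?_ ?_ ?_
  · intro v hv
    rw [← j0]
    rw [← j1] at hv
    exact h1 j v hv
  · intro v hv
    rw [← j0] at hv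
    rw [← j1]
    -- As `M` vanishes in degree `j`, the element `v` has a preimage; replacing it by its component
    -- of degree `j` makes it homogeneous.
    obtain ⟨w, hw⟩ := (hex v).1 (hs₀ j (by simp only [j]; push_cast; omega) _ (hε j v hv))
    obtain ⟨w', hw', h⟩ := exists_mem_piece_of_graded _
      (fun i => {v : Fin r₀ → B k d | ∀ a, v a ∈ ringPiece k d (i - 0)})
      (iSup_pi_eq_top _ (iSup_ringPiece_eq_top (k := k) (d := d) D) r₁) δ₁.toAddMonoidHom
      (fun i x hx => h1 i x fun a => (AddSubgroup.mem_pi _).1 hx a trivial) j (AddMonoidHom.id _)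
      ((compB k d (j - 0)).compLeft (Fin r₀)).toAddMonoidHom Function.injective_id
      (hproj r₀ 0) (hproj' r₀ 0) w
      (by
        change ∀ a, δ₁ w a ∈ _
        rw [hw]
        exact hv)
    exact ⟨w', fun a => (AddSubgroup.mem_pi _).1 hw' a trivial, h.trans hw⟩
  · intro v hv
    rw [← j1]
    rw [← j2] at hv
    exact ⟨h2 j v hv, hex'.apply_apply_eq_zero v⟩
  · intro v hv hv0
    rw [← j1] at hv
    rw [← j2]
    obtain ⟨w, hw⟩ := (hex' v).1 hv0
    obtain ⟨w', hw', h⟩ := exists_mem_piece_of_graded _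
      (fun i => {v : Fin r₁ → B k d | ∀ a, v a ∈ ringPiece k d (i - D)})
      (iSup_pi_eq_top _ (iSup_mcmPiece_eq_top (k := k) (d := d) ℓ (D + 1)) r₂) δ₂.toAddMonoidHom
      (fun i x hx => h2 i x fun a => (AddSubgroup.mem_pi _).1 hx a trivial) j (AddMonoidHom.id _)
      ((compB k d (j - D)).compLeft (Fin r₁)).toAddMonoidHom Function.injective_id
      (hproj r₁ D) (hproj' r₁ D) w
      (by
        change ∀ a, δ₂ w a ∈ _
        rw [hw]
        exact hv)
    exact ⟨w', fun a => (AddSubgroup.mem_pi _).1 hw' a trivial, h.trans hw⟩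

end HilbertFunction

/-! ### Betti numbers of pure modules -/

section PureBetti

variable {k : Type u} [Field k] {d : ℕ}

theorem red_eq_zero {a b : ℕ} (δ : (Fin a → B k d) →ₗ[B k d] (Fin b → B k d))
    (h : ∀ v i, δ v i ∈ maxIdeal k d) : red (constCoeff k d) δ = 0 := by
  ext i j
  exact (mem_maxIdeal_iff _).1 (h _ _)

theorem FreeRes.rho_eq_zero {M : Type u} [AddCommGroup M] [Module (B k d) M]
    (F : FreeRes (B k d) M) (i : ℕ) (h : ∀ v j, F.δ i v j ∈ maxIdeal k d) :
    F.rho (constCoeff k d) i = 0 := by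
  rw [FreeRes.rho, red_eq_zero _ h, LinearMap.range_zero, finrank_bot]

theorem betti_ofFree {M : Type u} [AddCommGroup M] [Module (B k d) M] {r : ℕ}
    (φ : (Fin r → B k d) ≃ₗ[B k d] M) : betti k d 0 M = r ∧ ∀ i, betti k d (i + 1) M = 0 := by
  have hrho := fun i => (FreeRes.ofFree r φ).rho_eq_zero i fun v j => by
    change (0 : B k d) ∈ _
    exact zero_mem _
  constructor
  · have h := betti_zero (FreeRes.ofFree r φ)
    rw [hrho] at h
    exact h
  · intro i
    have h := betti_succ (FreeRes.ofFree r φ) i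
    rw [hrho, hrho] at h
    exact h

/-- If `𝔪 N = (x ^ d, y ^ d) N` then the first syzygies of `N` contain the elements with entries
in `𝔪`, modulo `(x ^ d, y ^ d)`. -/
theorem FreeRes.ker_augm_le {N : Type u} [AddCommGroup N] [Module (B k d) N] (hd : 0 < d)
    (F : FreeRes (B k d) N)
    (hN : ∀ f ∈ maxIdeal k d, ∀ q : N, ∃ u v : N, f • q = pw k d 0 • u + pw k d 1 • v) :
    LinearMap.ker (augm hd (F.n 0)) ≤ LinearMap.range (redBarK (F.δ 0)) := by
  intro z hz
  obtain ⟨v, rfl⟩ := exists_lift z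
  have hv : ∀ i, v i ∈ maxIdeal k d := fun i => (mem_maxIdeal_iff _).2 (congrFun hz i)
  choose u w huw using fun i => hN (v i) (hv i) (F.ε (Pi.single i 1))
  obtain ⟨u', hu'⟩ := F.surj (∑ i, u i)
  obtain ⟨w', hw'⟩ := F.surj (∑ i, w i)
  have h1 : F.ε (v - pw k d 0 • u' - pw k d 1 • w') = 0 := by
    rw [map_sub, map_sub, map_smul, map_smul, hu', hw', linearMap_apply_eq_sum F.ε v]
    simp only [huw]
    rw [Finset.sum_add_distrib, ← Finset.smul_sum, ← Finset.smul_sum]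
    abel
  obtain ⟨y, hy⟩ := (F.exact_zero _).1 h1
  refine ⟨fun i => Ideal.Quotient.mk _ (y i), ?_⟩
  rw [LinearMap.restrictScalars_apply, redBar_apply, hy]
  funext j
  have h2 : ∀ i, Ideal.Quotient.mk (parIdeal k d) (pw k d i) = 0 := fun i =>
    Ideal.Quotient.eq_zero_iff_mem.2 (Ideal.subset_span (by fin_cases i <;> simp))
  simp [h2]

/-- The resolution of a module with a presentation by `N`. -/
def FreeRes.splice₂ {M N : Type u} [AddCommGroup M] [Module (B k d) M] [AddCommGroup N]
    [Module (B k d) N] (F : FreeRes (B k d) N) {r₀ r₁ : ℕ} (ε : (Fin r₀ → B k d) →ₗ[B k d] M)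
    (δ₁ : (Fin r₁ → B k d) →ₗ[B k d] (Fin r₀ → B k d)) (δ₂ : N →ₗ[B k d] (Fin r₁ → B k d))
    (hε : Function.Surjective ε) (hex : Function.Exact δ₁ ε) (hex' : Function.Exact δ₂ δ₁)
    (hinj : Function.Injective δ₂) : FreeRes (B k d) M :=
  (F.splice δ₂ δ₁.rangeRestrict hinj δ₁.surjective_rangeRestrict (fun v => by
    rw [← hex' v]
    exact Subtype.ext_iff)).splice (LinearMap.range δ₁).subtype ε Subtype.val_injective hε
    (fun v => by
      rw [hex v]
      constructor
      · rintro ⟨w, rfl⟩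
        exact ⟨δ₁.rangeRestrict w, rfl⟩
      · rintro ⟨⟨_, w, rfl⟩, rfl⟩
        exact ⟨w, rfl⟩)

/-- The Betti numbers of a pure module, in terms of those of the second syzygy. -/
theorem betti_pure {M N : Type u} [AddCommGroup M] [Module (B k d) M] [AddCommGroup N]
    [Module (B k d) N] (hd : 0 < d) (F : FreeRes (B k d) N) {r₀ r₁ : ℕ}
    (ε : (Fin r₀ → B k d) →ₗ[B k d] M)
    (δ₁ : (Fin r₁ → B k d) →ₗ[B k d] (Fin r₀ → B k d)) (δ₂ : N →ₗ[B k d] (Fin r₁ → B k d))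
    (hε : Function.Surjective ε) (hex : Function.Exact δ₁ ε) (hex' : Function.Exact δ₂ δ₁)
    (hinj : Function.Injective δ₂) (h1 : ∀ v b, δ₁ v b ∈ maxIdeal k d)
    (h2 : ∀ v b, δ₂ v b ∈ maxIdeal k d) :
    betti k d 0 M = r₀ ∧ betti k d 1 M = r₁ ∧
      betti k d 2 M = betti k d 0 N ∧
      betti k d 3 M + prk k d N = d * betti k d 2 M ∧
      ((∀ f ∈ maxIdeal k d, ∀ q : N, ∃ u v : N, f • q = pw k d 0 • u + pw k d 1 • v) →
        betti k d 2 M = prk k d N) := by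
  let G := F.splice₂ ε δ₁ δ₂ hε hex hex' hinj
  -- Minimality kills the first two reduced differentials. The tail resolves `N` and may be
  -- non-minimal, so its ranks stay in the count.
  have r0 : G.rho (constCoeff k d) 0 = 0 := G.rho_eq_zero 0 fun v j => h1 v j
  have r1 : G.rho (constCoeff k d) 1 = 0 := G.rho_eq_zero 1 fun v j => h2 (F.ε v) j
  have e0 := betti_zero G
  have e1 := betti_succ G 0
  have e2 := betti_succ G 1
  have f0 := betti_zero F
  have g2 : G.rho (constCoeff k d) 2 = F.rho (constCoeff k d) 0 := rfl
  have n0 : G.n 0 = r₀ := rfl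
  have n1 : G.n 1 = r₁ := rfl
  have n2 : G.n 2 = F.n 0 := rfl
  have hprk : prk k d (LinearMap.ker (G.δ 0)) = prk k d N := by
    refine (prk_congr ?_).symm
    refine (LinearEquiv.ofInjective δ₂ hinj).trans (LinearEquiv.ofEq _ _ ?_)
    rw [← hex'.linearMap_ker_eq]
    rfl
  have b3 := betti_three_eq G hd
  have b4 := G.prk_ker_add_finrank_range hd
  rw [hprk] at b3 b4
  simp only [Nat.reduceAdd] at e1 e2
  have e2' : betti k d 2 M + G.rho (constCoeff k d) 2 = F.n 0 := by omega
  have e2d := congrArg (d * ·) e2'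
  simp only [mul_add] at e2d
  change _ = F.n 0 * d at b4
  rw [n2] at b3
  rw [mul_comm (F.n 0)] at b3 b4
  refine ⟨by omega, by omega, by omega, by omega, fun hN => ?_⟩
  -- If `𝔪 N = (x^d, y^d) N`, then `b₀(N)` is the dimension of `N/(x^d, y^d)N`, hence the rank of
  -- `N`.
  have h3 := finrank_range_redBar_of_le hd (F.δ 0) (F.ker_augm_le hd hN)
  change Module.finrank k (LinearMap.range (redBarK (G.δ 2))) =
    F.rho (constCoeff k d) 0 + (d - 1) * F.n 0 at h3
  have h4 : d * F.n 0 = F.n 0 + (d - 1) * F.n 0 := by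
    obtain ⟨d, rfl⟩ := Nat.exists_eq_succ_of_ne_zero hd.ne'
    simp
    ring
  omega

/-- The free module `M^{(0)}` of rank one. -/
def mcmZeroEquiv (k : Type u) [Field k] (d : ℕ) : B k d ≃ₗ[B k d] mcm k d 0 where
  toFun b := ⟨incl k d b, incl_mem b⟩
  invFun q := mkB q q.2
  map_add' _ _ := rfl
  map_smul' b c := Subtype.ext (map_mul (incl k d) b c)
  left_inv _ := rfl
  right_inv _ := rfl

/-- The two consequences are the leading coefficient and the constant term of a polynomial identity
in `s`, the first obtained by comparing two consecutive values. -/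
theorem pure_numerics {ℓ D r₀ r₁ r₂ : ℕ} (hℓ : ℓ < d) {s₀ : ℕ}
    (h : ∀ s, s₀ ≤ s →
      r₀ * ((D + 1 + s) * d + 1) + r₂ * (s * d + ℓ + 1) = r₁ * ((1 + s) * d + 1)) :
    r₁ = r₀ + r₂ ∧ r₀ * (D * d) = r₂ * (d - ℓ) := by
  have h1 := h s₀ le_rfl
  have h2 := h (s₀ + 1) (by omega)
  have h3 : r₁ = r₀ + r₂ := by
    have hd : 0 < d := by omega
    refine mul_right_cancel₀ hd.ne' ?_
    zify at h1 h2 ⊢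
    linear_combination h1 - h2
  refine ⟨h3, ?_⟩
  subst h3
  obtain ⟨e, rfl⟩ := Nat.exists_eq_add_of_lt hℓ
  have h4 : ℓ + e + 1 - ℓ = e + 1 := by omega
  rw [h4]
  zify at h1 ⊢
  linear_combination h1

theorem bettiVec_eq {M : Type u} [AddCommGroup M] [Module (B k d) M] {a b c e : ℕ}
    (h0 : betti k d 0 M = a) (h1 : betti k d 1 M = b) (h2 : betti k d 2 M = c)
    (h3 : betti k d 3 M = e) : bettiVec k d M = ![(a : ℚ), b, c, e] := by
  funext i
  fin_cases i
  · exact congrArg Nat.cast h0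
  · exact congrArg Nat.cast h1
  · exact congrArg Nat.cast h2
  · exact congrArg Nat.cast h3

/-- The Hilbert function relates the ranks, and `betti_pure` expresses `b₂` and `b₃` through
`M^(ℓ)`. Only for `ℓ = 0`, where `M^(ℓ)` is free, and for `ℓ = d - 1`, where `𝔪 M^(ℓ) = (x^d, y^d)
M^(ℓ)`, is `b₂` determined here. -/
theorem exists_of_mem_pureBettiVecs (hd : 0 < d) {D ℓ : ℕ} {v : Fin 4 → ℚ}
    (hv : v ∈ pureBettiVecs k d 0 D (D + 1) ℓ) :
    ∃ r₀ r₁ r₂ b₂ b₃ : ℕ, 0 < r₀ ∧ r₁ = r₀ + r₂ ∧ r₀ * (D * d) = r₂ * (d - ℓ) ∧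
      v = ![(r₀ : ℚ), r₁, b₂, b₃] ∧ b₃ + r₂ * d = d * b₂ ∧ (ℓ = 0 → b₂ = r₂) ∧
      (d ≤ ℓ + 1 → b₂ = r₂ * d) := by
  obtain ⟨M, hM, ⟨hℓ, hlen, r₀, r₁, r₂, ε, δ₁, δ₂, hε, hex, hex', hinj, g0, g1, g2, m1, m2⟩, rfl⟩ :=
    hv
  have := isNoetherianRing_B (k := k) hd
  obtain ⟨hfin, hprk⟩ := mcm_finite (k := k) hd hℓ
  obtain ⟨F⟩ := FreeRes.nonempty (R := B k d) (Fin r₂ → mcm k d ℓ)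
  obtain ⟨b0, b1, b2, b4, b5⟩ := betti_pure hd F ε δ₁ δ₂ hε hex hex' hinj m1 m2
  obtain ⟨s₀, hs⟩ := pure_dimension_count hd M hlen ε δ₁ δ₂ hex hex' hinj g0 g1 g2
  obtain ⟨n1, n2⟩ := pure_numerics hℓ hs
  rw [prk_fin_fun hd, hprk] at b4 b5
  refine ⟨r₀, r₁, r₂, _, _, ?_, n1, n2, bettiVec_eq b0 b1 rfl rfl, b4, ?_, ?_⟩
  · rw [Nat.pos_iff_ne_zero]
    rintro rfl
    -- With `r₀ = 0` the module would be zero, contrary to nontriviality; this makes the multiple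
    -- positive.
    obtain ⟨x, hx⟩ := exists_ne (0 : M.carrier)
    obtain ⟨y, rfl⟩ := hε x
    exact hx (by rw [Subsingleton.elim y 0, map_zero])
  · rintro rfl
    rw [b2]
    exact (betti_ofFree (LinearEquiv.piCongrRight fun _ : Fin r₂ => mcmZeroEquiv k d)).1
  · intro hd'
    refine b5 fun f hf q => ?_
    choose u w huw using fun i => smul_mcm_mem hℓ hd' hf (q i)
    exact ⟨u, w, funext huw⟩

theorem mem_pureBettiVecs_zero (hd : 2 ≤ d) {t : ℕ} {v : Fin 4 → ℚ}
    (hv : v ∈ pureBettiVecs k d 0 t (t + 1) 0) :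
    ∃ c : ℚ, 0 < c ∧ v = c • ![1, (t : ℚ) + 1, (t : ℚ), 0] := by
  obtain ⟨r₀, r₁, r₂, b₂, b₃, h0, h1, h2, rfl, h3, h4, -⟩ :=
    exists_of_mem_pureBettiVecs (by omega) hv
  have h5 := h4 rfl
  subst h5
  have h6 : b₂ = r₀ * t := by
    refine mul_right_cancel₀ (b := d) (by omega) ?_
    rw [Nat.sub_zero] at h2
    rw [← h2]
    ring
  have h7 : b₃ = 0 := by
    rw [mul_comm] at h3
    omega
  subst h1 h6 h7
  refine ⟨r₀, by exact_mod_cast h0, ?_⟩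
  ext i
  fin_cases i <;> simp
  ring

theorem mem_pureBettiVecs_sub_one (hd : 2 ≤ d) {t : ℕ} {v : Fin 4 → ℚ}
    (hv : v ∈ pureBettiVecs k d 0 (t * d) (t * d + 1) (d - 1)) :
    ∃ c : ℚ, 0 < c ∧ v = c • ![1, (t : ℚ) * (d : ℚ) ^ 2 + 1, (t : ℚ) * (d : ℚ) ^ 3,
      (t : ℚ) * (d : ℚ) ^ 3 * ((d : ℚ) - 1)] := by
  have hv' : v ∈ pureBettiVecs k d 0 ((t * d : ℕ) : ℤ) (((t * d : ℕ) : ℤ) + 1) (d - 1) := by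
    push_cast
    exact hv
  obtain ⟨r₀, r₁, r₂, b₂, b₃, h0, h1, h2, rfl, h3, -, h4⟩ :=
    exists_of_mem_pureBettiVecs (by omega) hv'
  have h5 := h4 (by omega)
  have h6 : d - (d - 1) = 1 := by omega
  rw [h6, mul_one] at h2
  have h7 : (b₃ : ℚ) = (d : ℚ) * b₂ - b₂ := by
    rw [← h5] at h3
    rw [eq_sub_iff_add_eq]
    exact_mod_cast h3
  subst h5 h1 h2
  refine ⟨r₀, by exact_mod_cast h0, ?_⟩
  ext i
  fin_cases i
  · simp
  · simp
    ring
  · simp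
    ring
  · simp only [Fin.reduceFinMk, Matrix.cons_val, Pi.smul_apply, smul_eq_mul]
    rw [h7]
    push_cast
    ring

end PureBetti

/-! ### Betti vectors of cyclic modules and membership in the cone -/

section Cyclic

variable {k : Type u} [Field k] {d : ℕ}

theorem bettiVec_of_equiv {M : Type u} [AddCommGroup M] [Module (B k d) M] (φ : B k d ≃ₗ[B k d] M) :
    bettiVec k d M = ![1, 0, 0, 0] := by
  obtain ⟨h0, h1⟩ := betti_ofFree ((LinearEquiv.funUnique (Fin 1) (B k d) (B k d)).trans φ)
  have h := bettiVec_eq h0 (h1 0) (h1 1) (h1 2)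
  simpa using h

/-- `B` is a domain, so multiplication by `f` is injective and `0 → B → B → B/(f) → 0` is a minimal
free resolution. -/
theorem bettiVec_quotient_span_singleton {f : B k d} (hf : f ≠ 0) (hm : f ∈ maxIdeal k d) :
    bettiVec k d (B k d ⧸ Ideal.span {f}) = ![1, 1, 0, 0] := by
  let ι : B k d →ₗ[B k d] (Fin 1 → B k d) := LinearMap.pi fun _ => LinearMap.toSpanSingleton _ _ f
  let π : (Fin 1 → B k d) →ₗ[B k d] (B k d ⧸ Ideal.span {f}) :=
    (Submodule.mkQ (Ideal.span {f})) ∘ₗ LinearMap.proj 0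
  let G : FreeRes (B k d) (B k d ⧸ Ideal.span {f}) :=
    (FreeRes.ofFree 1 (LinearEquiv.funUnique (Fin 1) (B k d) (B k d))).splice ι π
      (fun a b h => mul_right_cancel₀ hf (congrFun h 0))
      (fun x => by
        obtain ⟨b, rfl⟩ := Submodule.mkQ_surjective _ x
        exact ⟨fun _ => b, rfl⟩)
      (fun v => by
        refine (Submodule.Quotient.mk_eq_zero _).trans (Ideal.mem_span_singleton'.trans ?_)
        constructor
        · rintro ⟨a, ha⟩
          refine ⟨a, funext fun i => ?_⟩
          obtain rfl : i = 0 := Subsingleton.elim _ _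
          exact ha
        · rintro ⟨a, rfl⟩
          exact ⟨a, rfl⟩)
  have r0 : G.rho (constCoeff k d) 0 = 0 := G.rho_eq_zero 0 fun v j =>
    Ideal.mul_mem_left (maxIdeal k d) _ hm
  have r : ∀ i, G.rho (constCoeff k d) (i + 1) = 0 := fun i => G.rho_eq_zero _ fun v j => by
    change (0 : B k d) ∈ _
    exact zero_mem _
  have e0 : betti k d 0 (B k d ⧸ Ideal.span {f}) + G.rho (constCoeff k d) 0 = 1 := betti_zero G
  have e1 : betti k d 1 (B k d ⧸ Ideal.span {f}) + G.rho (constCoeff k d) 0 +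
      G.rho (constCoeff k d) 1 = 1 := betti_succ G 0
  have e : ∀ i, betti k d (i + 2) (B k d ⧸ Ideal.span {f}) +
      G.rho (constCoeff k d) (i + 1) + G.rho (constCoeff k d) (i + 2) = 0 := fun i =>
    betti_succ G (i + 1)
  rw [r0] at e0 e1
  rw [r 0] at e1
  have h := bettiVec_eq e0 e1 (Nat.eq_zero_of_add_eq_zero_right (Nat.eq_zero_of_add_eq_zero_right (e 0)))
    (Nat.eq_zero_of_add_eq_zero_right (Nat.eq_zero_of_add_eq_zero_right (e 1)))
  simpa using h

theorem bettiVec_mem_totalBettiCone (M : GradedModule k d) [Module.Finite (B k d) M.carrier] :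
    bettiVec k d M.carrier ∈ totalBettiCone k d :=
  Submodule.subset_span ⟨M, inferInstance, rfl⟩

theorem one_zero_mem_totalBettiCone (hd : 0 < d) :
    (![1, 0, 0, 0] : Fin 4 → ℚ) ∈ totalBettiCone k d := by
  let g : Fin 0 → B k d := Fin.elim0
  let M := quotientGraded hd g (fun _ => 0) (fun i => i.elim0)
  have : Module.Finite (B k d) M.carrier :=
    inferInstanceAs (Module.Finite (B k d) (B k d ⧸ Ideal.span (Set.range g)))
  have h : bettiVec k d M.carrier = _ := bettiVec_of_equiv
    (Submodule.quotEquivOfEqBot (Ideal.span (Set.range g)) (by simp)).symm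
  rw [← h]
  exact bettiVec_mem_totalBettiCone M

theorem one_one_mem_totalBettiCone (hd : 0 < d) :
    (![1, 1, 0, 0] : Fin 4 → ℚ) ∈ totalBettiCone k d := by
  let g : Fin 1 → B k d := fun _ => pw k d 0
  let M := quotientGraded hd g (fun _ => 1) (fun i => by
    rw [mem_ringPiece_iff, incl_pw, MvPolynomial.X_pow_eq_monomial]
    exact monomial_mem_polyPiece (by simp) 1)
  have : Module.Finite (B k d) M.carrier :=
    inferInstanceAs (Module.Finite (B k d) (B k d ⧸ Ideal.span (Set.range g)))
  have hJ : ∀ J : Ideal (B k d), J = Ideal.span {pw k d 0} →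
      bettiVec k d (B k d ⧸ J) = ![1, 1, 0, 0] := by
    rintro _ rfl
    exact bettiVec_quotient_span_singleton
      (fun h => pow_ne_zero d (MvPolynomial.X_ne_zero (R := k) (0 : Fin 2)) (congrArg (incl k d) h))
      (pw_mem_maxIdeal hd 0)
  have h : bettiVec k d M.carrier = _ := hJ _ (congrArg Ideal.span Set.range_const)
  rw [← h]
  exact bettiVec_mem_totalBettiCone M

theorem pureBettiVecs_subset (D₀ D₁ D₂ : ℤ) (ℓ : ℕ) :
    pureBettiVecs k d D₀ D₁ D₂ ℓ ⊆ totalBettiCone k d := by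
  rintro _ ⟨M, -, ⟨-, -, r₀, -, -, ε, -, -, hε, -⟩, rfl⟩
  have : Module.Finite (B k d) M.carrier := Module.Finite.of_surjective ε hε
  exact bettiVec_mem_totalBettiCone M

theorem eq_zero_of_mem_totalBettiCone (hd : 0 < d) {v : Fin 4 → ℚ} (hv : v ∈ totalBettiCone k d)
    (h : v 0 = 0) : v = 0 := by
  have := isNoetherianRing_B (k := k) hd
  -- Nonnegativity is carried along so that a sum with vanishing first entry has summands with
  -- vanishing first entry. For a single module, `b₀ = 0` means `M = 𝔪 M`, hence `M = 0`.
  suffices key : 0 ≤ v 0 ∧ (v 0 = 0 → v = 0) from key.2 h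
  clear h
  induction hv using Submodule.span_induction with
  | mem v hv =>
    obtain ⟨M, hM, rfl⟩ := hv
    refine ⟨Nat.cast_nonneg _, fun h => ?_⟩
    obtain ⟨F⟩ := FreeRes.nonempty (R := B k d) M.carrier
    have h0 : betti k d 0 M.carrier = 0 := Nat.cast_eq_zero.1 h
    have hsub := M.subsingleton_of_smul_top (smul_top_eq_top_of_betti_zero F h0)
    obtain ⟨-, h1⟩ := betti_ofFree (k := k) (d := d) (M := M.carrier) (r := 0)
      { toFun := fun _ => 0, invFun := fun _ => 0, map_add' := fun _ _ => (add_zero 0).symm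
        map_smul' := fun _ _ => (smul_zero _).symm, left_inv := fun _ => Subsingleton.elim _ _
        right_inv := fun _ => Subsingleton.elim _ _ }
    rw [bettiVec_eq h0 (h1 0) (h1 1) (h1 2)]
    simp
  | zero => simp
  | add x y _ _ hx hy =>
    refine ⟨add_nonneg hx.1 hy.1, fun h => ?_⟩
    obtain ⟨h1, h2⟩ := (add_eq_zero_iff_of_nonneg hx.1 hy.1).1 h
    rw [hx.2 h1, hy.2 h2, add_zero]
  | smul c x _ hx =>
    refine ⟨mul_nonneg c.2 hx.1, fun h => ?_⟩
    rcases mul_eq_zero.1 h with h | h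
    · rw [Subtype.ext (a1 := c) (a2 := 0) h, zero_smul]
    · rw [hx.2 h, smul_zero]

end Cyclic

/-! ### Extremal rays of a simplicial cone -/

section SimplicialCone

/-- In the coordinates `T` the cone is the nonnegative orthant, whose extremal rays are the
coordinate axes. -/
theorem isExtremalRay_simplicial (u : Fin 4 → Fin 4 → ℚ) (T : (Fin 4 → ℚ) →ₗ[ℚ] (Fin 4 → ℚ))
    (hT : ∀ b, ∑ i, T b i • u i = b) (hu : ∀ i, T (u i) = Pi.single i 1) :
    {R | IsExtremalRay {b | ∀ i, 0 ≤ T b i} R} = Set.range fun i => ray (u i) := by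
  have hne : ∀ i, u i ≠ 0 := fun i h => by
    have h1 := congrFun (hu i) i
    rw [h, map_zero] at h1
    simp at h1
  ext R
  constructor
  · rintro ⟨⟨v, hv, rfl⟩, hsub, hext⟩
    have hv1 : v ∈ ray v := ⟨1, zero_le_one, (one_smul _ _).symm⟩
    obtain ⟨i, hi⟩ : ∃ i, T v i ≠ 0 := by
      by_contra! h
      apply hv
      rw [← hT v]
      simp [h]
    have hi' : 0 < T v i := lt_of_le_of_ne (hsub hv1 i) hi.symm
    -- The vector `v` is the midpoint of `2 T_i(v) u_i` and twice the rest, both in the cone.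
    -- Extremality puts the first on the ray of `v`, so `v` is a multiple of `u_i`.
    obtain ⟨c, hc, h⟩ := hext (x := (2 * T v i) • u i) (fun j => by
        rw [map_smul, hu]
        by_cases hij : j = i
        · subst hij
          simpa using hi'.le
        · simp [Pi.single_eq_of_ne hij])
      (y := (2 : ℚ) • (v - T v i • u i)) (fun j => by
        rw [map_smul, map_sub, map_smul, hu]
        by_cases hij : j = i
        · subst hij
          simp
        · simpa [Pi.single_eq_of_ne hij] using hsub hv1 j)
      hv1 ⟨1 / 2, 1 / 2, by norm_num, by norm_num, by norm_num, by
        rw [smul_smul, smul_smul, ← mul_assoc]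
        norm_num⟩
    have hc0 : c ≠ 0 := by
      rintro rfl
      rw [zero_smul, smul_eq_zero] at h
      exact h.elim (by positivity) (hne i)
    have hvu : v = (c⁻¹ * (2 * T v i)) • u i := by
      rw [mul_smul, h, smul_smul, inv_mul_cancel₀ hc0, one_smul]
    refine ⟨i, ?_⟩
    have hs : 0 < c⁻¹ * (2 * T v i) := by positivity
    generalize c⁻¹ * (2 * T v i) = s at hvu hs
    ext w
    constructor
    · rintro ⟨a, ha, rfl⟩
      refine ⟨a * s⁻¹, by positivity, ?_⟩
      rw [hvu, smul_smul, mul_assoc, inv_mul_cancel₀ hs.ne', mul_one]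
    · rintro ⟨a, ha, rfl⟩
      refine ⟨a * s, by positivity, ?_⟩
      conv_lhs => rw [hvu, smul_smul]
  · rintro ⟨i, rfl⟩
    refine ⟨⟨u i, hne i, rfl⟩, ?_, ?_⟩
    · rintro _ ⟨c, hc, rfl⟩ j
      rw [map_smul, hu]
      by_cases hij : j = i
      · subst hij
        simpa using hc
      · simp [Pi.single_eq_of_ne hij]
    · rintro x hx y hy z ⟨c, hc, rfl⟩ ⟨a, b, ha, hb, -, hab⟩
      refine ⟨T x i, hx i, ?_⟩
      conv_lhs => rw [← hT x]
      -- For `j ≠ i` the coordinates of a combination on the ray of `u_i` vanish. They are positive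
      -- combinations of nonnegative numbers, so the `j`-th coordinate of `x` vanishes too.
      refine Finset.sum_eq_single i (fun j _ hij => ?_) (by simp)
      have h1 := congrFun (congrArg T hab) j
      rw [map_add, map_smul, map_smul, map_smul, hu] at h1
      simp only [Pi.add_apply, Pi.smul_apply, smul_eq_mul, Pi.single_eq_of_ne hij, mul_zero] at h1
      have h2 := ((add_eq_zero_iff_of_nonneg (mul_nonneg ha.le (hx j))
        (mul_nonneg hb.le (hy j))).1 h1).1
      rw [(mul_eq_zero.1 h2).resolve_left ha.ne', zero_smul]

end SimplicialCone

/-! ### The closure of the cone and the limiting rays -/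

section ConeDescription

/-- The coordinates of a vector with respect to the generators of the extremal rays. -/
def rayCoord (d : ℚ) : (Fin 4 → ℚ) →ₗ[ℚ] (Fin 4 → ℚ) where
  toFun b := ![b 0 - b 1 + b 2 - b 3 / d, b 1 - b 2 + b 3 / d, b 2 - b 3 / (d - 1),
    b 3 / (d * (d - 1))]
  map_add' x y := by
    ext i
    fin_cases i <;> simp <;> ring
  map_smul' c x := by
    ext i
    fin_cases i <;> simp <;> ring

/-- The generators of the extremal rays. -/
def rayGen (d : ℚ) : Fin 4 → Fin 4 → ℚ :=
  ![![1, 0, 0, 0], ![1, 1, 0, 0], ![0, 1, 1, 0], ![0, 1, d, d * (d - 1)]]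

theorem sum_rayCoord_smul_rayGen {d : ℚ} (h0 : d ≠ 0) (h1 : d - 1 ≠ 0) (b : Fin 4 → ℚ) :
    ∑ i, rayCoord d b i • rayGen d i = b := by
  ext i
  fin_cases i <;> simp [Fin.sum_univ_four, rayCoord, rayGen] <;> field_simp <;> ring

theorem rayCoord_rayGen {d : ℚ} (h0 : d ≠ 0) (h1 : d - 1 ≠ 0) (i : Fin 4) :
    rayCoord d (rayGen d i) = Pi.single i 1 := by
  ext j
  fin_cases i <;> fin_cases j <;> simp [rayCoord, rayGen, h0, h1]
  field_simp
  ring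

theorem setOf_rayCoord_nonneg {d : ℚ} (hd : 1 < d) :
    {b | ∀ i, 0 ≤ rayCoord d b i} =
      {b | 0 ≤ b 3 ∧ b 3 / (d - 1) ≤ b 2 ∧ b 2 - b 3 / d ≤ b 1 ∧ b 1 - b 2 + b 3 / d ≤ b 0} := by
  ext b
  have h1 : 0 < d * (d - 1) := mul_pos (by linarith) (by linarith)
  have h2 : 0 ≤ b 3 / (d * (d - 1)) ↔ 0 ≤ b 3 := by
    rw [le_div_iff₀ h1, zero_mul]
  change (∀ i, 0 ≤ rayCoord d b i) ↔ _ ∧ _ ∧ _ ∧ _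
  rw [Fin.forall_fin_succ, Fin.forall_fin_succ, Fin.forall_fin_succ, Fin.forall_fin_one]
  change 0 ≤ b 0 - b 1 + b 2 - b 3 / d ∧ 0 ≤ b 1 - b 2 + b 3 / d ∧ 0 ≤ b 2 - b 3 / (d - 1) ∧
    0 ≤ b 3 / (d * (d - 1)) ↔ _
  rw [h2]
  constructor
  · rintro ⟨h3, h4, h5, h6⟩
    exact ⟨h6, by linarith, by linarith, by linarith⟩
  · rintro ⟨h3, h4, h5, h6⟩
    exact ⟨by linarith, by linarith, by linarith, h3⟩

theorem isClosed_polyhedron (d : ℚ) : IsClosed {b : Fin 4 → ℚ | 0 ≤ b 3 ∧ b 3 / (d - 1) ≤ b 2 ∧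
    b 2 - b 3 / d ≤ b 1 ∧ b 1 - b 2 + b 3 / d ≤ b 0} := by
  simp only [Set.ofPred_and]
  refine (isClosed_le ?_ ?_).inter ((isClosed_le ?_ ?_).inter ((isClosed_le ?_ ?_).inter
    (isClosed_le ?_ ?_))) <;> fun_prop

variable {k : Type u} [Field k] {d : ℕ}

theorem rayCoord_bettiVec_nonneg (hd : 2 ≤ d) (M : Type u) [AddCommGroup M] [Module (B k d) M]
    [Module.Finite (B k d) M] (i : Fin 4) : 0 ≤ rayCoord d (bettiVec k d M) i := by
  have := isNoetherianRing_B (k := k) (d := d) (by omega)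
  obtain ⟨F⟩ := FreeRes.nonempty (R := B k d) M
  have hd1 : (1 : ℚ) < d := by exact_mod_cast hd
  have hd0 : (0 : ℚ) < d := by linarith
  -- This gives the bound on `b₂`. In the alternating relation, `0 ≤ rank M` bounds `b₀`, and `rank
  -- M ≤ d b₀` bounds `b₁`.
  have h1 : (betti k d 3 M : ℚ) ≤ ((d : ℚ) - 1) * betti k d 2 M := by
    have h := betti_three_le F (by omega)
    rw [← Nat.cast_one, ← Nat.cast_sub (by omega)]
    exact_mod_cast h
  have h2 : (d : ℚ) * betti k d 0 M + d * betti k d 2 M =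
      d * betti k d 1 M + betti k d 3 M + prk k d M := by
    exact_mod_cast betti_alternating F (by omega)
  have h3 : (prk k d M : ℚ) ≤ betti k d 0 M * d := by
    exact_mod_cast prk_le_betti_zero F (by omega)
  have h4 : (0 : ℚ) ≤ prk k d M := Nat.cast_nonneg _
  revert i
  change bettiVec k d M ∈ {b | ∀ i, 0 ≤ rayCoord d b i}
  rw [setOf_rayCoord_nonneg hd1]
  change (0 : ℚ) ≤ betti k d 3 M ∧ (betti k d 3 M : ℚ) / (d - 1) ≤ betti k d 2 M ∧
    (betti k d 2 M : ℚ) - betti k d 3 M / d ≤ betti k d 1 M ∧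
    (betti k d 1 M : ℚ) - betti k d 2 M + betti k d 3 M / d ≤ betti k d 0 M
  generalize (betti k d 0 M : ℚ) = b0 at *
  generalize (betti k d 1 M : ℚ) = b1 at *
  generalize (betti k d 2 M : ℚ) = b2 at *
  have h5 : (betti k d 3 M : ℚ) / d * d = betti k d 3 M := div_mul_cancel₀ _ hd0.ne'
  refine ⟨Nat.cast_nonneg _, ?_, ?_, ?_⟩
  · rw [div_le_iff₀ (by linarith)]
    linarith
  · refine le_of_mul_le_mul_right ?_ hd0
    rw [sub_mul, h5]
    linarith
  · refine le_of_mul_le_mul_right ?_ hd0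
    rw [add_mul, sub_mul, h5]
    linarith

theorem tendsto_inv_smul_add {s : ℕ → ℚ} (hs : Tendsto s atTop atTop) (v w : Fin 4 → ℚ) :
    Tendsto (fun t => (s t)⁻¹ • w + v) atTop (𝓝 v) := by
  have h := ((tendsto_inv_atTop_zero.comp hs).smul_const w).add_const v
  simpa using h

theorem tendsto_ray_two : Tendsto (fun t : ℕ => (1 / (t : ℚ)) •
    (![1, (t : ℚ) + 1, (t : ℚ), 0] : Fin 4 → ℚ)) atTop (𝓝 ![0, 1, 1, 0]) := by
  -- The scaled vector is `(1/t)(1, 1, 0, 0)` plus the limit.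
  refine (tendsto_inv_smul_add tendsto_natCast_atTop_atTop _ ![1, 1, 0, 0]).congr' ?_
  filter_upwards [eventually_ge_atTop 1] with t ht
  have ht0 : (t : ℚ) ≠ 0 := by positivity
  ext i
  fin_cases i <;> simp <;> field_simp
  ring

theorem tendsto_ray_three {d : ℚ} (hd : 0 < d) : Tendsto (fun t : ℕ => (1 / ((t : ℚ) * d ^ 2)) •
    (![1, (t : ℚ) * d ^ 2 + 1, (t : ℚ) * d ^ 3, (t : ℚ) * d ^ 3 * (d - 1)] : Fin 4 → ℚ)) atTop
      (𝓝 ![0, 1, d, d * (d - 1)]) := by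
  -- Again `(1, 1, 0, 0)` is the error vector, now with scale `t d²`.
  refine (tendsto_inv_smul_add (s := fun t : ℕ => (t : ℚ) * d ^ 2)
    (tendsto_natCast_atTop_atTop.atTop_mul_const (by positivity)) _ ![1, 1, 0, 0]).congr' ?_
  filter_upwards [eventually_ge_atTop 1] with t ht
  have ht0 : (t : ℚ) ≠ 0 := by positivity
  ext i
  fin_cases i <;> simp <;> field_simp
  ring

theorem mem_closure_of_pure {v : Fin 4 → ℚ} {s : ℕ → ℚ} {w : ℕ → Fin 4 → ℚ}
    (hs : ∀ t, 0 ≤ s t)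
    (hw : ∀ t, 1 ≤ t → ∃ x ∈ totalBettiCone k d, ∃ c : ℚ, 0 < c ∧ x = c • w t)
    (h : Tendsto (fun t => s t • w t) atTop (𝓝 v)) :
    v ∈ closure (totalBettiCone k d : Set (Fin 4 → ℚ)) := by
  refine mem_closure_of_tendsto h ?_
  filter_upwards [eventually_ge_atTop 1] with t ht
  obtain ⟨x, hx, c, hc, rfl⟩ := hw t ht
  have h1 : s t • w t = (s t * c⁻¹) • c • w t := by
    rw [smul_smul, mul_assoc, inv_mul_cancel₀ hc.ne', mul_one]
  rw [h1]
  exact (totalBettiCone k d).smul_mem (mul_nonneg (hs t) (by positivity)) hx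

theorem pureBettiVecs_zero_nonempty (hd : 2 ≤ d) {t : ℕ} (ht : 1 ≤ t) :
    (pureBettiVecs k d 0 t (t + 1) 0).Nonempty :=
  pureBettiVecs_nonempty (ℓ := 0) (e := d) (by omega) (by omega) t t rfl (by omega)

theorem pureBettiVecs_sub_one_nonempty (hd : 2 ≤ d) {t : ℕ} (ht : 1 ≤ t) :
    (pureBettiVecs k d 0 (t * d) (t * d + 1) (d - 1)).Nonempty := by
  -- Here `e = 1`, and `T = t d²` powers produce generators of degree `D = t d` in `B`.
  have h := pureBettiVecs_nonempty (k := k) (d := d) (ℓ := d - 1) (e := 1) (by omega) (by omega)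
    (t * d * d) (t * d) (by ring) (by positivity)
  push_cast at h
  exact h

theorem rayGen_mem_closure (hd : 2 ≤ d) (i : Fin 4) :
    rayGen d i ∈ closure (totalBettiCone k d : Set (Fin 4 → ℚ)) := by
  fin_cases i
  · exact subset_closure (one_zero_mem_totalBettiCone (by omega))
  · exact subset_closure (one_one_mem_totalBettiCone (by omega))
  · refine mem_closure_of_pure (fun t => by positivity) (fun t ht => ?_) tendsto_ray_two
    obtain ⟨x, hx⟩ := pureBettiVecs_zero_nonempty (k := k) hd ht
    exact ⟨x, pureBettiVecs_subset _ _ _ _ hx, mem_pureBettiVecs_zero hd hx⟩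
  · refine mem_closure_of_pure (fun t => by positivity) (fun t ht => ?_)
      (tendsto_ray_three (by positivity))
    obtain ⟨x, hx⟩ := pureBettiVecs_sub_one_nonempty (k := k) hd ht
    exact ⟨x, pureBettiVecs_subset _ _ _ _ hx, mem_pureBettiVecs_sub_one hd hx⟩

theorem closure_totalBettiCone (hd : 2 ≤ d) :
    closure (totalBettiCone k d : Set (Fin 4 → ℚ)) = {b | ∀ i, 0 ≤ rayCoord d b i} := by
  have hd1 : (1 : ℚ) < d := by exact_mod_cast hd
  apply Set.Subset.antisymm
  · refine closure_minimal ?_ ?_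
    · intro v hv
      change v ∈ totalBettiCone k d at hv
      induction hv using Submodule.span_induction with
      | mem v hv =>
        obtain ⟨M, hM, rfl⟩ := hv
        exact rayCoord_bettiVec_nonneg hd M.carrier
      | zero => simp
      | add x y _ _ hx hy =>
        intro i
        rw [map_add]
        exact add_nonneg (hx i) (hy i)
      | smul c x _ hx =>
        intro i
        have h : rayCoord d (c • x) = (c : ℚ) • rayCoord d x := map_smul _ (c : ℚ) x
        rw [h]
        exact mul_nonneg c.2 (hx i)
    · rw [setOf_rayCoord_nonneg hd1]
      exact isClosed_polyhedron _
  · intro b hb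
    -- Closures of pointed cones are again pointed cones, so it suffices that the four generators
    -- lie in the closure.
    rw [← sum_rayCoord_smul_rayGen (d := d) (by linarith) (by linarith) b]
    change _ ∈ (totalBettiCone k d).closure
    exact Submodule.sum_mem _ fun i _ =>
      (totalBettiCone k d).closure.smul_mem (hb i) (rayGen_mem_closure hd i)

theorem smul_notMem_totalBettiCone (hd : 0 < d) {c : ℚ} (hc : 0 < c) {v : Fin 4 → ℚ}
    (h0 : v 0 = 0) (h1 : v 1 ≠ 0) : c • v ∉ totalBettiCone k d := fun h => by
  have h2 := congrFun (eq_zero_of_mem_totalBettiCone hd h (by simp [h0])) 1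
  exact (mul_ne_zero hc.ne' h1) h2

end ConeDescription

end RationalNormalCurve

end

theorem mainTheorem3 (k : Type u) [Field k] (d : ℕ) (hd : 2 ≤ d) :
    -- the closure of the cone
    closure (RationalNormalCurve.totalBettiCone k d : Set (Fin 4 → ℚ)) =
      {b | 0 ≤ b 3 ∧ b 3 / ((d : ℚ) - 1) ≤ b 2 ∧ b 2 - b 3 / (d : ℚ) ≤ b 1 ∧
        b 1 - b 2 + b 3 / (d : ℚ) ≤ b 0} ∧
    -- its extremal rays
    {R | RationalNormalCurve.IsExtremalRay
        (closure (RationalNormalCurve.totalBettiCone k d : Set (Fin 4 → ℚ))) R} =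
      {RationalNormalCurve.ray ![1, 0, 0, 0], RationalNormalCurve.ray ![1, 1, 0, 0],
        RationalNormalCurve.ray ![0, 1, 1, 0],
        RationalNormalCurve.ray ![0, 1, (d : ℚ), (d : ℚ) * ((d : ℚ) - 1)]} ∧
    -- the first two come from modules
    RationalNormalCurve.bettiVec k d (RationalNormalCurve.B k d) = ![1, 0, 0, 0] ∧
    (∀ (n : ℤ) (f : RationalNormalCurve.B k d), 0 < n → f ∈ RationalNormalCurve.ringPiece k d n →
      f ≠ 0 →
      RationalNormalCurve.bettiVec k d (RationalNormalCurve.B k d ⧸ Ideal.span {f}) =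
        ![1, 1, 0, 0]) ∧
    -- the last two do not lie in the cone
    (∀ c : ℚ, 0 < c → c • ![0, 1, 1, 0] ∉ RationalNormalCurve.totalBettiCone k d) ∧
    (∀ c : ℚ, 0 < c → c • ![0, 1, (d : ℚ), (d : ℚ) * ((d : ℚ) - 1)] ∉
      RationalNormalCurve.totalBettiCone k d) ∧
    -- the ray of `(0, 1, 1, 0)` is the limit of the rays of pure modules of type `(0, t, t + 1; 0)`
    (∀ t : ℕ, 1 ≤ t →
      (RationalNormalCurve.pureBettiVecs k d 0 t (t + 1) 0).Nonempty ∧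
      ∀ v ∈ RationalNormalCurve.pureBettiVecs k d 0 t (t + 1) 0,
        ∃ c : ℚ, 0 < c ∧ v = c • ![1, (t : ℚ) + 1, (t : ℚ), 0]) ∧
    Tendsto (fun t : ℕ => (1 / (t : ℚ)) • (![1, (t : ℚ) + 1, (t : ℚ), 0] : Fin 4 → ℚ)) atTop
      (𝓝 ![0, 1, 1, 0]) ∧
    -- the ray of `(0, 1, d, d(d - 1))` is the limit of the rays of pure modules of type
    -- `(0, td, td + 1; d - 1)`
    (∀ t : ℕ, 1 ≤ t →
      (RationalNormalCurve.pureBettiVecs k d 0 (t * d) (t * d + 1) (d - 1)).Nonempty ∧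
      ∀ v ∈ RationalNormalCurve.pureBettiVecs k d 0 (t * d) (t * d + 1) (d - 1),
        ∃ c : ℚ, 0 < c ∧ v = c • ![1, (t : ℚ) * (d : ℚ) ^ 2 + 1, (t : ℚ) * (d : ℚ) ^ 3,
          (t : ℚ) * (d : ℚ) ^ 3 * ((d : ℚ) - 1)]) ∧
    Tendsto (fun t : ℕ => (1 / ((t : ℚ) * (d : ℚ) ^ 2)) •
        (![1, (t : ℚ) * (d : ℚ) ^ 2 + 1, (t : ℚ) * (d : ℚ) ^ 3,
          (t : ℚ) * (d : ℚ) ^ 3 * ((d : ℚ) - 1)] : Fin 4 → ℚ)) atTop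
      (𝓝 ![0, 1, (d : ℚ), (d : ℚ) * ((d : ℚ) - 1)]) := by
  have hd0 : 0 < d := by omega
  have hd1 : (1 : ℚ) < d := by exact_mod_cast hd
  have hcl := RationalNormalCurve.closure_totalBettiCone (k := k) hd
  refine ⟨?_, ?_, ?_, ?_, ?_, ?_, ?_, RationalNormalCurve.tendsto_ray_two, ?_,
    RationalNormalCurve.tendsto_ray_three (by linarith)⟩
  · rw [hcl, RationalNormalCurve.setOf_rayCoord_nonneg hd1]
  · rw [hcl, RationalNormalCurve.isExtremalRay_simplicial (RationalNormalCurve.rayGen d)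
      (RationalNormalCurve.rayCoord d)
      (RationalNormalCurve.sum_rayCoord_smul_rayGen (by linarith) (by linarith))
      (RationalNormalCurve.rayCoord_rayGen (by linarith) (by linarith))]
    ext R
    simp only [Set.mem_range, Set.mem_insert_iff, Set.mem_singleton_iff]
    constructor
    · rintro ⟨i, rfl⟩
      fin_cases i
      exacts [Or.inl rfl, Or.inr (Or.inl rfl), Or.inr (Or.inr (Or.inl rfl)),
        Or.inr (Or.inr (Or.inr rfl))]
    · rintro (rfl | rfl | rfl | rfl)
      exacts [⟨0, rfl⟩, ⟨1, rfl⟩, ⟨2, rfl⟩, ⟨3, rfl⟩]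
  · exact RationalNormalCurve.bettiVec_of_equiv (LinearEquiv.refl _ _)
  · intro n f hn hf hf0
    exact RationalNormalCurve.bettiVec_quotient_span_singleton hf0
      (RationalNormalCurve.mem_maxIdeal_of_mem_ringPiece (by positivity) hf)
  · intro c hc
    exact RationalNormalCurve.smul_notMem_totalBettiCone hd0 hc rfl one_ne_zero
  · intro c hc
    exact RationalNormalCurve.smul_notMem_totalBettiCone hd0 hc rfl one_ne_zero
  · intro t ht
    exact ⟨RationalNormalCurve.pureBettiVecs_zero_nonempty hd ht, fun v hv =>
      RationalNormalCurve.mem_pureBettiVecs_zero hd hv⟩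
  · intro t ht
    exact ⟨RationalNormalCurve.pureBettiVecs_sub_one_nonempty hd ht, fun v hv =>
      RationalNormalCurve.mem_pureBettiVecs_sub_one hd hv⟩
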